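/- Setting. A link function is a sequence of symmetric maps $L_n:\{1,\dots,n\}^2\to T$ into a label set $T$ (e.g. $\mathbb Z_+$ or $\mathbb Z_+^2$); write $L=L_n$. It satisfies Property B if $\sup_{n,t,i}\#\{l\le n: L_n(i,l)=t\}<\infty$. Let $k_n$ be the number of distinct labels in $(L_n(i,j))_{i,j\le n}$ and $\alpha_n$ the maximal number of occurrences of one label; the growth conditions are $k_n\to\infty$ and $k_n\alpha_n=O(n^2)$. Given real random variables $(x_t)_{t\in T}$, called the input sequence, the patterned matrix is $X_n=(x_{L_n(i,j)})_{i,j\le n}$. The assumptions on an input sequence are: (A1) independent, uniformly bounded, mean $0$, variance $1$; (A2) i.i.d., mean $0$, variance $1$; (A3) independent, mean $0$, variance $1$, with uniformly bounded moments of every order. A word of length $h$ is a sequence $w$ of $h$ letters whose first occurrences are in alphabetical order. It is pair-matched if each letter occurs exactly twice; $\mathcal W_{2k}$ is the set of pair-matched words of length $2k$. A word $w\in\mathcal W_{2k}$ is Catalan if $k=1$ (so $w=aa$), or if it contains a double letter whose deletion leaves a Catalan word of length $2k-2$ (up to renaming letters). For a link function $L$ let $\Pi_L(w)$ be the set of maps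 $\pi:\{0,\dots,h\}\to\{1,\dots,n\}$ with $\pi(0)=\pi(h)$ such that, for all $i,j$, $w[i]=w[j]$ if and only if $L(\pi(i-1),\pi(i))=L(\pi(j-1),\pi(j))$. For $w,w'\in\mathcal W_{2k}$, $k\ge1$, put $$p_Z(w,w')=\lim_{n\to\infty}n^{-(1+k)}\,\#\big(\Pi_{L_X}(w)\cap\Pi_{L_Y}(w')\big)$$ when this limit exists. Write $(L_X,L_Y)\rightsquigarrow L_W$ if, for all $k\ge 1$ and $w\in\mathcal W_{2k}$, $p_Z(w,w)$ exists and equals $1$ if $w$ is Catalan and $0$ otherwise. Call $L_X,L_Y$ compatible if, for all $k\ge1$, $p_Z(w,w')$ exists and equals $0$ for all distinct $w,w'\in\mathcal W_{2k}$. Statement. Let $L_X$ and $L_Y$ be symmetric link functions satisfying Property B. (1) Suppose that $L_X,L_Y$ are compatible and $(L_X,L_Y)\rightsquigarrow L_W$. Let $X_n,Y_n$ be the patterned matrices with links $L_X,L_Y$ whose input sequences are independent of each other, each satisfying (A1), (A2) or (A3); unless both satisfy (A1), assume also that $L_X$ and $L_Y$ satisfy the growth conditions. Then the limiting spectral distribution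 of $n^{-1/2}X_n\odot Y_n$ ($\odot$ is the entrywise product) is the semicircular law with density $\frac1{2\pi}\sqrt{4-s^2}$ on $[-2,2]$: the empirical spectral distribution functions converge to its distribution function, in probability, at every continuity point of the latter. If moreover each of the two input sequences satisfies (A1) or (A3), or if the link functions do not depend on $n$ (that is, $L_n(i,j)=L_m(i,j)$ for $i,j\le m\le n$, for both links), then this convergence holds almost surely. (2) If $L_X$ and $L_Y$ together determine the Wigner link $L_W(i,j)=(\min\{i,j\},\max\{i,j\})$, i.e. for every $n$ and $i,j,k,l\le n$ the equalities $L_X(i,j)=L_X(k,l)$ and $L_Y(i,j)=L_Y(k,l)$ imply $L_W(i,j)=L_W(k,l)$, then $(L_X,L_Y)\rightsquigarrow L_W$. -/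

import Mathlib

open MeasureTheory ProbabilityTheory Filter Topology Asymptotics

noncomputable section

namespace SchurHadamard

/-! ## Link functions -/

/-- A symmetric link function with labels in `ι`: for every `n` a symmetric function on
`{1, …, n}²` (indexed by `Fin n`). It may depend on `n`. -/
structure SymLink (ι : Type*) where
  val : ∀ n : ℕ, Fin n → Fin n → ι
  symm : ∀ (n : ℕ) (i j : Fin n), val n i j = val n j i

/-- The Wigner link function `(i, j) ↦ (min i j, max i j)`. -/
def wignerLink : SymLink (ℕ × ℕ) where
  val := fun _ i j => (min (i : ℕ) (j : ℕ), max (i : ℕ) (j : ℕ))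
  symm := fun _ i j => by rw [min_comm, max_comm]

/-- Property B: the number of occurrences of a label in a row is uniformly bounded. -/
def SymLink.PropertyB {ι : Type*} (L : SymLink ι) : Prop :=
  ∃ D : ℕ, ∀ (n : ℕ) (t : ι) (i : Fin n), {l : Fin n | L.val n i l = t}.ncard ≤ D

/-- The number of labels that occur in the `n × n` matrix. -/
def SymLink.numLabels {ι : Type*} (L : SymLink ι) (n : ℕ) : ℕ :=
  (Set.range fun q : Fin n × Fin n => L.val n q.1 q.2).ncard

/-- The maximal number of occurrences of one label in the `n × n` matrix. -/
def SymLink.maxOccurrences {ι : Type*} (L : SymLink ι) (n : ℕ) : ℕ :=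
  ⨆ t : ι, {q : Fin n × Fin n | L.val n q.1 q.2 = t}.ncard

/-- `k_n → ∞` and `k_n α_n = O(n²)`. -/
def SymLink.GrowthConditions {ι : Type*} (L : SymLink ι) : Prop :=
  Tendsto L.numLabels atTop atTop ∧
    (fun n : ℕ => ((L.numLabels n * L.maxOccurrences n : ℕ) : ℝ)) =O[atTop]
      fun n : ℕ => (n : ℝ) ^ 2

/-- The link function does not depend on `n`: each `L_n` extends every `L_m` with `m ≤ n`. -/
def SymLink.Consistent {ι : Type*} (L : SymLink ι) : Prop :=
  ∀ (m n : ℕ) (h : m ≤ n) (i j : Fin m),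
    L.val n (Fin.castLE h i) (Fin.castLE h j) = L.val m i j

/-- `L_X` and `L_Y` together determine the Wigner link function. -/
def DetermineWigner {ι κ : Type*} (LX : SymLink ι) (LY : SymLink κ) : Prop :=
  ∀ (n : ℕ) (i j k l : Fin n), LX.val n i j = LX.val n k l → LY.val n i j = LY.val n k l →
    wignerLink.val n i j = wignerLink.val n k l

/-! ## Words and circuits -/

/-- Words of length `h` (letters are natural numbers) in which first occurrences of letters are in
alphabetical order: every letter smaller than the current one has already occurred. -/
structure Word (h : ℕ) where
  letter : Fin h → ℕ
  ordered : ∀ (i : Fin h) (a : ℕ), a < letter i → ∃ j : Fin h, j < i ∧ letter j = a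

/-- Every letter of the word occurs exactly twice. -/
def Word.PairMatched {h : ℕ} (w : Word h) : Prop :=
  ∀ i : Fin h, {j : Fin h | w.letter j = w.letter i}.ncard = 2

/-- Catalan sequences of letters: a double letter, or a sequence containing a double letter (whose
letter does not occur elsewhere) whose deletion leaves a Catalan sequence. -/
inductive CatalanList : List ℕ → Prop
  | double (a : ℕ) : CatalanList [a, a]
  | insert (u v : List ℕ) (a : ℕ) (ha : a ∉ u ++ v) (huv : CatalanList (u ++ v)) :
      CatalanList (u ++ a :: a :: v)

/-- Catalan words. -/
def Word.IsCatalan {h : ℕ} (w : Word h) : Prop := CatalanList (List.ofFn w.letter)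

/-- The circuits `π : {0, …, h} → {1, …, n}`, `π 0 = π h`, in the class of the word `w`: the
`i`-th and `j`-th edges have the same label if and only if `w[i] = w[j]`. -/
def circuitClass {ι : Type*} (L : SymLink ι) (n : ℕ) {h : ℕ} (w : Word h) :
    Set (Fin (h + 1) → Fin n) :=
  {π | π 0 = π (Fin.last h) ∧ ∀ i j : Fin h, w.letter i = w.letter j ↔
    L.val n (π i.castSucc) (π i.succ) = L.val n (π j.castSucc) (π j.succ)}

/-- The limit `p_Z(w, w')` of `n^{-(1+k)} #(Π_X(w) ∩ Π_Y(w'))` exists and equals `p`. -/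
def HasWordLimit {ι κ : Type*} (LX : SymLink ι) (LY : SymLink κ) {k : ℕ}
    (w w' : Word (2 * k)) (p : ℝ) : Prop :=
  Tendsto (fun n : ℕ => ((circuitClass LX n w ∩ circuitClass LY n w').ncard : ℝ) /
    (n : ℝ) ^ (k + 1)) atTop (𝓝 p)

/-- Compatibility: `p_Z(w, w') = 0` for distinct pair-matched words `w`, `w'`. -/
def Compatible {ι κ : Type*} (LX : SymLink ι) (LY : SymLink κ) : Prop :=
  ∀ (k : ℕ) (w w' : Word (2 * k)), 1 ≤ k → w.PairMatched → w'.PairMatched → w ≠ w' →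
    HasWordLimit LX LY w w' 0

open Classical in
/-- The relation `(L_X, L_Y) ⇝ L_W`: for pair-matched `w`, `p_Z(w, w)` is `1` if `w` is a Catalan
word and `0` otherwise. -/
def LeadsToWigner {ι κ : Type*} (LX : SymLink ι) (LY : SymLink κ) : Prop :=
  ∀ (k : ℕ) (w : Word (2 * k)), 1 ≤ k → w.PairMatched →
    HasWordLimit LX LY w w (if w.IsCatalan then 1 else 0)

/-! ## Input sequences -/

section Inputs

variable {ι Ω : Type*} [MeasurableSpace Ω]

/-- Independent real random variables with mean `0` and variance `1`. -/
structure IsStandardInput (x : ι → Ω → ℝ) (μ : Measure Ω) : Prop where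
  measurable : ∀ t, Measurable (x t)
  indep : iIndepFun x μ
  memLp : ∀ t, MemLp (x t) 2 μ
  mean : ∀ t, ∫ ω, x t ω ∂μ = 0
  var : ∀ t, variance (x t) μ = 1

/-- (A1): independent, uniformly bounded, mean `0`, variance `1`. -/
def InputA1 (x : ι → Ω → ℝ) (μ : Measure Ω) : Prop :=
  IsStandardInput x μ ∧ ∃ C : ℝ, ∀ t, ∀ᵐ ω ∂μ, |x t ω| ≤ C

/-- (A2): i.i.d., mean `0`, variance `1`. -/
def InputA2 (x : ι → Ω → ℝ) (μ : Measure Ω) : Prop :=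
  IsStandardInput x μ ∧ ∀ s t, IdentDistrib (x s) (x t) μ μ

/-- (A3): independent, mean `0`, variance `1`, moments of every order uniformly bounded. -/
def InputA3 (x : ι → Ω → ℝ) (μ : Measure Ω) : Prop :=
  IsStandardInput x μ ∧ ∀ m : ℕ, ∃ C : ℝ, ∀ t,
    Integrable (fun ω => |x t ω| ^ m) μ ∧ ∫ ω, |x t ω| ^ m ∂μ ≤ C

end Inputs

/-! ## Matrices and limiting spectral distributions -/

/-- The patterned matrix with entries `x_{L(i,j)}`. -/
def patternedMatrix {ι : Type*} (L : SymLink ι) (x : ι → ℝ) (n : ℕ) :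
    Matrix (Fin n) (Fin n) ℝ :=
  Matrix.of fun i j => x (L.val n i j)

/-- The matrix `n^{-1/2} X_n ⊙ Y_n`. -/
def scaledProduct {ι κ : Type*} (LX : SymLink ι) (LY : SymLink κ) (x : ι → ℝ) (y : κ → ℝ)
    (n : ℕ) : Matrix (Fin n) (Fin n) ℝ :=
  (Real.sqrt n)⁻¹ • Matrix.hadamard (patternedMatrix LX x n) (patternedMatrix LY y n)

lemma scaledProduct_isHermitian {ι κ : Type*} (LX : SymLink ι) (LY : SymLink κ) (x : ι → ℝ)
    (y : κ → ℝ) (n : ℕ) : (scaledProduct LX LY x y n).IsHermitian := by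
  ext i j
  simp [scaledProduct, patternedMatrix, LX.symm n j i, LY.symm n j i]

/-- The empirical spectral distribution of a real symmetric `n × n` matrix. -/
def esd {n : ℕ} {A : Matrix (Fin n) (Fin n) ℝ} (hA : A.IsHermitian) : Measure ℝ :=
  (n : ENNReal)⁻¹ • ∑ i, Measure.dirac (hA.eigenvalues i)

/-- The semicircular law: density `√(4 - s²) / (2π)` on `[-2, 2]` (`Real.sqrt` vanishes on negative
numbers). -/
def semicircleLaw : Measure ℝ :=
  volume.withDensity fun s => ENNReal.ofReal (Real.sqrt (4 - s ^ 2) / (2 * Real.pi))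

section Convergence

variable {Ω : Type*} [MeasurableSpace Ω]

/-- Almost surely, the distribution functions of `ν n` converge to that of `F` at all continuity
points of the latter. -/
def IsLimitAlmostSurely (μ : Measure Ω) (ν : ℕ → Ω → Measure ℝ) (F : Measure ℝ) : Prop :=
  ∀ᵐ ω ∂μ, ∀ s : ℝ, ContinuousAt (fun r => F.real (Set.Iic r)) s →
    Tendsto (fun n => (ν n ω).real (Set.Iic s)) atTop (𝓝 (F.real (Set.Iic s)))

/-- The distribution functions of `ν n` converge in probability to that of `F` at all continuity
points of the latter. -/
def IsLimitInProbability (μ : Measure Ω) (ν : ℕ → Ω → Measure ℝ) (F : Measure ℝ) : Prop :=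
  ∀ s : ℝ, ContinuousAt (fun r => F.real (Set.Iic r)) s →
    TendstoInMeasure μ (fun n ω => (ν n ω).real (Set.Iic s)) atTop
      (fun _ => F.real (Set.Iic s))

/-- The random empirical spectral distributions of `n^{-1/2} X_n ⊙ Y_n`. -/
def productESD {ι κ : Type*} (LX : SymLink ι) (LY : SymLink κ) (x : ι → Ω → ℝ) (y : κ → Ω → ℝ)
    (n : ℕ) (ω : Ω) : Measure ℝ :=
  esd (scaledProduct_isHermitian LX LY (fun t => x t ω) (fun s => y s ω) n)

end Convergence

end SchurHadamard

end

namespace SchurHadamard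

/-! ## Catalan words and binary trees -/

/-! The proof is the method of moments. Expanding a trace, the `h`-th moment of the spectral
distribution is `n^(-1-h/2)` times the sum, over closed circuits of length `h`, of the inputs `x`
and `y` along the edges. Both inputs together form one independent family, so, when all moments are
bounded, a circuit has nonzero mean only if no label of either link occurs on a single edge. By
Property B an edge with a known label leaves boundedly many choices for its endpoint, so only
O(n^(r+1)) circuits carry at most `r` labels of one link (`card_circuits_le`). Hence only circuits
that are pair-matched for both links matter, and each of them has mean 1. Sorted by their two words
they are counted by p_Z(w, w'): compatibility removes the terms with w ≠ w', and the diagonal leaves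
the number of Catalan words. These correspond to binary trees (`ncard_catalan_words`), and the
Catalan numbers are the even moments of the semicircular law.

Almost sure convergence of the moments follows from a fourth central moment of order n^(2h+2),
against the normalization n^(2h+4). The difficulty is that vertices are counted through the labels
of one link, while circuits may be tied together through the other link only. Each quadruple of
circuits is therefore explored in increasing and in decreasing order; the two resulting exponents
add up to at most 4h + 4, so one of them is at most 2h + 2 (`forwardCost_add_backwardCost_le`).
Since the limit law has compact support, convergence of moments gives convergence of distribution
functions (`tendsto_cdf_of_tendsto_moments`).

Inputs with two moments only are compared with bounded, recentred and rescaled truncations. Two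
perturbation bounds serve: one by the Frobenius norm, for Lipschitz test functions
(`abs_integral_esd_sub_le`), and one by the number of changed entries (`card_eigenvalues_le_add`).
The Frobenius error is small in mean, which gives convergence in probability. For links that do not
depend on `n`, sums of nonnegative terms over the entries increase with `n`, so dyadic sizes
suffice: almost surely only o(n) entries of the product exceed √n in absolute value, and a variance
bound controls the Frobenius error of the others.

If the links determine the Wigner link, a circuit in both classes of `w` is a closed walk that
traverses equal edges at equal letters. A Catalan word of length 2k has exactly n^(k+1) such walks
(`ncard_weakClass`), of which all but O(n^k) lie in both classes; for any other pair-matched word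
they visit at most `k` vertices (`card_image_le_of_not_isCatalan`). -/

/-- The list `l` is a sequence of letters whose nesting structure is the binary tree `t`. -/
def TreeWord : BinaryTree Unit → List ℕ → Prop
  | .nil, l => l = []
  | .node _ s t, l => ∃ (a : ℕ) (u v : List ℕ), l = a :: u ++ a :: v ∧ a ∉ u ∧ a ∉ v ∧
      (∀ b ∈ u, b ∉ v) ∧ TreeWord s u ∧ TreeWord t v

/-- The list of letters with nesting structure `t` whose letters occur first in the order
`m, m + 1, …`. -/
def treeList : BinaryTree Unit → ℕ → List ℕ
  | .nil, _ => []
  | .node _ s t, m => m :: treeList s (m + 1) ++ m :: treeList t (m + 1 + s.numNodes)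

/-- A double letter at the very front becomes a new root whose right subtree is the old tree.
Anywhere else it falls into the block between the two root letters or into the block after them, and
the corresponding subtree grows. -/
lemma treeWord_mem_append {t : BinaryTree Unit} {u v : List ℕ} {a : ℕ} (ha : a ∉ u ++ v)
    (h : TreeWord t (u ++ v)) : ∃ t', TreeWord t' (u ++ a :: a :: v) := by
  induction t generalizing u v with
  | nil =>
    simp only [TreeWord, List.append_eq_nil_iff] at h
    obtain ⟨rfl, rfl⟩ := h
    exact ⟨.node () .nil .nil, a, [], [], by simp [TreeWord]⟩
  | node _ s t ihs iht =>
    rcases u with - | ⟨b, u⟩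
    · exact ⟨.node () .nil (.node () s t), a, [], v, rfl, by simp, by simpa using ha, by simp,
        rfl, by simpa using h⟩
    · obtain ⟨c, p, q, hl, hcp, hcq, hd, hp, hq⟩ := h
      simp only [List.cons_append, List.cons.injEq] at hl
      obtain ⟨rfl, hl⟩ := hl
      simp only [List.cons_append, List.mem_cons, not_or] at ha
      rw [List.append_eq_append_iff] at hl
      rcases hl with ⟨r, rfl, rfl⟩ | ⟨r, rfl, hr⟩
      · obtain ⟨s', hs'⟩ := ihs (u := u) (v := r) (by simp_all) hp
        refine ⟨.node () s' t, b, u ++ a :: a :: r, q, by simp, ?_, hcq, ?_, hs', hq⟩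
        · simp_all; tauto
        · rintro x hx hxq
          have := hd x
          simp_all
      -- An empty `r` means insertion just before the second root letter, that is, at the end of the
      -- left block.
      · rcases r with - | ⟨c, r⟩
        · simp only [List.nil_append] at hr
          subst hr
          obtain ⟨s', hs'⟩ := ihs (u := p) (v := []) (by simp_all) (by simpa using hp)
          refine ⟨.node () s' t, b, p ++ [a, a], q, by simp, ?_, hcq, ?_, by simpa using hs', hq⟩
          · simp_all; tauto
          · rintro x hx hxq
            simp only [List.mem_append, List.mem_cons, List.not_mem_nil, or_false, or_self] at hx
            rcases hx with hx | rfl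
            · exact hd x (by simpa using hx) hxq
            · simp_all
        · simp only [List.cons_append, List.cons.injEq] at hr
          obtain ⟨rfl, rfl⟩ := hr
          obtain ⟨t', ht'⟩ := iht (u := r) (v := v) (by simp_all) hq
          refine ⟨.node () s t', b, p, r ++ a :: a :: v, by simp, hcp, ?_, ?_, hp, ht'⟩
          · simp_all; tauto
          · intro x hx
            have := hd x hx
            simp_all
            rintro rfl
            exact ha.2.1 hx

lemma CatalanList.exists_treeWord {l : List ℕ} (h : CatalanList l) : ∃ t, TreeWord t l := by
  induction h with
  | double a => exact ⟨.node () .nil .nil, a, [], [], by simp [TreeWord]⟩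
  | insert u v a ha _ ih =>
    obtain ⟨t, ht⟩ := ih
    exact treeWord_mem_append ha ht

/-- The double letters that build up `u` can equally be inserted one by one between `p` and `s`. The
empty surrounding list is allowed separately because it is not a `CatalanList`. -/
lemma CatalanList.append_append {u : List ℕ} (hu : CatalanList u) {p s : List ℕ}
    (hps : p ++ s = [] ∨ CatalanList (p ++ s)) (hd : ∀ b ∈ u, b ∉ p ++ s) :
    CatalanList (p ++ u ++ s) := by
  have aux : ∀ (p s : List ℕ) (a : ℕ), (p ++ s = [] ∨ CatalanList (p ++ s)) → a ∉ p ++ s →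
      CatalanList (p ++ a :: a :: s) := by
    rintro p s a (h | h) ha
    · simp only [List.append_eq_nil_iff] at h
      obtain ⟨rfl, rfl⟩ := h
      exact .double a
    · exact .insert p s a ha h
  induction hu with
  | double a => simpa using aux p s a hps (hd a (by simp))
  | insert u v a ha _ ih =>
    have h1 := ih (fun b hb => hd b (by simp at hb ⊢; tauto))
    have h2 := hd a (by simp)
    have := CatalanList.insert (p ++ u) (v ++ s) a (by simp at ha h2 ⊢; tauto)
      (by simpa using h1)
    simpa using this

lemma TreeWord.catalanList {t : BinaryTree Unit} {l : List ℕ} (h : TreeWord t l) :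
    l = [] ∨ CatalanList l := by
  induction t generalizing l with
  | nil => exact .inl h
  | node _ s t ihs iht =>
    obtain ⟨a, u, v, rfl, hau, hav, hd, hu, hv⟩ := h
    right
    have h1 : CatalanList ([a] ++ a :: v) := by
      rcases iht hv with rfl | h
      · exact .double a
      · exact .insert [] v a (by simpa) (by simpa)
    rcases ihs hu with rfl | h
    · simpa using h1
    · have := h.append_append (p := [a]) (s := a :: v) (.inr h1) (by
        intro b hb; have := hd b hb; simp; refine ⟨?_, this⟩; rintro rfl; exact hau hb)
      simpa using this

lemma length_treeList (t : BinaryTree Unit) (m : ℕ) : (treeList t m).length = 2 * t.numNodes := by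
  induction t generalizing m with
  | nil => rfl
  | node _ s t ihs iht => simp [treeList, ihs, iht]; ring

lemma mem_treeList (t : BinaryTree Unit) (m b : ℕ) :
    b ∈ treeList t m ↔ m ≤ b ∧ b < m + t.numNodes := by
  induction t generalizing m with
  | nil => simp [treeList]
  | node _ s t ihs iht => simp [treeList, ihs, iht]; omega

lemma treeWord_treeList (t : BinaryTree Unit) (m : ℕ) : TreeWord t (treeList t m) := by
  induction t generalizing m with
  | nil => rfl
  | node _ s t ihs iht =>
    refine ⟨m, _, _, rfl, ?_, ?_, ?_, ihs _, iht _⟩ <;> simp [mem_treeList] <;> omega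

lemma count_treeList (t : BinaryTree Unit) (m b : ℕ) (hb : b ∈ treeList t m) :
    (treeList t m).count b = 2 := by
  induction t generalizing m with
  | nil => simp [treeList] at hb
  | node _ s t ihs iht =>
    have h1 := mem_treeList s (m + 1) b
    have h2 := mem_treeList t (m + 1 + s.numNodes) b
    have e1 : b ∉ treeList s (m + 1) → (treeList s (m + 1)).count b = 0 :=
      List.count_eq_zero_of_not_mem
    have e2 : b ∉ treeList t (m + 1 + s.numNodes) →
      (treeList t (m + 1 + s.numNodes)).count b = 0 := List.count_eq_zero_of_not_mem
    simp only [treeList, List.cons_append, List.mem_cons, List.mem_append] at hb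
    simp only [treeList, List.cons_append, List.count_cons, List.count_append, beq_iff_eq]
    by_cases hm : m = b
    · subst hm
      rw [e1 (by rw [h1]; omega), e2 (by rw [h2]; omega)]; simp
    · by_cases hs : b ∈ treeList s (m + 1)
      · rw [ihs _ hs, e2 (by rw [h2]; rw [h1] at hs; omega)]; simp [hm]
      · rw [e1 hs, iht _ (by tauto)]; simp [hm]

/-- All letters of the list are at least `m`, and first occurrences are in the order
`m, m + 1, …`. -/
def OrderedFrom (m : ℕ) (l : List ℕ) : Prop :=
  (∀ b ∈ l, m ≤ b) ∧ ∀ (p s : List ℕ) (c : ℕ), l = p ++ c :: s → ∀ a, m ≤ a → a < c → a ∈ p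

lemma orderedFrom_treeList (t : BinaryTree Unit) (m : ℕ) : OrderedFrom m (treeList t m) := by
  refine ⟨fun b hb => ((mem_treeList t m b).1 hb).1, ?_⟩
  induction t generalizing m with
  | nil => intro p s c h; simp [treeList] at h
  | node _ s t ihs iht =>
    intro p r c h a hma hac
    rcases p with - | ⟨d, p⟩
    · simp [treeList] at h
      omega
    · simp only [treeList, List.cons_append, List.cons.injEq] at h
      obtain ⟨rfl, h⟩ := h
      by_cases ham : a = m
      · simp [ham]
      refine List.mem_cons_of_mem _ ?_
      rw [List.append_eq_append_iff] at h
      rcases h with ⟨q, rfl, h⟩ | ⟨q, h, h'⟩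
      · rcases q with - | ⟨e, q⟩
        · simp at h; omega
        · simp only [List.cons_append, List.cons.injEq] at h
          obtain ⟨rfl, h⟩ := h
          by_cases hs : a < m + 1 + s.numNodes
          · have := (mem_treeList s (m + 1) a).2 (by omega)
            simp [this]
          · have := iht _ q r c h a (by omega) hac
            simp [this]
      · rcases q with - | ⟨e, q⟩
        · simp at h'; omega
        · simp only [List.cons_append, List.cons.injEq] at h'
          obtain ⟨rfl, h'⟩ := h'
          exact ihs _ p q c h a (by omega) hac

/-- The order of first occurrences leaves no freedom in the names of the letters: the root takes the
least one, the left subtree the next ones, the right subtree the rest. -/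
lemma OrderedFrom.eq_treeList {t : BinaryTree Unit} {l : List ℕ} {m : ℕ} (h : OrderedFrom m l)
    (ht : TreeWord t l) : l = treeList t m := by
  induction t generalizing l m with
  | nil => exact ht
  | node _ s t ihs iht =>
    obtain ⟨a, u, v, rfl, hau, hav, hd, hu, hv⟩ := ht
    obtain ⟨h1, h2⟩ := h
    have ham : a = m := by
      by_contra hne
      have := h1 a (by simp)
      simpa using h2 [] (u ++ a :: v) a rfl m le_rfl (by omega)
    subst ham
    have hul : u = treeList s (a + 1) := by
      refine ihs ⟨fun b hb => ?_, fun p r c hl b hb hbc => ?_⟩ hu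
      · have := h1 b (by simp [hb])
        rcases this.lt_or_eq with h | rfl
        · exact h
        · exact absurd hb hau
      · subst hl
        have := h2 (a :: p) (r ++ a :: v) c (by simp) b (by omega) hbc
        simp only [List.mem_cons] at this
        exact this.resolve_left (by omega)
    have hvl : v = treeList t (a + 1 + s.numNodes) := by
      refine iht ⟨fun b hb => ?_, fun p r c hl b hb hbc => ?_⟩ hv
      · have h3 := h1 b (by simp [hb])
        have h4 : b ∉ u := fun h => hd b h hb
        rw [hul, mem_treeList] at h4
        have : a ≠ b := by rintro rfl; exact hav hb
        omega
      · subst hl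
        have := h2 (a :: u ++ a :: p) r c (by simp) b (by omega) hbc
        simp only [List.cons_append, List.mem_cons, List.mem_append, hul, mem_treeList] at this
        rcases this with h | h | h | h
        · omega
        · omega
        · omega
        · exact h
    rw [treeList, ← hul, ← hvl]

/-- The second occurrence of the first letter marks the end of the left block, since neither block
contains that letter. -/
lemma treeList_injective (m : ℕ) : Function.Injective fun t => treeList t m := by
  intro t
  induction t generalizing m with
  | nil =>
    intro t' h
    cases t' with
    | nil => rfl
    | node _ s t => simp [treeList] at h
  | node _ s t ihs iht =>
    intro t' h
    cases t' with
    | nil => simp [treeList] at h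
    | node _ s' t' =>
      have key : ∀ {u u' v v' : List ℕ} {a : ℕ}, a ∉ u → a ∉ u' → u ++ a :: v = u' ++ a :: v' →
          u = u' ∧ v = v' := by
        intro u
        induction u with
        | nil =>
          rintro (- | ⟨b, u'⟩) v v' a - h2 h3
          · simpa using h3
          · simp at h3 h2; exact absurd h3.1 h2.1
        | cons b u ih =>
          rintro (- | ⟨b', u'⟩) v v' a h1 h2 h3
          · simp at h3 h1; exact absurd h3.1.symm h1.1
          · simp only [List.cons_append, List.cons.injEq] at h3
            obtain ⟨e1, e2⟩ := ih (fun h => h1 (by simp [h])) (fun h => h2 (by simp [h])) h3.2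
            exact ⟨by rw [h3.1, e1], e2⟩
      simp only [treeList, List.cons_append, List.cons.injEq, true_and] at h
      obtain ⟨e1, e2⟩ := key (by simp [mem_treeList]) (by simp [mem_treeList]) h
      have hs : s = s' := ihs _ e1
      subst hs
      have ht : t = t' := iht _ e2
      subst ht
      rfl

lemma Word.ext_letter {h : ℕ} {w w' : Word h} (e : w.letter = w'.letter) : w = w' := by
  cases w; cases w'; simp_all

lemma Word.orderedFrom {h : ℕ} (w : Word h) : OrderedFrom 0 (List.ofFn w.letter) := by
  refine ⟨by simp, fun p s c hl a _ hac => ?_⟩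
  have hlen : p.length < h := by
    have := congrArg List.length hl
    simp at this
    omega
  have hc : w.letter ⟨p.length, hlen⟩ = c := by
    have : (List.ofFn w.letter)[p.length]'(by simpa) = c := by simp [hl]
    simpa using this
  obtain ⟨j, hj, hja⟩ := w.ordered ⟨p.length, hlen⟩ a (by rwa [hc])
  have hj' : (j : ℕ) < p.length := hj
  have : (List.ofFn w.letter)[(j : ℕ)]'(by simp) = a := by simpa using hja
  simp only [hl] at this
  rw [List.getElem_append_left hj'] at this
  exact this ▸ List.getElem_mem _

lemma ncard_eq_count {h : ℕ} (f : Fin h → ℕ) (a : ℕ) :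
    {j | f j = a}.ncard = (List.ofFn f).count a := by
  have h1 : {j | f j = a}.ncard = ∑ j, if f j = a then 1 else 0 := by
    rw [← Finset.card_filter, ← Set.ncard_coe_finset]
    simp
  rw [h1]
  clear h1
  induction h with
  | zero => simp
  | succ h ih =>
    rw [Fin.sum_univ_succ, ih fun j => f j.succ, List.ofFn_succ, List.count_cons, add_comm]
    simp

/-- The word with nesting structure `t`. -/
def treeWord {k : ℕ} (t : BinaryTree Unit) (ht : t.numNodes = k) : Word (2 * k) where
  letter i := (treeList t 0)[(i : ℕ)]'(by rw [length_treeList, ht]; exact i.2)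
  ordered i a ha := by
    have hl : (i : ℕ) < (treeList t 0).length := by rw [length_treeList, ht]; exact i.2
    have := (orderedFrom_treeList t 0).2 ((treeList t 0).take i) ((treeList t 0).drop (i + 1)) _
      (by simp) a (Nat.zero_le _) ha
    obtain ⟨j, hj, hja⟩ := List.getElem_of_mem this
    simp only [List.length_take] at hj
    refine ⟨⟨j, by omega⟩, by simp [Fin.lt_def]; omega, ?_⟩
    simpa using hja

lemma ofFn_treeWord {k : ℕ} (t : BinaryTree Unit) (ht : t.numNodes = k) :
    List.ofFn (treeWord t ht).letter = treeList t 0 := by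
  apply List.ext_getElem
  · simp [length_treeList, ht]
  · simp [treeWord]

/-- The bijection sends a tree to the word naming its nodes in order of first visit. The case `k =
0` is exceptional: the empty word does not count as Catalan, whereas `catalan 0 = 1`. -/
lemma ncard_catalan_words (k : ℕ) (hk : 1 ≤ k) :
    {w : Word (2 * k) | w.PairMatched ∧ w.IsCatalan}.ncard = catalan k := by
  rw [← BinaryTree.treesOfNumNodesEq_card_eq_catalan, ← Set.ncard_coe_finset]
  symm
  refine Set.ncard_congr (fun t ht => treeWord t (by simpa using ht)) ?_ ?_ ?_
  · intro t ht
    simp only [Finset.mem_coe, BinaryTree.mem_treesOfNumNodesEq] at ht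
    refine ⟨fun i => ?_, ?_⟩
    · rw [ncard_eq_count, ofFn_treeWord]
      exact count_treeList _ _ _ (List.getElem_mem _)
    · rw [Word.IsCatalan, ofFn_treeWord]
      refine (treeWord_treeList t 0).catalanList.resolve_left fun h => ?_
      have := length_treeList t 0
      rw [h, ht] at this
      simp at this
      omega
  · intro t t' ht ht' h
    have := congrArg (fun w : Word (2 * k) => List.ofFn w.letter) h
    simp only [ofFn_treeWord] at this
    exact treeList_injective 0 this
  · rintro w ⟨-, hw⟩
    obtain ⟨t, ht⟩ := CatalanList.exists_treeWord hw
    have h := w.orderedFrom.eq_treeList ht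
    have hk : t.numNodes = k := by
      have := congrArg List.length h
      rw [length_treeList] at this
      simpa using this.symm
    refine ⟨t, by simpa using hk, Word.ext_letter ?_⟩
    apply List.ofFn_injective
    rw [ofFn_treeWord, h]

end SchurHadamard

namespace SchurHadamard

/-! ## Counting circuits -/

/-- A symmetric array in which every row contains each label at most `D` times. -/
structure RowBound {ι : Type*} (D : ℕ) {n : ℕ} (l : Fin n → Fin n → ι) : Prop where
  symm : ∀ i j, l i j = l j i
  ncard_le : ∀ t i, {j | l i j = t}.ncard ≤ D

lemma RowBound.card_filter_mem_le {ι : Type*} [DecidableEq ι] {D n : ℕ} {l : Fin n → Fin n → ι}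
    (hl : RowBound D l) (T : Finset ι) (i : Fin n) :
    (Finset.univ.filter fun j => l i j ∈ T).card ≤ D * T.card := by
  refine Finset.card_le_mul_card_image_of_maps_to (f := fun j => l i j) (by simp) D ?_
  intro t ht
  refine le_trans ?_ (hl.ncard_le t i)
  rw [← Set.ncard_coe_finset]
  refine Set.ncard_le_ncard ?_ (Set.toFinite _)
  intro j
  simp

/-- The labels on a path. -/
def pathLabels {ι : Type*} [DecidableEq ι] {n m : ℕ} (l : Fin n → Fin n → ι)
    (c : Fin (m + 1) → Fin n) : Finset ι :=
  Finset.univ.image fun i : Fin m => l (c i.castSucc) (c i.succ)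

lemma pathLabels_succ {ι : Type*} [DecidableEq ι] {n m : ℕ} (l : Fin n → Fin n → ι)
    (c : Fin (m + 2) → Fin n) :
    pathLabels l c = insert (l (c 0) (c 1)) (pathLabels l (Fin.tail c)) := by
  ext t
  simp [pathLabels, Fin.exists_fin_succ, Fin.tail, eq_comm]

/-- Each step either uses a label of `T`, with at most `D * T.card` possible endpoints, or a new
label, with at most `n` endpoints. In the second case the label joins `T` and one of the `r` allowed
new labels is spent. -/
lemma card_paths_le {ι : Type*} [DecidableEq ι] {D n : ℕ} {l : Fin n → Fin n → ι}
    (hl : RowBound D l) (m : ℕ) (T : Finset ι) (r : ℕ) (v : Fin n) :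
    (Finset.univ.filter fun c : Fin (m + 1) → Fin n =>
      c 0 = v ∧ (pathLabels l c \ T).card ≤ r).card ≤ (D * (T.card + m) + 1) ^ m * n ^ r := by
  induction m generalizing T r v with
  | zero =>
    have hn : 0 < n := v.pos
    calc _ ≤ ({fun _ => v} : Finset (Fin 1 → Fin n)).card := by
            refine Finset.card_le_card fun c hc => ?_
            simp only [Finset.mem_filter] at hc
            simp only [Finset.mem_singleton]
            funext i
            rw [← hc.2.1, show i = 0 from Fin.fin_one_eq_zero i]
      _ ≤ _ := by
            simp only [Finset.card_singleton, pow_zero, one_mul]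
            exact Nat.one_le_pow _ _ hn
  | succ m ih =>
    -- The quantity `T.card + m` does not change when a step is removed and its label is put into
    -- `T`, so the same base serves in both cases.
    set B := D * (T.card + (m + 1)) + 1 with hB
    let S : Fin n → Finset (Fin (m + 1) → Fin n) := fun u => Finset.univ.filter fun c =>
      c 0 = u ∧ (insert (l v u) (pathLabels l c) \ T).card ≤ r
    have h1 : (Finset.univ.filter fun c : Fin (m + 2) → Fin n =>
        c 0 = v ∧ (pathLabels l c \ T).card ≤ r).card ≤ ∑ u, (S u).card := by
      refine le_trans (Finset.card_le_card_of_injOn (t := Finset.univ.biUnion S)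
        (fun c => Fin.tail c) ?_ ?_) Finset.card_biUnion_le
      · intro c hc
        simp only [Finset.coe_filter, Finset.mem_univ, true_and, Set.mem_ofPred_eq] at hc
        simp only [Finset.coe_biUnion, Set.mem_iUnion, Finset.mem_coe]
        refine ⟨c 1, Finset.mem_univ _, ?_⟩
        simp only [S, Finset.mem_filter, Finset.mem_univ, true_and]
        refine ⟨rfl, ?_⟩
        rw [← hc.1, ← pathLabels_succ]
        exact hc.2
      · intro c hc c' hc' h
        simp only [Finset.coe_filter, Finset.mem_univ, true_and, Set.mem_ofPred_eq] at hc hc'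
        rw [← Fin.cons_self_tail c, ← Fin.cons_self_tail c', hc.1, hc'.1]
        exact congrArg _ h
    have h2 : ∀ u ∈ Finset.univ.filter fun u => l v u ∈ T, (S u).card ≤ B ^ m * n ^ r := by
      intro u hu
      simp only [Finset.mem_filter, Finset.mem_univ, true_and] at hu
      refine le_trans (Finset.card_le_card ?_) ((ih T r u).trans ?_)
      · intro c hc
        simp only [S, Finset.mem_filter, Finset.mem_univ, true_and] at hc ⊢
        refine ⟨hc.1, ?_⟩
        have := hc.2
        rw [Finset.insert_sdiff_of_mem _ hu] at this
        exact this
      · gcongr ?_ ^ m * n ^ r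
        rw [hB]
        gcongr
        omega
    -- The factor `n` on the left stands in for an exponent `r - 1`, which would be wrong at `r =
    -- 0`, where no path qualifies.
    have h3 : ∀ u ∈ Finset.univ.filter fun u => l v u ∉ T,
        (S u).card * n ≤ B ^ m * n ^ r := by
      intro u hu
      simp only [Finset.mem_filter, Finset.mem_univ, true_and] at hu
      have key : ∀ c : Fin (m + 1) → Fin n, (insert (l v u) (pathLabels l c) \ T).card =
          (pathLabels l c \ insert (l v u) T).card + 1 := by
        intro c
        rw [Finset.insert_sdiff_of_notMem _ hu, ← Finset.card_insert_of_notMem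
          (a := l v u) (s := pathLabels l c \ insert (l v u) T) (by simp)]
        congr 1
        ext t
        simp only [Finset.mem_insert, Finset.mem_sdiff]
        tauto
      rcases r with - | r
      · have : S u = ∅ := by
          apply Finset.filter_eq_empty_iff.2
          intro c _
          rw [key]
          omega
        simp [this]
      · rw [pow_succ, ← mul_assoc]
        refine Nat.mul_le_mul_right _ (le_trans (Finset.card_le_card ?_)
          ((ih (insert (l v u) T) r u).trans ?_))
        · intro c hc
          simp only [S, Finset.mem_filter, Finset.mem_univ, true_and] at hc ⊢
          rw [key] at hc
          exact ⟨hc.1, by omega⟩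
        · rw [Finset.card_insert_of_notMem hu]
          gcongr
          rw [hB]
          apply le_of_eq
          ring
    have hn : 0 < n := v.pos
    calc _ ≤ ∑ u, (S u).card := h1
      _ = ∑ u with l v u ∈ T, (S u).card + ∑ u with l v u ∉ T, (S u).card :=
          (Finset.sum_filter_add_sum_filter_not _ _ _).symm
      _ ≤ (D * T.card) * (B ^ m * n ^ r) + B ^ m * n ^ r := by
          gcongr ?_ + ?_
          · refine (Finset.sum_le_card_nsmul _ _ _ h2).trans ?_
            rw [smul_eq_mul]
            gcongr
            exact hl.card_filter_mem_le T v
          · refine Nat.le_of_mul_le_mul_right ?_ hn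
            rw [Finset.sum_mul]
            refine (Finset.sum_le_card_nsmul _ _ _ h3).trans ?_
            rw [smul_eq_mul, mul_comm]
            gcongr
            simpa using Finset.card_le_univ (Finset.univ.filter fun u => l v u ∉ T)
      _ = (D * T.card + 1) * B ^ m * n ^ r := by ring
      _ ≤ B * B ^ m * n ^ r := by
          gcongr
          rw [hB]
          gcongr
          omega
      _ = B ^ (m + 1) * n ^ r := by ring

/-- The label of the edge from `c i` to the (cyclically) next vertex. -/
def edgeLabel {ι : Type*} {n h : ℕ} [NeZero h] (l : Fin n → Fin n → ι) (c : Fin h → Fin n)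
    (i : Fin h) : ι := l (c i) (c (i + 1))

/-- The labels on a closed circuit. -/
def circuitLabels {ι : Type*} [DecidableEq ι] {n h : ℕ} [NeZero h] (l : Fin n → Fin n → ι)
    (c : Fin h → Fin n) : Finset ι := Finset.univ.image (edgeLabel l c)

lemma edgeLabel_mem {ι : Type*} [DecidableEq ι] {n h : ℕ} [NeZero h] (l : Fin n → Fin n → ι)
    (c : Fin h → Fin n) (i : Fin h) : edgeLabel l c i ∈ circuitLabels l c :=
  Finset.mem_image_of_mem _ (Finset.mem_univ i)

lemma card_circuitLabels_le {ι : Type*} [DecidableEq ι] {n h : ℕ} [NeZero h]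
    (l : Fin n → Fin n → ι) (c : Fin h → Fin n) : (circuitLabels l c).card ≤ h :=
  Finset.card_image_le.trans (by simp)

lemma edgeLabel_castSucc {ι : Type*} {n m : ℕ} (l : Fin n → Fin n → ι) (c : Fin (m + 1) → Fin n)
    (i : Fin m) : edgeLabel l c i.castSucc = l (c i.castSucc) (c i.succ) := by
  rw [edgeLabel, Fin.coeSucc_eq_succ]

lemma edgeLabel_last {ι : Type*} {n m : ℕ} (l : Fin n → Fin n → ι) (c : Fin (m + 1) → Fin n) :
    edgeLabel l c (Fin.last m) = l (c (Fin.last m)) (c 0) := by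
  rw [edgeLabel, Fin.last_add_one]

lemma pathLabels_subset {ι : Type*} [DecidableEq ι] {n m : ℕ} (l : Fin n → Fin n → ι)
    (c : Fin (m + 1) → Fin n) : pathLabels l c ⊆ circuitLabels l c := by
  intro t ht
  simp only [pathLabels, Finset.mem_image, Finset.mem_univ, true_and] at ht
  obtain ⟨i, rfl⟩ := ht
  rw [← edgeLabel_castSucc l c i]
  exact edgeLabel_mem _ _ _

lemma edgeLabel_rotate {ι : Type*} {n h : ℕ} [NeZero h] (l : Fin n → Fin n → ι)
    (c : Fin h → Fin n) (a i : Fin h) :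
    edgeLabel l (fun j => c (j + a)) i = edgeLabel l c (i + a) := by
  simp only [edgeLabel, add_right_comm]

lemma circuitLabels_rotate {ι : Type*} [DecidableEq ι] {n h : ℕ} [NeZero h]
    (l : Fin n → Fin n → ι) (c : Fin h → Fin n) (a : Fin h) :
    circuitLabels l (fun j => c (j + a)) = circuitLabels l c := by
  ext t
  simp only [circuitLabels, Finset.mem_image, Finset.mem_univ, true_and, edgeLabel_rotate]
  constructor
  · rintro ⟨i, rfl⟩
    exact ⟨_, rfl⟩
  · rintro ⟨i, rfl⟩
    exact ⟨i - a, by simp⟩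

/-- The first vertex costs a factor `n`; after it only new labels cost further factors. -/
lemma card_circuits_le {ι : Type*} [DecidableEq ι] {D n h : ℕ} [NeZero h] {l : Fin n → Fin n → ι}
    (hl : RowBound D l) (T : Finset ι) (r : ℕ) :
    (Finset.univ.filter fun c : Fin h → Fin n => (circuitLabels l c \ T).card ≤ r).card ≤
      (D * (T.card + h) + 1) ^ h * n ^ (r + 1) := by
  obtain - | m := h
  · exact absurd rfl (NeZero.ne 0)
  calc _ ≤ (Finset.univ.biUnion fun v => Finset.univ.filter fun c : Fin (m + 1) → Fin n =>
        c 0 = v ∧ (pathLabels l c \ T).card ≤ r).card := by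
        refine Finset.card_le_card fun c hc => ?_
        simp only [Finset.mem_filter, Finset.mem_univ, true_and] at hc
        simp only [Finset.mem_biUnion, Finset.mem_filter, Finset.mem_univ, true_and]
        exact ⟨c 0, rfl, (Finset.card_le_card
          (Finset.sdiff_subset_sdiff (pathLabels_subset l c) le_rfl)).trans hc⟩
    _ ≤ ∑ v : Fin n, (D * (T.card + m) + 1) ^ m * n ^ r :=
        Finset.card_biUnion_le.trans (Finset.sum_le_sum fun v _ => card_paths_le hl m T r v)
    _ = (D * (T.card + m) + 1) ^ m * n ^ (r + 1) := by simp; ring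
    _ ≤ _ := by
        gcongr ?_ * _
        calc (D * (T.card + m) + 1) ^ m ≤ (D * (T.card + (m + 1)) + 1) ^ m := by
              gcongr; omega
          _ ≤ _ := Nat.pow_le_pow_right (by omega) (by omega)

/-- Given sets `T`, `U` of labels of the first and second array, the number of free vertices of the
circuit `c` is one less than expected: it has an edge whose first label is new and does not occur
on another edge, or whose first label is new and whose second label is known. -/
def Saved {ι κ : Type*} {n h : ℕ} [NeZero h] (l : Fin n → Fin n → ι)
    (l' : Fin n → Fin n → κ) (T : Finset ι) (U : Finset κ) (c : Fin h → Fin n) : Prop :=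
  (∃ i, edgeLabel l c i ∉ T ∧ ∀ j, edgeLabel l c j = edgeLabel l c i → j = i) ∨
    ∃ i, edgeLabel l c i ∉ T ∧ edgeLabel l' c i ∈ U

open Classical in
/-- A bound for the number of free vertices of the circuit `c`, when the labels in `T` and `U` are
known. -/
noncomputable def cost {ι κ : Type*} {n h : ℕ} [NeZero h] (l : Fin n → Fin n → ι)
    (l' : Fin n → Fin n → κ) (T : Finset ι) (U : Finset κ) (c : Fin h → Fin n) : ℕ :=
  (circuitLabels l c \ T).card + if Saved l l' T U c then 0 else 1

/-- Without the closing edge the circuit is a path with one new label less, because the label of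
that edge occurs on no other edge. This compensates for the free choice of the first vertex. -/
lemma card_single_last_le {ι : Type*} [DecidableEq ι] {D n m : ℕ}
    {l : Fin n → Fin n → ι} (hl : RowBound D l) (T : Finset ι) (r : ℕ) :
    (Finset.univ.filter fun c : Fin (m + 1) → Fin n => (circuitLabels l c \ T).card ≤ r + 1 ∧
      edgeLabel l c (Fin.last m) ∉ T ∧
      ∀ j, edgeLabel l c j = edgeLabel l c (Fin.last m) → j = Fin.last m).card ≤
      (D * (T.card + m) + 1) ^ m * n ^ (r + 1) := by
  calc _ ≤ (Finset.univ.biUnion fun v => Finset.univ.filter fun c : Fin (m + 1) → Fin n =>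
        c 0 = v ∧ (pathLabels l c \ T).card ≤ r).card := by
        refine Finset.card_le_card fun c hc => ?_
        simp only [Finset.mem_filter, Finset.mem_univ, true_and] at hc
        simp only [Finset.mem_biUnion, Finset.mem_filter, Finset.mem_univ, true_and]
        obtain ⟨h1, h2, h3⟩ := hc
        refine ⟨c 0, rfl, ?_⟩
        have hsub : pathLabels l c \ T ⊆
            (circuitLabels l c \ T).erase (edgeLabel l c (Fin.last m)) := by
          intro t ht
          rw [Finset.mem_sdiff] at ht
          refine Finset.mem_erase.2 ⟨?_, Finset.mem_sdiff.2 ⟨pathLabels_subset l c ht.1, ht.2⟩⟩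
          rintro rfl
          have := ht.1
          simp only [pathLabels, Finset.mem_image, Finset.mem_univ, true_and] at this
          obtain ⟨i, hi⟩ := this
          rw [← edgeLabel_castSucc l c i] at hi
          exact (Fin.castSucc_lt_last i).ne (h3 _ hi)
        have := Finset.card_le_card hsub
        rw [Finset.card_erase_of_mem (Finset.mem_sdiff.2 ⟨edgeLabel_mem _ _ _, h2⟩)] at this
        omega
    _ ≤ ∑ v : Fin n, (D * (T.card + m) + 1) ^ m * n ^ r :=
        Finset.card_biUnion_le.trans (Finset.sum_le_sum fun v _ => card_paths_le hl m T r v)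
    _ = _ := by simp; ring

/-- Given the first vertex, the known second label of the closing edge leaves at most `D * U.card`
candidates for the last vertex. A candidate reveals the first label of the closing edge, which can
join `T` in advance, so the remaining path has one new label less. -/
lemma card_linked_last_le {ι κ : Type*} [DecidableEq ι] [DecidableEq κ] {D n m : ℕ}
    {l : Fin n → Fin n → ι} {l' : Fin n → Fin n → κ} (hl : RowBound D l) (hl' : RowBound D l')
    (T : Finset ι) (U : Finset κ) (r : ℕ) :
    (Finset.univ.filter fun c : Fin (m + 1) → Fin n => (circuitLabels l c \ T).card ≤ r + 1 ∧
      edgeLabel l c (Fin.last m) ∉ T ∧ edgeLabel l' c (Fin.last m) ∈ U).card ≤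
      D * U.card * (D * (T.card + 1 + m) + 1) ^ m * n ^ (r + 1) := by
  calc _ ≤ (Finset.univ.biUnion fun v => (Finset.univ.filter fun u => l' v u ∈ U).biUnion fun u =>
        Finset.univ.filter fun c : Fin (m + 1) → Fin n =>
        c 0 = v ∧ (pathLabels l c \ insert (l u v) T).card ≤ r).card := by
        refine Finset.card_le_card fun c hc => ?_
        simp only [Finset.mem_filter, Finset.mem_univ, true_and] at hc
        simp only [Finset.mem_biUnion, Finset.mem_filter, Finset.mem_univ, true_and]
        obtain ⟨h1, h2, h3⟩ := hc
        refine ⟨c 0, c (Fin.last m), ?_, rfl, ?_⟩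
        · rwa [hl'.symm, ← edgeLabel_last l' c]
        rw [← edgeLabel_last l c]
        have hsub : pathLabels l c \ insert (edgeLabel l c (Fin.last m)) T ⊆
            (circuitLabels l c \ T).erase (edgeLabel l c (Fin.last m)) := by
          intro t ht
          simp only [Finset.mem_sdiff, Finset.mem_insert, not_or] at ht
          exact Finset.mem_erase.2
            ⟨ht.2.1, Finset.mem_sdiff.2 ⟨pathLabels_subset l c ht.1, ht.2.2⟩⟩
        have := Finset.card_le_card hsub
        rw [Finset.card_erase_of_mem (Finset.mem_sdiff.2 ⟨edgeLabel_mem _ _ _, h2⟩)] at this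
        omega
    _ ≤ ∑ v : Fin n, D * U.card * ((D * (T.card + 1 + m) + 1) ^ m * n ^ r) := by
        refine Finset.card_biUnion_le.trans (Finset.sum_le_sum fun v _ => ?_)
        refine Finset.card_biUnion_le.trans ((Finset.sum_le_card_nsmul _ _
          ((D * (T.card + 1 + m) + 1) ^ m * n ^ r) fun u _ => ?_).trans ?_)
        · refine (card_paths_le hl m (insert (l u v) T) r v).trans ?_
          gcongr
          exact Finset.card_insert_le _ _
        · rw [smul_eq_mul]
          gcongr
          exact hl'.card_filter_mem_le U v
    _ = _ := by simp; ring

/-- A rotation brings a saving edge into the closing position, where one of the two preceding lemmas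
gains a factor `n`. Circuits without such an edge pay one more in `cost` and fall under
`card_circuits_le`. The constant depends on `T` and `U` only through `Q`, so the bound can be
iterated along a tuple. -/
lemma exists_card_cost_le (ι κ : Type*) (D h Q : ℕ) [NeZero h] : ∃ K : ℕ, ∀ (n : ℕ)
    (l : Fin n → Fin n → ι) (l' : Fin n → Fin n → κ), RowBound D l → RowBound D l' →
    ∀ (T : Finset ι) (U : Finset κ) (e : ℕ), T.card ≤ Q → U.card ≤ Q →
    (Finset.univ.filter fun c : Fin h → Fin n => cost l l' T U c ≤ e).card ≤ K * n ^ e := by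
  classical
  obtain - | m := h
  · exact absurd rfl (NeZero.ne 0)
  refine ⟨(D * (Q + (m + 1)) + 1) ^ (m + 1) + (m + 1) * ((D * (Q + m) + 1) ^ m) +
    (m + 1) * (D * Q * (D * (Q + 1 + m) + 1) ^ m), fun n l l' hl hl' T U e hT hU => ?_⟩
  obtain - | r := e
  · rw [Finset.filter_eq_empty_iff.2]
    · simp
    intro c _
    rw [cost]
    split_ifs with hs
    · have : 0 < (circuitLabels l c \ T).card := by
        rw [Finset.card_pos]
        rcases hs with ⟨i, hi, -⟩ | ⟨i, hi, -⟩ <;>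
        exact ⟨_, Finset.mem_sdiff.2 ⟨edgeLabel_mem _ _ _, hi⟩⟩
      omega
    · omega
  let A := Finset.univ.filter fun c : Fin (m + 1) → Fin n => (circuitLabels l c \ T).card ≤ r
  let P : Fin (m + 1) → Finset (Fin (m + 1) → Fin n) := fun i => Finset.univ.filter fun c =>
    (circuitLabels l c \ T).card ≤ r + 1 ∧ edgeLabel l c i ∉ T ∧
      ∀ j, edgeLabel l c j = edgeLabel l c i → j = i
  let R : Fin (m + 1) → Finset (Fin (m + 1) → Fin n) := fun i => Finset.univ.filter fun c =>
    (circuitLabels l c \ T).card ≤ r + 1 ∧ edgeLabel l c i ∉ T ∧ edgeLabel l' c i ∈ U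
  have hrot : ∀ i : Fin (m + 1), Fin.last m + (i + 1) = i := fun i => by
    rw [add_left_comm, Fin.last_add_one, add_zero]
  have hinj : ∀ a : Fin (m + 1), Function.Injective
      fun (c : Fin (m + 1) → Fin n) (j : Fin (m + 1)) => c (j + a) := by
    intro a c c' h
    ext j
    have := congrFun h (j - a)
    simp only [sub_add_cancel] at this
    rw [this]
  have hP : ∀ i, (P i).card ≤ (D * (Q + m) + 1) ^ m * n ^ (r + 1) := by
    intro i
    refine le_trans (Finset.card_le_card_of_injOn (fun c j => c (j + (i + 1))) ?_
      (hinj _).injOn) ((card_single_last_le hl T r).trans (by gcongr))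
    intro c hc
    simp only [P, Finset.coe_filter, Finset.mem_univ, true_and, Set.mem_ofPred_eq] at hc ⊢
    rw [circuitLabels_rotate, edgeLabel_rotate, hrot]
    refine ⟨hc.1, hc.2.1, fun j hj => ?_⟩
    rw [edgeLabel_rotate] at hj
    have := hc.2.2 _ hj
    exact add_right_cancel (this.trans (hrot i).symm)
  have hR : ∀ i, (R i).card ≤ D * Q * (D * (Q + 1 + m) + 1) ^ m * n ^ (r + 1) := by
    intro i
    refine le_trans (Finset.card_le_card_of_injOn (fun c j => c (j + (i + 1))) ?_
      (hinj _).injOn) ((card_linked_last_le hl hl' T U r).trans (by gcongr))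
    intro c hc
    simp only [R, Finset.coe_filter, Finset.mem_univ, true_and, Set.mem_ofPred_eq] at hc ⊢
    rw [circuitLabels_rotate, edgeLabel_rotate, edgeLabel_rotate, hrot]
    exact hc
  calc _ ≤ (A ∪ Finset.univ.biUnion P ∪ Finset.univ.biUnion R).card := by
        refine Finset.card_le_card fun c hc => ?_
        replace hc := (Finset.mem_filter.1 hc).2
        rw [cost] at hc
        simp only [Finset.mem_union, Finset.mem_biUnion, A, P, R, Finset.mem_filter,
          Finset.mem_univ, true_and]
        split_ifs at hc with hs
        · rcases hs with ⟨i, hi⟩ | ⟨i, hi⟩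
          · exact .inl (.inr ⟨i, hc, hi⟩)
          · exact .inr ⟨i, hc, hi⟩
        · exact .inl (.inl (by omega))
    _ ≤ A.card + ∑ i, (P i).card + ∑ i, (R i).card :=
        (Finset.card_union_le _ _).trans (add_le_add ((Finset.card_union_le _ _).trans
          (add_le_add le_rfl Finset.card_biUnion_le)) Finset.card_biUnion_le)
    _ ≤ (D * (Q + (m + 1)) + 1) ^ (m + 1) * n ^ (r + 1) +
        (m + 1) * ((D * (Q + m) + 1) ^ m * n ^ (r + 1)) +
        (m + 1) * (D * Q * (D * (Q + 1 + m) + 1) ^ m * n ^ (r + 1)) := by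
        gcongr
        · exact (card_circuits_le hl T r).trans (by gcongr)
        · exact (Finset.sum_le_card_nsmul _ _ _ fun i _ => hP i).trans (by simp)
        · exact (Finset.sum_le_card_nsmul _ _ _ fun i _ => hR i).trans (by simp)
    _ = _ := by ring

end SchurHadamard

namespace SchurHadamard

/-! ## Counting tuples of circuits -/

/-- The labels on the circuits with index in `S`. -/
def labelsOn {ι : Type*} [DecidableEq ι] {n h r : ℕ} [NeZero h] (l : Fin n → Fin n → ι)
    (p : Fin r → Fin h → Fin n) (S : Finset (Fin r)) : Finset ι :=
  S.biUnion fun c => circuitLabels l (p c)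

lemma mem_labelsOn {ι : Type*} [DecidableEq ι] {n h r : ℕ} [NeZero h] {l : Fin n → Fin n → ι}
    {p : Fin r → Fin h → Fin n} {S : Finset (Fin r)} {t : ι} :
    t ∈ labelsOn l p S ↔ ∃ c ∈ S, t ∈ circuitLabels l (p c) := Finset.mem_biUnion

lemma card_labelsOn_le {ι : Type*} [DecidableEq ι] {n h r : ℕ} [NeZero h]
    (l : Fin n → Fin n → ι) (p : Fin r → Fin h → Fin n) (S : Finset (Fin r)) :
    (labelsOn l p S).card ≤ r * h := by
  refine (Finset.card_biUnion_le_card_mul _ _ h fun c _ => card_circuitLabels_le l (p c)).trans ?_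
  gcongr
  simpa using Finset.card_le_univ S

open Classical in
/-- The sum of the costs of the circuits of a tuple, processed in increasing order. -/
noncomputable def forwardCost {ι κ : Type*} {n h r : ℕ} [NeZero h] (l : Fin n → Fin n → ι)
    (l' : Fin n → Fin n → κ) (p : Fin r → Fin h → Fin n) : ℕ :=
  ∑ c, cost l l' (labelsOn l p (Finset.Iio c)) (labelsOn l' p (Finset.Iio c)) (p c)

open Classical in
/-- The sum of the costs of the circuits of a tuple, processed in decreasing order. -/
noncomputable def backwardCost {ι κ : Type*} {n h r : ℕ} [NeZero h] (l : Fin n → Fin n → ι)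
    (l' : Fin n → Fin n → κ) (p : Fin r → Fin h → Fin n) : ℕ :=
  ∑ c, cost l l' (labelsOn l p (Finset.Ioi c)) (labelsOn l' p (Finset.Ioi c)) (p c)

lemma labelsOn_Iio_rev {ι : Type*} [DecidableEq ι] {n h r : ℕ} [NeZero h]
    (l : Fin n → Fin n → ι) (p : Fin r → Fin h → Fin n) (c : Fin r) :
    labelsOn l (fun d => p d.rev) (Finset.Iio c.rev) = labelsOn l p (Finset.Ioi c) := by
  ext t
  simp only [mem_labelsOn, Finset.mem_Iio, Finset.mem_Ioi]
  constructor
  · rintro ⟨d, hd, ht⟩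
    exact ⟨d.rev, by rwa [← Fin.rev_lt_rev, Fin.rev_rev], ht⟩
  · rintro ⟨d, hd, ht⟩
    exact ⟨d.rev, by rwa [Fin.rev_lt_rev], by rwa [Fin.rev_rev]⟩

lemma forwardCost_rev {ι κ : Type*} {n h r : ℕ} [NeZero h] (l : Fin n → Fin n → ι)
    (l' : Fin n → Fin n → κ) (p : Fin r → Fin h → Fin n) :
    forwardCost l l' (fun c => p c.rev) = backwardCost l l' p := by
  rw [forwardCost, backwardCost, ← Equiv.sum_comp Fin.revPerm]
  simp only [Fin.revPerm_apply, Fin.rev_rev, labelsOn_Iio_rev]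

lemma labelsOn_Iio_castSucc {ι : Type*} [DecidableEq ι] {n h r : ℕ} [NeZero h]
    (l : Fin n → Fin n → ι) (p : Fin (r + 1) → Fin h → Fin n) (c : Fin r) :
    labelsOn l p (Finset.Iio c.castSucc) = labelsOn l (Fin.init p) (Finset.Iio c) := by
  ext t
  simp only [mem_labelsOn, Finset.mem_Iio]
  constructor
  · rintro ⟨d, hd, ht⟩
    obtain ⟨d, rfl⟩ := Fin.exists_castSucc_eq.2 (hd.trans_le (Fin.le_last _)).ne
    exact ⟨d, by simpa using hd, ht⟩
  · rintro ⟨d, hd, ht⟩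
    exact ⟨d.castSucc, by simpa using hd, ht⟩

lemma labelsOn_Iio_last {ι : Type*} [DecidableEq ι] {n h r : ℕ} [NeZero h]
    (l : Fin n → Fin n → ι) (p : Fin (r + 1) → Fin h → Fin n) :
    labelsOn l p (Finset.Iio (Fin.last r)) = labelsOn l (Fin.init p) Finset.univ := by
  ext t
  simp only [mem_labelsOn, Finset.mem_Iio]
  constructor
  · rintro ⟨d, hd, ht⟩
    obtain ⟨d, rfl⟩ := Fin.exists_castSucc_eq.2 hd.ne
    exact ⟨d, by simp, ht⟩
  · rintro ⟨d, hd, ht⟩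
    exact ⟨d.castSucc, Fin.castSucc_lt_last d, ht⟩

open Classical in
lemma forwardCost_succ {ι κ : Type*} {n h r : ℕ} [NeZero h] (l : Fin n → Fin n → ι)
    (l' : Fin n → Fin n → κ) (p : Fin (r + 1) → Fin h → Fin n) :
    forwardCost l l' p = forwardCost l l' (Fin.init p) +
      cost l l' (labelsOn l (Fin.init p) Finset.univ) (labelsOn l' (Fin.init p) Finset.univ)
        (p (Fin.last r)) := by
  rw [forwardCost, Fin.sum_univ_castSucc]
  simp only [labelsOn_Iio_castSucc, labelsOn_Iio_last]
  rfl

/-- The circuits are chosen one after the other, the labels of the earlier ones playing the role of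
`T` and `U`. The factor `E + 1` accounts for how the total cost may split between the last circuit
and the others. -/
lemma exists_card_forwardCost_le (ι κ : Type*) (D h r E : ℕ) [NeZero h] : ∃ K : ℕ, ∀ (n : ℕ)
    (l : Fin n → Fin n → ι) (l' : Fin n → Fin n → κ), 0 < n → RowBound D l → RowBound D l' →
    ∀ e ≤ E, (Finset.univ.filter fun p : Fin r → Fin h → Fin n =>
      forwardCost l l' p ≤ e).card ≤ K * n ^ e := by
  classical
  induction r with
  | zero =>
    refine ⟨1, fun n l l' hn _ _ e _ => (Finset.card_le_univ _).trans ?_⟩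
    simpa using Nat.one_le_pow e n hn
  | succ r ih =>
    obtain ⟨K, hK⟩ := ih
    obtain ⟨K', hK'⟩ := exists_card_cost_le ι κ D h (r * h)
    refine ⟨(E + 1) * (K * K'), fun n l l' hn hl hl' e he => ?_⟩
    let F : ℕ → (Fin r → Fin h → Fin n) → Finset (Fin (r + 1) → Fin h → Fin n) := fun a q =>
      (Finset.univ.filter fun c => cost l l' (labelsOn l q Finset.univ)
        (labelsOn l' q Finset.univ) c ≤ e - a).image fun c => Fin.snoc (α := fun _ => Fin h → Fin n) q c
    let G : ℕ → Finset (Fin r → Fin h → Fin n) := fun a =>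
      Finset.univ.filter fun q => forwardCost l l' q ≤ a
    have hF : ∀ a q, (F a q).card ≤ K' * n ^ (e - a) := fun a q =>
      Finset.card_image_le.trans
        (hK' n l l' hl hl' _ _ _ (card_labelsOn_le l q _) (card_labelsOn_le l' q _))
    calc _ ≤ ((Finset.range (e + 1)).biUnion fun a => (G a).biUnion fun q => F a q).card := by
          refine Finset.card_le_card fun p hp => ?_
          replace hp := (Finset.mem_filter.1 hp).2
          rw [forwardCost_succ] at hp
          simp only [Finset.mem_biUnion, G, F, Finset.mem_filter, Finset.mem_univ, true_and,
            Finset.mem_image, Finset.mem_range]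
          refine ⟨forwardCost l l' (Fin.init p), by omega, Fin.init p, le_rfl, p (Fin.last r),
            by omega, Fin.snoc_init_self p⟩
      _ ≤ ∑ a ∈ Finset.range (e + 1), ∑ q ∈ G a, (F a q).card :=
          Finset.card_biUnion_le.trans (Finset.sum_le_sum fun a _ => Finset.card_biUnion_le)
      _ ≤ ∑ a ∈ Finset.range (e + 1), K * K' * n ^ e := by
          refine Finset.sum_le_sum fun a ha => ?_
          rw [Finset.mem_range] at ha
          refine (Finset.sum_le_card_nsmul _ _ _ fun q _ => hF a q).trans ?_
          rw [smul_eq_mul]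
          calc _ ≤ (K * n ^ a) * (K' * n ^ (e - a)) := by
                gcongr
                exact hK n l l' hn hl hl' a (by omega)
            _ = K * K' * (n ^ a * n ^ (e - a)) := by ring
            _ = _ := by rw [← pow_add, Nat.add_sub_cancel' (by omega)]
      _ ≤ _ := by
          rw [Finset.sum_const, Finset.card_range, smul_eq_mul, ← mul_assoc]
          gcongr

/-- The number of edges of the circuit `c` with label `t`. -/
noncomputable def multiplicity {ι : Type*} [DecidableEq ι] {n h : ℕ} [NeZero h]
    (l : Fin n → Fin n → ι) (c : Fin h → Fin n) (t : ι) : ℕ :=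
  (Finset.univ.filter fun i => edgeLabel l c i = t).card

lemma multiplicity_pos {ι : Type*} [DecidableEq ι] {n h : ℕ} [NeZero h]
    {l : Fin n → Fin n → ι} {c : Fin h → Fin n} {t : ι} :
    0 < multiplicity l c t ↔ t ∈ circuitLabels l c := by
  rw [multiplicity, Finset.card_pos, circuitLabels, Finset.mem_image]
  simp [Finset.Nonempty]

lemma sum_multiplicity {ι : Type*} [DecidableEq ι] {n h : ℕ} [NeZero h]
    (l : Fin n → Fin n → ι) (c : Fin h → Fin n) (T : Finset ι) (hT : circuitLabels l c ⊆ T) :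
    ∑ t ∈ T, multiplicity l c t = h := by
  have := Finset.card_eq_sum_card_fiberwise (s := Finset.univ) (f := edgeLabel l c) (t := T)
    fun i _ => hT (edgeLabel_mem l c i)
  rw [Finset.card_fin] at this
  exact this.symm

/-- Every label is new exactly once, on the first circuit that carries it. -/
lemma sum_card_new_forward {ι : Type*} [DecidableEq ι] {n h r : ℕ} [NeZero h]
    (l : Fin n → Fin n → ι) (p : Fin r → Fin h → Fin n) :
    ∑ c, (circuitLabels l (p c) \ labelsOn l p (Finset.Iio c)).card =
      (labelsOn l p Finset.univ).card := by
  rw [← Finset.card_biUnion]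
  · congr 1
    ext t
    simp only [Finset.mem_biUnion, Finset.mem_univ, true_and, Finset.mem_sdiff, mem_labelsOn]
    refine ⟨fun ⟨c, hc, _⟩ => ⟨c, hc⟩, fun ⟨c, hc⟩ => ?_⟩
    have hne : (Finset.univ.filter fun c => t ∈ circuitLabels l (p c)).Nonempty := ⟨c, by simpa⟩
    have hmin := Finset.min'_mem _ hne
    simp only [Finset.mem_filter, Finset.mem_univ, true_and] at hmin
    refine ⟨_, hmin, ?_⟩
    rintro ⟨d, hd, ht⟩
    exact absurd (Finset.min'_le _ d (by simpa using ht)) (not_le.2 (Finset.mem_Iio.1 hd))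
  · intro c _ d _ hcd
    rw [Function.onFun, Finset.disjoint_left]
    intro t htc htd
    rw [Finset.mem_sdiff, mem_labelsOn] at htc htd
    rcases lt_or_gt_of_ne hcd with hlt | hlt
    · exact htd.2 ⟨c, by simpa, htc.1⟩
    · exact htc.2 ⟨d, by simpa, htd.1⟩

lemma sum_card_new_backward {ι : Type*} [DecidableEq ι] {n h r : ℕ} [NeZero h]
    (l : Fin n → Fin n → ι) (p : Fin r → Fin h → Fin n) :
    ∑ c, (circuitLabels l (p c) \ labelsOn l p (Finset.Ioi c)).card =
      (labelsOn l p Finset.univ).card := by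
  have := sum_card_new_forward l fun c => p c.rev
  rw [← Equiv.sum_comp Fin.revPerm] at this
  simp only [Fin.revPerm_apply, Fin.rev_rev, labelsOn_Iio_rev] at this
  rw [this]
  congr 1
  ext t
  simp only [mem_labelsOn, Finset.mem_univ, true_and]
  exact ⟨fun ⟨c, hc⟩ => ⟨_, hc⟩, fun ⟨c, hc⟩ => ⟨c.rev, by rwa [Fin.rev_rev]⟩⟩

/-- Every label of the tuple `p` occurs on at least two edges. -/
def JointlyMatched {ι : Type*} {n h r : ℕ} [NeZero h] (l : Fin n → Fin n → ι)
    (p : Fin r → Fin h → Fin n) : Prop :=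
  ∀ c i, ∃ d j, (d, j) ≠ (c, i) ∧ edgeLabel l (p d) j = edgeLabel l (p c) i

/-- The circuits `c` and `d` share a label. -/
def ShareLabel {ι : Type*} {n h : ℕ} [NeZero h] (l : Fin n → Fin n → ι)
    (c d : Fin h → Fin n) : Prop := ∃ i j, edgeLabel l c i = edgeLabel l d j

/-- If a label occurs once on `c`, the absence of a saving in either order puts it on an earlier and
on a later circuit. Otherwise all multiplicities on `c` are at least two and any shared first label
will do. A link through the second array yields one: since that edge saves nothing, its first label
is known as well. -/
lemma exists_shared_label {ι κ : Type*} [DecidableEq ι] [DecidableEq κ] {n h r : ℕ} [NeZero h]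
    {l : Fin n → Fin n → ι} {l' : Fin n → Fin n → κ} {p : Fin r → Fin h → Fin n}
    (hlink : ∀ c, ∃ d ≠ c, ShareLabel l (p c) (p d) ∨ ShareLabel l' (p c) (p d)) (c : Fin r)
    (hf : ¬ Saved l l' (labelsOn l p (Finset.Iio c)) (labelsOn l' p (Finset.Iio c)) (p c))
    (hb : ¬ Saved l l' (labelsOn l p (Finset.Ioi c)) (labelsOn l' p (Finset.Ioi c)) (p c)) :
    ∃ t ∈ circuitLabels l (p c), (∃ d ≠ c, t ∈ circuitLabels l (p d)) ∧
      (multiplicity l (p c) t = 1 → (∃ d < c, t ∈ circuitLabels l (p d)) ∧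
        ∃ d > c, t ∈ circuitLabels l (p d)) := by
  simp only [Saved, not_or, not_exists, not_and] at hf hb
  by_cases hs : ∃ i, ∀ j, edgeLabel l (p c) j = edgeLabel l (p c) i → j = i
  · obtain ⟨i, hi⟩ := hs
    have h1 : edgeLabel l (p c) i ∈ labelsOn l p (Finset.Iio c) := by
      by_contra h
      exact hf.1 i h hi
    have h2 : edgeLabel l (p c) i ∈ labelsOn l p (Finset.Ioi c) := by
      by_contra h
      exact hb.1 i h hi
    rw [mem_labelsOn] at h1 h2
    obtain ⟨d, hd, h1⟩ := h1
    obtain ⟨e, he, h2⟩ := h2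
    rw [Finset.mem_Iio] at hd
    rw [Finset.mem_Ioi] at he
    exact ⟨_, edgeLabel_mem _ _ i, ⟨d, hd.ne, h1⟩, fun _ => ⟨⟨d, hd, h1⟩, e, he, h2⟩⟩
  · have hm : ∀ t, multiplicity l (p c) t ≠ 1 := by
      intro t ht
      rw [multiplicity, Finset.card_eq_one] at ht
      obtain ⟨i, hi⟩ := ht
      simp only [Finset.ext_iff, Finset.mem_filter, Finset.mem_univ, true_and,
        Finset.mem_singleton] at hi
      refine hs ⟨i, fun j hj => (hi j).1 ?_⟩
      rw [hj, (hi i).2 rfl]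
    suffices ∃ t ∈ circuitLabels l (p c), ∃ d ≠ c, t ∈ circuitLabels l (p d) by
      obtain ⟨t, ht, hd⟩ := this
      exact ⟨t, ht, hd, fun h => absurd h (hm t)⟩
    obtain ⟨d, hd, ⟨i, j, hij⟩ | ⟨i, j, hij⟩⟩ := hlink c
    · exact ⟨_, edgeLabel_mem _ _ i, d, hd, hij ▸ edgeLabel_mem _ _ j⟩
    · rcases lt_or_gt_of_ne hd with hlt | hlt
      · have h1 : edgeLabel l (p c) i ∈ labelsOn l p (Finset.Iio c) := by
          by_contra h
          exact hf.2 i h (mem_labelsOn.2 ⟨d, by simpa, hij ▸ edgeLabel_mem _ _ j⟩)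
        obtain ⟨e, he, h1⟩ := mem_labelsOn.1 h1
        exact ⟨_, edgeLabel_mem _ _ i, e, (Finset.mem_Iio.1 he).ne, h1⟩
      · have h1 : edgeLabel l (p c) i ∈ labelsOn l p (Finset.Ioi c) := by
          by_contra h
          exact hb.2 i h (mem_labelsOn.2 ⟨d, by simpa, hij ▸ edgeLabel_mem _ _ j⟩)
        obtain ⟨e, he, h1⟩ := mem_labelsOn.1 h1
        exact ⟨_, edgeLabel_mem _ _ i, e, (Finset.mem_Ioi.1 he).ne', h1⟩

/-- Each order counts every label once and adds 1 for each circuit that it does not save. With `T`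
the set of all labels and `B` the set of circuits saved in neither order, the claim reduces to `2 *
T.card + B.card ≤ r * h`. Each circuit of `B` is charged to a label given by `exists_shared_label`,
and a label turns out to occur on at least two edges more than it has charges; the total number of
edges is `r * h`. -/
lemma forwardCost_add_backwardCost_le {ι κ : Type*} {n h r : ℕ} [NeZero h]
    {l : Fin n → Fin n → ι} {l' : Fin n → Fin n → κ} {p : Fin r → Fin h → Fin n}
    (hm : JointlyMatched l p)
    (hlink : ∀ c, ∃ d ≠ c, ShareLabel l (p c) (p d) ∨ ShareLabel l' (p c) (p d)) :
    forwardCost l l' p + backwardCost l l' p ≤ r * h + r := by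
  classical
  let Sf : Fin r → Prop := fun c =>
    Saved l l' (labelsOn l p (Finset.Iio c)) (labelsOn l' p (Finset.Iio c)) (p c)
  let Sb : Fin r → Prop := fun c =>
    Saved l l' (labelsOn l p (Finset.Ioi c)) (labelsOn l' p (Finset.Ioi c)) (p c)
  set T := labelsOn l p Finset.univ with hT
  let B : Finset (Fin r) := Finset.univ.filter fun c => ¬ Sf c ∧ ¬ Sb c
  have hex : ∀ c, ∃ t, c ∈ B → t ∈ circuitLabels l (p c) ∧
      (∃ d ≠ c, t ∈ circuitLabels l (p d)) ∧
      (multiplicity l (p c) t = 1 → (∃ d < c, t ∈ circuitLabels l (p d)) ∧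
        ∃ d > c, t ∈ circuitLabels l (p d)) := by
    intro c
    by_cases hc : c ∈ B
    · have := (Finset.mem_filter.1 hc).2
      obtain ⟨t, h1, h2⟩ := exists_shared_label hlink c this.1 this.2
      exact ⟨t, fun _ => ⟨h1, h2⟩⟩
    · exact ⟨edgeLabel l (p c) 0, fun h => absurd h hc⟩
  choose f hf using hex
  -- A label with a charge lies on at least two circuits. On the first and on the last circuit
  -- carrying it, a charge forces multiplicity at least two, since no circuit further out carries
  -- it. These two extreme circuits supply the 2 in addition to all charges.
  have hfib : ∀ t ∈ T, 2 + (B.filter fun c => f c = t).card ≤ ∑ c, multiplicity l (p c) t := by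
    intro t ht
    have hle : ∀ c, (if c ∈ B.filter (fun c => f c = t) then 1 else 0) ≤
        multiplicity l (p c) t := by
      intro c
      split_ifs with hc
      · rw [Finset.mem_filter] at hc
        have := (hf c hc.1).1
        rw [hc.2] at this
        exact multiplicity_pos.2 this
      · exact Nat.zero_le _
    rcases (B.filter fun c => f c = t).eq_empty_or_nonempty with he | ⟨c₀, hc₀⟩
    · rw [he, Finset.card_empty, add_zero]
      obtain ⟨c, -, hc⟩ := mem_labelsOn.1 ht
      simp only [circuitLabels, Finset.mem_image, Finset.mem_univ, true_and] at hc
      obtain ⟨i, rfl⟩ := hc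
      obtain ⟨d, j, hne, hdj⟩ := hm c i
      by_cases hdc : d = c
      · subst hdc
        refine le_trans ?_ (Finset.single_le_sum (f := fun c => multiplicity l (p c) _)
          (fun _ _ => Nat.zero_le _) (Finset.mem_univ d))
        refine Finset.one_lt_card.2 ⟨j, by simpa, i, by simp, fun h => hne (by rw [h])⟩
      · calc 2 ≤ ∑ e ∈ {c, d}, multiplicity l (p e) (edgeLabel l (p c) i) := by
              rw [Finset.sum_pair (Ne.symm hdc)]
              have h1 := multiplicity_pos.2 (edgeLabel_mem l (p c) i)
              have h2 := multiplicity_pos.2 (edgeLabel_mem l (p d) j)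
              rw [hdj] at h2
              omega
          _ ≤ _ := Finset.sum_le_sum_of_subset (Finset.subset_univ _)
    · let H := Finset.univ.filter fun c => t ∈ circuitLabels l (p c)
      rw [Finset.mem_filter] at hc₀
      obtain ⟨h1, ⟨d, hd, h2⟩, -⟩ := hf c₀ hc₀.1
      rw [hc₀.2] at h1 h2
      have hc₀H : c₀ ∈ H := by simpa [H] using h1
      have hdH : d ∈ H := by simpa [H] using h2
      have hne : H.Nonempty := ⟨c₀, hc₀H⟩
      have hlt : H.min' hne < H.max' hne :=
        Finset.min'_lt_max' H hc₀H hdH (Ne.symm hd)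
      have hmin : 1 + (if H.min' hne ∈ B.filter (fun c => f c = t) then 1 else 0) ≤
          multiplicity l (p (H.min' hne)) t := by
        have hpos : 0 < multiplicity l (p (H.min' hne)) t :=
          multiplicity_pos.2 (Finset.mem_filter.1 (H.min'_mem hne)).2
        split_ifs with hc
        · rw [Finset.mem_filter] at hc
          by_contra hcon
          obtain ⟨⟨e, he, hte⟩, -⟩ := (hf _ hc.1).2.2 (by rw [hc.2]; omega)
          rw [hc.2] at hte
          exact absurd (H.min'_le e (by simpa [H] using hte)) (not_le.2 he)
        · omega
      have hmax : 1 + (if H.max' hne ∈ B.filter (fun c => f c = t) then 1 else 0) ≤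
          multiplicity l (p (H.max' hne)) t := by
        have hpos : 0 < multiplicity l (p (H.max' hne)) t :=
          multiplicity_pos.2 (Finset.mem_filter.1 (H.max'_mem hne)).2
        split_ifs with hc
        · rw [Finset.mem_filter] at hc
          by_contra hcon
          obtain ⟨-, e, he, hte⟩ := (hf _ hc.1).2.2 (by rw [hc.2]; omega)
          rw [hc.2] at hte
          exact absurd (H.le_max' e (by simpa [H] using hte)) (not_le.2 he)
        · omega
      calc 2 + (B.filter fun c => f c = t).card
          = ∑ c, ((if c = H.min' hne then 1 else 0) + (if c = H.max' hne then 1 else 0) +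
            if c ∈ B.filter (fun c => f c = t) then 1 else 0) := by
            rw [Finset.sum_add_distrib, Finset.sum_add_distrib]
            simp only [Finset.sum_ite_eq', Finset.mem_univ, if_true, Finset.sum_ite_mem,
              Finset.univ_inter, Finset.sum_const, smul_eq_mul, mul_one]
        _ ≤ _ := by
            refine Finset.sum_le_sum fun c _ => ?_
            by_cases e1 : c = H.min' hne
            · subst e1
              rw [if_pos rfl, if_neg hlt.ne]
              simpa using hmin
            by_cases e2 : c = H.max' hne
            · subst e2
              rw [if_pos rfl, if_neg hlt.ne']
              simpa using hmax
            rw [if_neg e1, if_neg e2]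
            simpa using hle c
  have hBT : 2 * T.card + B.card ≤ r * h := by
    have h1 : B.card = ∑ t ∈ T, (B.filter fun c => f c = t).card :=
      Finset.card_eq_sum_card_fiberwise fun c hc =>
        mem_labelsOn.2 ⟨c, Finset.mem_univ _, (hf c hc).1⟩
    calc 2 * T.card + B.card = ∑ t ∈ T, (2 + (B.filter fun c => f c = t).card) := by
          rw [Finset.sum_add_distrib, ← h1, Finset.sum_const, smul_eq_mul, mul_comm]
      _ ≤ ∑ t ∈ T, ∑ c, multiplicity l (p c) t := Finset.sum_le_sum hfib
      _ = ∑ c, ∑ t ∈ T, multiplicity l (p c) t := Finset.sum_comm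
      _ = ∑ c : Fin r, h := Finset.sum_congr rfl fun c _ => sum_multiplicity l (p c) T
          fun t ht => mem_labelsOn.2 ⟨c, Finset.mem_univ _, ht⟩
      _ = r * h := by simp
  have e1 : forwardCost l l' p = T.card + ∑ c, if Sf c then 0 else 1 := by
    rw [hT, ← sum_card_new_forward, ← Finset.sum_add_distrib]
    rfl
  have e2 : backwardCost l l' p = T.card + ∑ c, if Sb c then 0 else 1 := by
    rw [hT, ← sum_card_new_backward, ← Finset.sum_add_distrib]
    rfl
  have e3 : (∑ c, if Sf c then 0 else 1) + (∑ c, if Sb c then 0 else 1) ≤ r + B.card := by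
    have : r + B.card = ∑ c : Fin r, (1 + if ¬ Sf c ∧ ¬ Sb c then 1 else 0) := by
      rw [Finset.sum_add_distrib, ← Finset.card_filter]
      simp [B]
    rw [this, ← Finset.sum_add_distrib]
    refine Finset.sum_le_sum fun c _ => ?_
    by_cases h1 : Sf c <;> by_cases h2 : Sb c <;> simp [h1, h2]
  omega

/-- One of the two costs is at most half of 4h + 4, and reversing the tuple exchanges them. The
exponent is two below that of the normalization (n^(1+h/2))^4, which makes the fourth moments
summable. -/
lemma exists_card_linked_le (ι κ : Type*) (D h : ℕ) [NeZero h] : ∃ K : ℕ, ∀ (n : ℕ)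
    (l : Fin n → Fin n → ι) (l' : Fin n → Fin n → κ), 0 < n → RowBound D l → RowBound D l' →
    {p : Fin 4 → Fin h → Fin n | JointlyMatched l p ∧
      ∀ c, ∃ d ≠ c, ShareLabel l (p c) (p d) ∨ ShareLabel l' (p c) (p d)}.ncard ≤
      K * n ^ (2 * h + 2) := by
  classical
  obtain ⟨K, hK⟩ := exists_card_forwardCost_le ι κ D h 4 (2 * h + 2)
  refine ⟨2 * K, fun n l l' hn hl hl' => ?_⟩
  have h1 := hK n l l' hn hl hl' _ le_rfl
  set F := Finset.univ.filter fun p : Fin 4 → Fin h → Fin n => forwardCost l l' p ≤ 2 * h + 2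
    with hF
  calc _ ≤ (F ∪ F.image fun p c => p c.rev).card := by
        rw [← Set.ncard_coe_finset]
        refine Set.ncard_le_ncard ?_ (Set.toFinite _)
        rintro p ⟨hp, hp'⟩
        have := forwardCost_add_backwardCost_le hp hp'
        simp only [Finset.coe_union, Finset.coe_image, Set.mem_union, Finset.mem_coe, hF,
          Finset.mem_filter, Finset.mem_univ, true_and, Set.mem_image]
        rcases le_or_gt (forwardCost l l' p) (2 * h + 2) with h | h
        · exact .inl h
        · refine .inr ⟨fun c => p c.rev, ?_, by simp⟩
          rw [forwardCost_rev]
          omega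
    _ ≤ F.card + F.card := (Finset.card_union_le _ _).trans (Nat.add_le_add_left Finset.card_image_le _)
    _ ≤ _ := by rw [mul_assoc]; omega

end SchurHadamard

namespace SchurHadamard

/-! ## Walks that traverse an edge for every letter of a list -/

/-- The unoriented edges of the walk that starts at `v`. -/
def walkEdges {V : Type*} : V → List V → List (Sym2 V)
  | _, [] => []
  | v, x :: xs => s(v, x) :: walkEdges x xs

/-- The last vertex of the walk that starts at `v`. -/
def walkEnd {V : Type*} : V → List V → V
  | v, [] => v
  | _, x :: xs => walkEnd x xs

lemma walkEdges_append {V : Type*} (v : V) (us vs : List V) :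
    walkEdges v (us ++ vs) = walkEdges v us ++ walkEdges (walkEnd v us) vs := by
  induction us generalizing v with
  | nil => rfl
  | cons x us ih => simp [walkEdges, walkEnd, ih]

lemma walkEnd_append {V : Type*} (v : V) (us vs : List V) :
    walkEnd v (us ++ vs) = walkEnd (walkEnd v us) vs := by
  induction us generalizing v with
  | nil => rfl
  | cons x us ih => simp [walkEnd, ih]

lemma length_walkEdges {V : Type*} (v : V) (vs : List V) :
    (walkEdges v vs).length = vs.length := by
  induction vs generalizing v with
  | nil => rfl
  | cons x us ih => simp [walkEdges, ih]

lemma walkEnd_mem {V : Type*} (v : V) {vs : List V} (h : vs ≠ []) : walkEnd v vs ∈ vs := by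
  induction vs generalizing v with
  | nil => exact absurd rfl h
  | cons x us ih =>
    rcases us with - | ⟨y, us⟩
    · simp [walkEnd]
    · exact List.mem_cons_of_mem _ (ih x (by simp))

lemma mem_of_mem_walkEdges {V : Type*} {v b : V} {vs : List V} {e : Sym2 V}
    (he : e ∈ walkEdges v vs) (hb : b ∈ e) : b ∈ v :: vs := by
  induction vs generalizing v with
  | nil => simp [walkEdges] at he
  | cons x us ih =>
    simp only [walkEdges, List.mem_cons] at he
    rcases he with rfl | he
    · rw [Sym2.mem_iff] at hb
      simp only [List.mem_cons]
      tauto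
    · exact List.mem_cons_of_mem _ (ih he)

/-- The walk from `v` through `vs` is closed, and edges with equal letters in `l` are equal. -/
def IsLetterWalk {V : Type*} (l : List ℕ) (v : V) (vs : List V) : Prop :=
  vs.length = l.length ∧ walkEnd v vs = v ∧
    ∀ p ∈ l.zip (walkEdges v vs), ∀ q ∈ l.zip (walkEdges v vs), p.1 = q.1 → p.2 = q.2

/-- Traversing one unoriented edge twice in succession leads back to its starting point, so a double
letter is an excursion to an arbitrary vertex `b` and back. -/
lemma isLetterWalk_insert {V : Type*} {u v : List ℕ} {a : ℕ} (ha : a ∉ u ++ v) {x b c : V}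
    {us vs : List V} (hu : us.length = u.length) (hv : vs.length = v.length) :
    IsLetterWalk (u ++ a :: a :: v) x (us ++ b :: c :: vs) ↔
      c = walkEnd x us ∧ IsLetterWalk (u ++ v) x (us ++ vs) := by
  have hu' : u.length = (walkEdges x us).length := by rw [length_walkEdges, hu]
  simp only [IsLetterWalk, walkEnd_append, walkEdges_append, walkEnd, walkEdges]
  rw [List.zip_append hu', List.zip_append hu', List.zip_cons_cons, List.zip_cons_cons]
  have hua : ∀ (e : Sym2 V) (es : List (Sym2 V)), (a, e) ∉ u.zip es := fun e es h =>
    ha (List.mem_append_left _ (List.of_mem_zip h).1)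
  have hva : ∀ (e : Sym2 V) (es : List (Sym2 V)), (a, e) ∉ v.zip es := fun e es h =>
    ha (List.mem_append_right _ (List.of_mem_zip h).1)
  constructor
  · rintro ⟨-, h2, h3⟩
    have hc : c = walkEnd x us := by
      have := h3 (a, s(walkEnd x us, b)) (by simp) (a, s(b, c)) (by simp) rfl
      simp only [Sym2.eq_iff] at this
      rcases this with ⟨h, h'⟩ | ⟨h, -⟩
      · rw [h, h']
      · exact h.symm
    subst hc
    refine ⟨rfl, by simp [hu, hv], h2, fun p hp q hq => h3 p ?_ q ?_⟩
    · simp only [List.mem_append, List.mem_cons] at hp ⊢; tauto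
    · simp only [List.mem_append, List.mem_cons] at hq ⊢; tauto
  · rintro ⟨rfl, h1, h2, h3⟩
    refine ⟨by simp [hu, hv], h2, fun p hp q hq => ?_⟩
    have hs : s(b, walkEnd x us) = s(walkEnd x us, b) := Sym2.eq_swap
    rw [hs] at hp hq
    have key : ∀ r : ℕ × Sym2 V, r ∈ u.zip (walkEdges x us) ++
        (a, s(walkEnd x us, b)) :: (a, s(walkEnd x us, b)) ::
          v.zip (walkEdges (walkEnd x us) vs) →
        r = (a, s(walkEnd x us, b)) ∨ (r.1 ≠ a ∧
          r ∈ u.zip (walkEdges x us) ++ v.zip (walkEdges (walkEnd x us) vs)) := by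
      rintro ⟨r, e⟩ hr
      simp only [List.mem_append, List.mem_cons] at hr ⊢
      rcases hr with hr | hr | hr | hr
      · exact .inr ⟨by rintro rfl; exact hua _ _ hr, .inl hr⟩
      · exact .inl hr
      · exact .inl hr
      · exact .inr ⟨by rintro rfl; exact hva _ _ hr, .inr hr⟩
    rcases key p hp with rfl | ⟨hp1, hp2⟩ <;> rcases key q hq with rfl | ⟨hq1, hq2⟩ <;> intro h
    · rfl
    · exact absurd h.symm hq1
    · exact absurd h hp1
    · exact h3 p hp2 q hq2 h

/-- Each double letter contributes one free vertex in addition to the starting vertex. -/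
lemma CatalanList.ncard_letterWalks {l : List ℕ} (h : CatalanList l) (V : Type*) :
    {q : V × List V | IsLetterWalk l q.1 q.2}.ncard = Nat.card V ^ (l.length / 2 + 1) := by
  induction h with
  | double a =>
    have : {q : V × List V | IsLetterWalk [a, a] q.1 q.2} =
        (fun p : V × V => (p.1, [p.2, p.1])) '' (Set.univ ×ˢ Set.univ) := by
      ext ⟨x, xs⟩
      simp only [Set.mem_ofPred_eq, Set.univ_prod_univ, Set.image_univ, Set.mem_range,
        Prod.mk.injEq, Prod.exists]
      constructor
      · rintro ⟨h1, h2, -⟩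
        rcases xs with - | ⟨b, - | ⟨c, - | ⟨d, ds⟩⟩⟩ <;> simp at h1
        simp only [walkEnd] at h2
        exact ⟨x, b, rfl, by rw [h2]⟩
      · rintro ⟨x, b, rfl, rfl⟩
        refine ⟨rfl, rfl, ?_⟩
        simp [walkEdges, Sym2.eq_swap]
    rw [this, Set.ncard_image_of_injective _ (by rintro ⟨x, y⟩ ⟨x', y'⟩; simp; tauto),
      Set.ncard_prod, Set.ncard_univ]
    simp [pow_two]
  | insert u v a ha _ ih =>
    have : {q : V × List V | IsLetterWalk (u ++ a :: a :: v) q.1 q.2} =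
        (fun p : (V × List V) × V => (p.1.1, p.1.2.take u.length ++ p.2 ::
          walkEnd p.1.1 (p.1.2.take u.length) :: p.1.2.drop u.length)) ''
          ({q : V × List V | IsLetterWalk (u ++ v) q.1 q.2} ×ˢ Set.univ) := by
      ext ⟨x, xs⟩
      simp only [Set.mem_ofPred_eq, Set.mem_image, Set.mem_prod, Set.mem_univ, and_true,
        Prod.mk.injEq, Prod.exists]
      constructor
      · intro h
        have hlen := h.1
        simp only [List.length_append, List.length_cons] at hlen
        obtain ⟨us, r, rfl, hus⟩ : ∃ us r, xs = us ++ r ∧ us.length = u.length :=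
          ⟨xs.take u.length, xs.drop u.length, by simp, by simp; omega⟩
        simp only [List.length_append] at hlen
        rcases r with - | ⟨b, - | ⟨c, r⟩⟩
        · simp at hlen; omega
        · simp at hlen; omega
        · simp only [List.length_cons] at hlen
          obtain ⟨rfl, h'⟩ := (isLetterWalk_insert ha hus (by omega)).1 h
          refine ⟨x, us ++ r, b, h', rfl, ?_⟩
          simp [← hus]
      · rintro ⟨x, ys, b, h, rfl, rfl⟩
        have hlen := h.1
        rw [List.length_append] at hlen
        rw [isLetterWalk_insert ha (by simp; omega) (by simp; omega)]
        simpa using h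
    rw [this, Set.InjOn.ncard_image, Set.ncard_prod, ih, Set.ncard_univ]
    · rw [← pow_succ]
      congr 1
      simp only [List.length_append, List.length_cons]
      omega
    · rintro ⟨⟨x, xs⟩, b⟩ h ⟨⟨x', xs'⟩, b'⟩ h' heq
      have hlen := h.1.1
      have hlen' := h'.1.1
      simp only [List.length_append] at hlen hlen'
      simp only [Prod.mk.injEq] at heq ⊢
      obtain ⟨rfl, heq⟩ := heq
      obtain ⟨e1, e2⟩ := List.append_inj heq (by simp; omega)
      simp only [List.cons.injEq] at e2
      refine ⟨⟨rfl, ?_⟩, e2.1⟩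
      rw [← List.take_append_drop u.length xs, ← List.take_append_drop u.length xs', e1, e2.2.2]

/-- With so many vertices, some vertex other than the start is visited only once. The edges into and
out of it must carry the same letter, and that letter occurs nowhere else; deleting the excursion
reduces `k` by one. -/
lemma IsLetterWalk.catalanList {V : Type*} [DecidableEq V] (k : ℕ) {l : List ℕ} {x : V}
    {xs : List V} (hk : 1 ≤ k) (hl : l.length = 2 * k) (hcount : ∀ a ∈ l, l.count a = 2)
    (h : IsLetterWalk l x xs) (hcard : k + 1 ≤ xs.toFinset.card) : CatalanList l := by
  induction k generalizing l xs with
  | zero => omega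
  | succ k ih =>
    have hxs : xs.length = 2 * (k + 1) := h.1.trans hl
    have hne : xs ≠ [] := by rintro rfl; simp at hxs
    have hx : x ∈ xs := by
      have := walkEnd_mem x hne
      rwa [h.2.1] at this
    -- The list `xs` has `2 * (k + 1)` entries and contains the start and at least `k + 1` other
    -- vertices; these cannot all be repeated.
    obtain ⟨b, hb, hbx, hbc⟩ : ∃ b ∈ xs, b ≠ x ∧ xs.count b = 1 := by
      by_contra! hcon
      have h2 : ∀ b ∈ xs.toFinset.erase x, 2 ≤ xs.count b := by
        intro b hb
        rw [Finset.mem_erase, List.mem_toFinset] at hb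
        have := List.count_pos_iff.2 hb.2
        have := hcon b hb.2 hb.1
        omega
      have h3 := Finset.card_nsmul_le_sum _ _ _ h2
      have h4 := Multiset.toFinset_sum_count_eq (xs : Multiset V)
      simp only [Multiset.coe_count, Multiset.coe_card, List.toFinset_coe] at h4
      rw [← Finset.add_sum_erase _ _ (List.mem_toFinset.2 hx)] at h4
      rw [Finset.card_erase_of_mem (List.mem_toFinset.2 hx), smul_eq_mul] at h3
      have := List.count_pos_iff.2 hx
      omega
    obtain ⟨us, ws, rfl⟩ := List.append_of_mem hb
    have hbu : b ∉ us := fun hmem => by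
      have := List.count_pos_iff.2 hmem
      simp at hbc
      omega
    have hbw : b ∉ ws := fun hmem => by
      have := List.count_pos_iff.2 hmem
      simp at hbc
      omega
    rcases ws with - | ⟨c, vs⟩
    · have := h.2.1
      rw [walkEnd_append] at this
      exact absurd this hbx
    simp only [List.length_append, List.length_cons] at hxs
    obtain ⟨u, r, rfl, hu⟩ : ∃ u r, l = u ++ r ∧ us.length = u.length :=
      ⟨l.take us.length, l.drop us.length, by simp, by simp; omega⟩
    simp only [List.length_append] at hl
    rcases r with - | ⟨a, - | ⟨a', v⟩⟩
    · simp at hl; omega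
    · simp at hl; omega
    simp only [List.length_cons] at hl
    have hv : vs.length = v.length := by omega
    have hu' : u.length = (walkEdges x us).length := by rw [length_walkEdges, hu]
    have hzip : (u ++ a :: a' :: v).zip (walkEdges x (us ++ b :: c :: vs)) =
        u.zip (walkEdges x us) ++ (a, s(walkEnd x us, b)) :: (a', s(b, c)) ::
          v.zip (walkEdges c vs) := by
      rw [walkEdges_append, List.zip_append hu']
      rfl
    have hfun := h.2.2
    rw [hzip] at hfun
    -- Any other edge with the letter of the edge into `b` would contain `b` too. Only the edge out
    -- of `b` can do so, which excludes the letter from `u` and from `v`.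
    have hau : a ∉ u := by
      intro hmem
      obtain ⟨i, hi, hia⟩ := List.getElem_of_mem hmem
      have hmem' : (a, (walkEdges x us)[i]'(by omega)) ∈ u.zip (walkEdges x us) := by
        rw [← hia, ← List.getElem_zip (h := by simp; omega)]
        exact List.getElem_mem _
      have := hfun _ (List.mem_append_left _ hmem') (a, s(walkEnd x us, b)) (by simp) rfl
      have hb' := mem_of_mem_walkEdges (b := b) (List.of_mem_zip hmem').2
        (by simp only at this; simp [this])
      simp only [List.mem_cons] at hb'
      tauto
    have hav : a ∉ v := by
      intro hmem
      obtain ⟨i, hi, hia⟩ := List.getElem_of_mem hmem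
      have hmem' : (a, (walkEdges c vs)[i]'(by rw [length_walkEdges]; omega)) ∈
          v.zip (walkEdges c vs) := by
        rw [← hia, ← List.getElem_zip (h := by simp [length_walkEdges]; omega)]
        exact List.getElem_mem _
      have := hfun (a, (walkEdges c vs)[i]'(by rw [length_walkEdges]; omega))
        (by simp only [List.mem_append, List.mem_cons]; tauto)
        (a, s(walkEnd x us, b)) (by simp) rfl
      have hb' := mem_of_mem_walkEdges (b := b) (List.of_mem_zip hmem').2
        (by simp only at this; simp [this])
      exact hbw hb'
    have haa : a = a' := by
      by_contra hne
      have := hcount a (by simp)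
      rw [List.count_append, List.count_cons_self, List.count_cons_of_ne (Ne.symm hne),
        List.count_eq_zero_of_not_mem hau, List.count_eq_zero_of_not_mem hav] at this
      omega
    subst haa
    have ha : a ∉ u ++ v := by simp [hau, hav]
    obtain ⟨rfl, hw⟩ := (isLetterWalk_insert ha hu hv).1 h
    rcases k with - | k
    · have e1 : u = [] := List.length_eq_zero_iff.1 (by omega)
      have e2 : v = [] := List.length_eq_zero_iff.1 (by omega)
      subst e1 e2
      exact .double a
    refine .insert u v a ha (ih (by omega) (by simp; omega) ?_ hw ?_)
    · intro d hd
      have hda : a ≠ d := by rintro rfl; exact ha hd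
      have := hcount d (by simp at hd ⊢; tauto)
      rw [List.count_append, List.count_cons_of_ne hda, List.count_cons_of_ne hda] at this
      rwa [List.count_append]
    · have hmem : walkEnd x us ∈ us ++ vs := by
        rcases us with - | ⟨y, us⟩
        · have := walkEnd_mem x (vs := vs) (by rintro rfl; simp at hxs)
          rw [show walkEnd x vs = x from hw.2.1] at this
          simpa [walkEnd] using this
        · exact List.mem_append_left _ (walkEnd_mem x (by simp))
      have hsub : (us ++ b :: walkEnd x us :: vs).toFinset ⊆ insert b (us ++ vs).toFinset := by
        intro y hy
        simp only [List.mem_toFinset, List.mem_append, List.mem_cons, Finset.mem_insert] at hy ⊢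
        rcases hy with hy | hy | rfl | hy
        · tauto
        · tauto
        · right; simpa using hmem
        · tauto
      have := (Finset.card_le_card hsub).trans (Finset.card_insert_le _ _)
      omega

/-! ### From walks to circuits, and the links that determine the Wigner link -/

lemma walkEdges_ofFn {V : Type*} {h : ℕ} (p : Fin (h + 1) → V) :
    walkEdges (p 0) (List.ofFn fun i : Fin h => p i.succ) =
      List.ofFn fun i : Fin h => s(p i.castSucc, p i.succ) := by
  induction h with
  | zero => rfl
  | succ h ih =>
    rw [List.ofFn_succ, List.ofFn_succ, walkEdges]
    have := ih fun i => p i.succ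
    simp only [Fin.succ_zero_eq_one] at this ⊢
    rw [this]
    rfl

lemma walkEnd_ofFn {V : Type*} {h : ℕ} (p : Fin (h + 1) → V) :
    walkEnd (p 0) (List.ofFn fun i : Fin h => p i.succ) = p (Fin.last h) := by
  induction h with
  | zero => rfl
  | succ h ih =>
    rw [List.ofFn_succ, walkEnd]
    exact ih fun i => p i.succ

/-- The closed circuits whose (unoriented) edges are equal whenever the letters are. -/
def weakClass (n : ℕ) {h : ℕ} (w : Word h) : Set (Fin (h + 1) → Fin n) :=
  {p | p 0 = p (Fin.last h) ∧ ∀ i j : Fin h, w.letter i = w.letter j →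
    s(p i.castSucc, p i.succ) = s(p j.castSucc, p j.succ)}

lemma isLetterWalk_iff {n h : ℕ} (w : Word h) (p : Fin (h + 1) → Fin n) :
    IsLetterWalk (List.ofFn w.letter) (p 0) (List.ofFn fun i : Fin h => p i.succ) ↔
      p ∈ weakClass n w := by
  have hz : ∀ z, z ∈ (List.ofFn w.letter).zip
      (List.ofFn fun i : Fin h => s(p i.castSucc, p i.succ)) ↔
      ∃ i : Fin h, (w.letter i, s(p i.castSucc, p i.succ)) = z := by
    intro z
    rw [List.mem_iff_getElem]
    constructor
    · rintro ⟨i, hi, rfl⟩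
      simp at hi
      exact ⟨⟨i, hi⟩, by simp⟩
    · rintro ⟨i, rfl⟩
      exact ⟨i, by simp, by simp⟩
  simp only [IsLetterWalk, walkEnd_ofFn, walkEdges_ofFn, List.length_ofFn, true_and, weakClass,
    Set.mem_ofPred_eq, hz]
  rw [eq_comm]
  refine and_congr_right fun _ => ⟨fun H i j hij => H _ ⟨i, rfl⟩ _ ⟨j, rfl⟩ hij, ?_⟩
  rintro H _ ⟨i, rfl⟩ _ ⟨j, rfl⟩ hij
  exact H i j hij

lemma ncard_weakClass (n : ℕ) {k : ℕ} {w : Word (2 * k)} (hw : w.IsCatalan) :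
    (weakClass n w).ncard = n ^ (k + 1) := by
  have := CatalanList.ncard_letterWalks hw (Fin n)
  simp only [Nat.card_eq_fintype_card, Fintype.card_fin, List.length_ofFn] at this
  rw [Nat.mul_div_cancel_left _ (by norm_num)] at this
  rw [← this]
  refine Set.ncard_congr (fun p _ => (p 0, List.ofFn fun i : Fin (2 * k) => p i.succ)) ?_ ?_ ?_
  · intro p hp
    exact (isLetterWalk_iff w p).2 hp
  · intro p q _ _ h
    simp only [Prod.mk.injEq] at h
    have h2 := List.ofFn_injective h.2
    funext i
    refine Fin.cases h.1 (fun i => congrFun h2 i) i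
  · rintro ⟨x, xs⟩ h
    have hlen : xs.length = 2 * k := by simpa using h.1
    have hxs : xs = List.ofFn fun i : Fin (2 * k) =>
        (Fin.cons x (fun i : Fin (2 * k) => xs[(i : ℕ)]'(by omega)) : Fin (2 * k + 1) → Fin n)
          i.succ := by
      apply List.ext_getElem
      · simp [hlen]
      · simp
    refine ⟨Fin.cons x fun i : Fin (2 * k) => xs[(i : ℕ)]'(by omega), ?_, ?_⟩
    · rw [← isLetterWalk_iff, ← hxs]
      exact h
    · rw [← hxs]
      rfl

lemma card_image_le_of_not_isCatalan {n k : ℕ} (hk : 1 ≤ k) {w : Word (2 * k)}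
    (hw : w.PairMatched) (hcat : ¬ w.IsCatalan) {p : Fin (2 * k + 1) → Fin n}
    (hp : p ∈ weakClass n w) : (Finset.univ.image p).card ≤ k := by
  by_contra hcon
  refine hcat (((isLetterWalk_iff w p).2 hp).catalanList k hk (by simp) ?_ ?_)
  · intro a ha
    rw [List.mem_ofFn] at ha
    obtain ⟨i, rfl⟩ := ha
    exact (ncard_eq_count _ _).symm.trans (hw i)
  · refine le_trans (not_le.1 hcon) (Finset.card_le_card ?_)
    intro v hv
    simp only [Finset.mem_image, Finset.mem_univ, true_and] at hv
    obtain ⟨i, rfl⟩ := hv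
    simp only [List.mem_toFinset, List.mem_ofFn]
    refine Fin.cases ?_ (fun i => ⟨i, rfl⟩) i
    exact ⟨⟨2 * k - 1, by omega⟩, by rw [hp.1]; congr 1; ext; simp; omega⟩

/-- A map with at most `k` values factors through `Fin k`. -/
lemma ncard_card_image_le (n m k : ℕ) :
    {p : Fin (m + 1) → Fin n | (Finset.univ.image p).card ≤ k}.ncard ≤ k ^ (m + 1) * n ^ k := by
  have hsub : {p : Fin (m + 1) → Fin n | (Finset.univ.image p).card ≤ k} ⊆
      Set.range fun q : (Fin (m + 1) → Fin k) × (Fin k → Fin n) => q.2 ∘ q.1 := by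
    intro p hp
    set S := Finset.univ.image p with hS
    have hp' : S.card ≤ k := hp
    have hmem : ∀ i, p i ∈ S := fun i => Finset.mem_image_of_mem _ (Finset.mem_univ i)
    refine ⟨(fun i => Fin.castLE hp' (S.equivFin ⟨p i, hmem i⟩),
      fun j => if hj : (j : ℕ) < S.card then (S.equivFin.symm ⟨j, hj⟩ : Fin n) else p 0), ?_⟩
    funext i
    simp
  refine (Set.ncard_le_ncard hsub (Set.toFinite _)).trans ?_
  rw [← Set.image_univ]
  refine (Set.ncard_image_le (Set.toFinite _)).trans ?_
  rw [Set.ncard_univ]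
  simp

/-- Circuits appear as maps on `Fin (h + 1)` with equal ends and as cyclic sequences on `Fin h`;
this matches the successor of one description with that of the other. -/
lemma closed_castSucc_add_one {V : Type*} {h : ℕ} [NeZero h] {p : Fin (h + 1) → V}
    (hp : p 0 = p (Fin.last h)) (i : Fin h) : p (i + 1).castSucc = p i.succ := by
  obtain - | m := h
  · exact i.elim0
  refine Fin.lastCases ?_ (fun j => ?_) i
  · rw [Fin.last_add_one, Fin.succ_last, ← hp]
    rfl
  · rw [Fin.coeSucc_eq_succ]
    rfl

lemma edgeLabel_comp_castSucc {ι : Type*} {n h : ℕ} [NeZero h] (l : Fin n → Fin n → ι)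
    {p : Fin (h + 1) → Fin n} (hp : p 0 = p (Fin.last h)) (i : Fin h) :
    edgeLabel l (fun j => p j.castSucc) i = l (p i.castSucc) (p i.succ) := by
  rw [edgeLabel, closed_castSucc_add_one hp]

lemma closed_ext {V : Type*} {h : ℕ} [NeZero h] {p q : Fin (h + 1) → V}
    (hp : p 0 = p (Fin.last h)) (hq : q 0 = q (Fin.last h))
    (hpq : (fun j : Fin h => p j.castSucc) = fun j => q j.castSucc) : p = q := by
  funext i
  refine Fin.lastCases ?_ (fun j => congrFun hpq j) i
  rw [← hp, ← hq]
  exact congrFun hpq 0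

lemma card_image_lt_card_image {α β γ : Type*} [Fintype α] [DecidableEq β] [DecidableEq γ]
    {f : α → β} {g : α → γ} (hfg : ∀ i j, f i = f j → g i = g j) {i j : α} (hij : f i ≠ f j)
    (hij' : g i = g j) : (Finset.univ.image g).card < (Finset.univ.image f).card := by
  have hex : ∀ b : β, ∃ c : γ, ∀ i, f i = b → g i = c := by
    intro b
    by_cases hb : ∃ i, f i = b
    · obtain ⟨i, rfl⟩ := hb
      exact ⟨g i, fun j hj => hfg _ _ hj⟩
    · exact ⟨g i, fun j hj => absurd ⟨j, hj⟩ hb⟩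
  choose φ hφ using hex
  have himg : Finset.univ.image g = (Finset.univ.image f).image φ := by
    rw [Finset.image_image]
    exact Finset.image_congr fun i _ => hφ _ i rfl
  rw [himg]
  refine lt_of_le_of_ne Finset.card_image_le fun h => hij ?_
  refine Finset.card_image_iff.1 h (by simp) (by simp) ?_
  rw [← hφ _ i rfl, ← hφ _ j rfl, hij']

lemma Word.PairMatched.card_letters {k : ℕ} {w : Word (2 * k)} (hw : w.PairMatched) :
    (Finset.univ.image w.letter).card = k := by
  have h1 := Finset.card_eq_sum_card_image w.letter Finset.univ
  rw [Finset.sum_congr rfl (g := fun _ => 2)] at h1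
  · simp at h1
    omega
  · intro a ha
    simp only [Finset.mem_image, Finset.mem_univ, true_and] at ha
    obtain ⟨i, rfl⟩ := ha
    refine Eq.trans ?_ (hw i)
    rw [← Set.ncard_coe_finset]
    simp

lemma exists_rowBound {ι κ : Type*} {LX : SymLink ι} {LY : SymLink κ} (hX : LX.PropertyB)
    (hY : LY.PropertyB) : ∃ D : ℕ, ∀ n, RowBound D (LX.val n) ∧ RowBound D (LY.val n) := by
  obtain ⟨D, hD⟩ := hX
  obtain ⟨D', hD'⟩ := hY
  exact ⟨max D D', fun n => ⟨⟨LX.symm n, fun t i => (hD n t i).trans (le_max_left _ _)⟩,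
    ⟨LY.symm n, fun t i => (hD' n t i).trans (le_max_right _ _)⟩⟩⟩

/-- In the difference two distinct letters receive the same label. At most `k - 1` labels remain,
which costs a factor `n` in the count of circuits. -/
lemma ncard_weakClass_diff_le {ι : Type*} {D n k : ℕ} (hk : 1 ≤ k) {L : SymLink ι}
    (hl : RowBound D (L.val n)) {w : Word (2 * k)} (hw : w.PairMatched) :
    (weakClass n w \ circuitClass L n w).ncard ≤ (D * (2 * k) + 1) ^ (2 * k) * n ^ k := by
  classical
  have : NeZero (2 * k) := ⟨by omega⟩
  have h1 := card_circuits_le (h := 2 * k) hl ∅ (k - 1)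
  rw [← Set.ncard_coe_finset, Finset.card_empty, zero_add, Nat.sub_add_cancel hk] at h1
  refine le_trans (Set.ncard_le_ncard_of_injOn (fun p j => p j.castSucc) ?_ ?_
    (Set.toFinite _)) h1
  · rintro p ⟨hp, hp'⟩
    have hlab : ∀ i j, w.letter i = w.letter j → L.val n (p i.castSucc) (p i.succ) =
        L.val n (p j.castSucc) (p j.succ) := by
      intro i j hij
      have := hp.2 i j hij
      rw [Sym2.eq_iff] at this
      rcases this with ⟨e1, e2⟩ | ⟨e1, e2⟩
      · rw [e1, e2]
      · rw [e1, e2, L.symm]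
    have hex : ∃ i j, w.letter i ≠ w.letter j ∧ L.val n (p i.castSucc) (p i.succ) =
        L.val n (p j.castSucc) (p j.succ) := by
      by_contra! hcon
      refine hp' ⟨hp.1, fun i j => ⟨hlab i j, fun h => ?_⟩⟩
      by_contra hne
      exact hcon i j hne h
    obtain ⟨i, j, hij, hij'⟩ := hex
    have := card_image_lt_card_image hlab hij hij'
    rw [hw.card_letters] at this
    simp only [Finset.coe_filter, Finset.mem_univ, true_and, Set.mem_ofPred_eq,
      Finset.sdiff_empty, circuitLabels]
    have heq : (edgeLabel (L.val n) fun j => p j.castSucc) =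
        fun i : Fin (2 * k) => L.val n (p i.castSucc) (p i.succ) :=
      funext fun i => edgeLabel_comp_castSucc _ hp.1 i
    rw [heq]
    omega
  · intro p hp q hq h
    exact closed_ext hp.1.1 hq.1.1 h

lemma tendsto_div_pow_of_le {f : ℕ → ℕ} {C e : ℕ} (hf : ∀ n, f n ≤ C * n ^ e) :
    Tendsto (fun n => (f n : ℝ) / (n : ℝ) ^ (e + 1)) atTop (𝓝 0) := by
  refine squeeze_zero' (g := fun n : ℕ => (C : ℝ) / n) (Eventually.of_forall fun n => by positivity)
    ?_ (tendsto_const_div_atTop_nhds_zero_nat _)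
  filter_upwards [eventually_gt_atTop 0] with n hn
  have hn' : (0 : ℝ) < n := by exact_mod_cast hn
  rw [div_le_div_iff₀ (by positivity) hn', pow_succ, ← mul_assoc]
  gcongr
  exact_mod_cast hf n

theorem leadsToWigner_of_determineWigner {ι κ : Type*} {LX : SymLink ι} {LY : SymLink κ}
    (hX : LX.PropertyB) (hY : LY.PropertyB) (hW : DetermineWigner LX LY) :
    LeadsToWigner LX LY := by
  intro k w hk hw
  obtain ⟨D, hD⟩ := exists_rowBound hX hY
  set I := fun n => circuitClass LX n w ∩ circuitClass LY n w with hI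
  have hsub : ∀ n, I n ⊆ weakClass n w := by
    rintro n p ⟨h1, h2⟩
    refine ⟨h1.1, fun i j hij => ?_⟩
    have := hW n _ _ _ _ ((h1.2 i j).1 hij) ((h2.2 i j).1 hij)
    simp only [wignerLink, Prod.mk.injEq] at this
    rw [Sym2.eq_iff]
    simp only [Fin.ext_iff]
    omega
  unfold HasWordLimit
  split_ifs with hcat
  · set C := 2 * (D * (2 * k) + 1) ^ (2 * k) with hC
    have hdiff : ∀ n, (weakClass n w \ I n).ncard ≤ C * n ^ k := by
      intro n
      rw [hI, Set.sdiff_inter]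
      refine (Set.ncard_union_le _ _).trans ?_
      have h1 := ncard_weakClass_diff_le hk (hD n).1 hw
      have h2 := ncard_weakClass_diff_le hk (hD n).2 hw
      rw [hC, mul_assoc]
      omega
    have hlim := tendsto_div_pow_of_le hdiff
    have h1 : Tendsto (fun n : ℕ => (1 : ℝ) - ((weakClass n w \ I n).ncard : ℝ) /
        (n : ℝ) ^ (k + 1)) atTop (𝓝 1) := by simpa using tendsto_const_nhds.sub hlim
    refine h1.congr' ?_
    filter_upwards [eventually_gt_atTop 0] with n hn
    have hn' : (0 : ℝ) < n := by exact_mod_cast hn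
    have h2 := Set.ncard_sdiff_add_ncard_of_subset (hsub n) (Set.toFinite _)
    rw [ncard_weakClass n hcat] at h2
    have h3 : ((weakClass n w \ I n).ncard : ℝ) + (I n).ncard = (n : ℝ) ^ (k + 1) := by
      exact_mod_cast h2
    rw [← h3]
    have : ((weakClass n w \ I n).ncard : ℝ) + (I n).ncard ≠ 0 := by rw [h3]; positivity
    field_simp
    ring
  · refine tendsto_div_pow_of_le (C := k ^ (2 * k + 1)) fun n => ?_
    refine (Set.ncard_le_ncard ?_ (Set.toFinite _)).trans (ncard_card_image_le n (2 * k) k)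
    intro p hp
    exact card_image_le_of_not_isCatalan hk hw hcat (hsub n hp)

end SchurHadamard

namespace SchurHadamard

/-! ## The semicircular law -/

/-- The moments of the semicircular law, up to normalization. -/
noncomputable def semicircleIntegral (m : ℕ) : ℝ := ∫ s in (-2 : ℝ)..2, s ^ m * √(4 - s ^ 2)

/-- The differentiated function, `s ^ m` times the power 3/2 of `4 - s ^ 2`, vanishes at both ends
of [-2, 2], so integration gives a recursion for the moments. At `m = 0` the truncated exponent `m -
1` is harmless because of the factor `m`. -/
lemma hasDerivAt_pow_mul_semicircle (m : ℕ) {s : ℝ} (hs : s ∈ Set.Ioo (-2 : ℝ) 2) :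
    HasDerivAt (fun s : ℝ => s ^ m * ((4 - s ^ 2) * √(4 - s ^ 2)))
      (4 * m * (s ^ (m - 1) * √(4 - s ^ 2)) - (m + 3) * (s ^ (m + 1) * √(4 - s ^ 2))) s := by
  have hpos : 0 < 4 - s ^ 2 := by nlinarith [hs.1, hs.2]
  have h1 : HasDerivAt (fun s : ℝ => 4 - s ^ 2) (-(2 * s)) s := by
    simpa using (hasDerivAt_pow 2 s).const_sub 4
  have h2 := h1.sqrt hpos.ne'
  have h3 := (hasDerivAt_pow m s).mul (h1.mul h2)
  refine h3.congr_deriv ?_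
  have hsq : √(4 - s ^ 2) * √(4 - s ^ 2) = 4 - s ^ 2 := Real.mul_self_sqrt hpos.le
  have hne : √(4 - s ^ 2) ≠ 0 := (Real.sqrt_pos.2 hpos).ne'
  have e1 : (4 - s ^ 2) * (-(2 * s) / (2 * √(4 - s ^ 2))) = - s * √(4 - s ^ 2) := by
    field_simp
    rw [pow_two √(4 - s ^ 2), hsq]
  simp only [Pi.mul_apply]
  rw [e1]
  rcases m with - | m
  · simp; ring
  · simp only [Nat.add_sub_cancel]
    push_cast
    ring

lemma intervalIntegrable_pow_mul_semicircle (m : ℕ) :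
    IntervalIntegrable (fun s : ℝ => s ^ m * √(4 - s ^ 2)) volume (-2) 2 :=
  (Continuous.intervalIntegrable (by fun_prop) _ _)

lemma semicircleIntegral_rec (m : ℕ) :
    (m + 3) * semicircleIntegral (m + 1) = 4 * m * semicircleIntegral (m - 1) := by
  have h := intervalIntegral.integral_eq_sub_of_hasDerivAt_of_le (a := -2) (b := 2) (by norm_num)
    (f := fun s : ℝ => s ^ m * ((4 - s ^ 2) * √(4 - s ^ 2)))
    (f' := fun s => 4 * m * (s ^ (m - 1) * √(4 - s ^ 2)) - (m + 3) * (s ^ (m + 1) * √(4 - s ^ 2)))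
    (by fun_prop) (fun s hs => hasDerivAt_pow_mul_semicircle m hs)
    (((intervalIntegrable_pow_mul_semicircle _).const_mul _).sub
      ((intervalIntegrable_pow_mul_semicircle _).const_mul _))
  rw [intervalIntegral.integral_sub ((intervalIntegrable_pow_mul_semicircle _).const_mul _)
      ((intervalIntegrable_pow_mul_semicircle _).const_mul _),
    intervalIntegral.integral_const_mul, intervalIntegral.integral_const_mul] at h
  norm_num at h
  simp only [semicircleIntegral]
  linarith

lemma semicircleIntegral_zero : semicircleIntegral 0 = 2 * Real.pi := by
  have h := intervalIntegral.integral_comp_mul_left (a := -1) (b := 1) (c := 2)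
    (fun s : ℝ => √(4 - s ^ 2)) two_ne_zero
  have e : ∀ x : ℝ, √(4 - (2 * x) ^ 2) = 2 * √(1 - x ^ 2) := by
    intro x
    rw [show 4 - (2 * x) ^ 2 = 2 ^ 2 * (1 - x ^ 2) by ring, Real.sqrt_mul (by norm_num),
      Real.sqrt_sq (by norm_num)]
  simp only [e, intervalIntegral.integral_const_mul, integral_sqrt_one_sub_sq] at h
  norm_num at h
  simp only [semicircleIntegral, pow_zero, one_mul]
  linarith

lemma semicircleIntegral_odd (k : ℕ) : semicircleIntegral (2 * k + 1) = 0 := by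
  induction k with
  | zero =>
    have := semicircleIntegral_rec 0
    norm_num at this
    simpa using this
  | succ k ih =>
    have := semicircleIntegral_rec (2 * k + 2)
    rw [show 2 * k + 2 - 1 = 2 * k + 1 by omega, ih, mul_zero] at this
    rcases mul_eq_zero.1 this with h | h
    · have : (0 : ℝ) < ((2 * k + 2 : ℕ) : ℝ) + 3 := by positivity
      exact absurd h this.ne'
    · exact h

/-- At `2 * k + 1` the recursion multiplies by 2(2k + 1)/(k + 2), which is the ratio of consecutive
Catalan numbers. -/
lemma semicircleIntegral_even (k : ℕ) :
    semicircleIntegral (2 * k) = 2 * Real.pi * (catalan k : ℝ) := by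
  induction k with
  | zero => simp [semicircleIntegral_zero]
  | succ k ih =>
    have h := semicircleIntegral_rec (2 * k + 1)
    rw [Nat.add_sub_cancel, ih] at h
    have h1 := Nat.succ_mul_centralBinom_succ k
    rw [← succ_mul_catalan_eq_centralBinom, ← succ_mul_catalan_eq_centralBinom] at h1
    have h2 : ((k : ℝ) + 1) * ((k + 1 + 1) * catalan (k + 1)) =
        2 * (2 * k + 1) * ((k + 1) * catalan k) := by exact_mod_cast h1
    have h3 : ((k : ℝ) + 1 + 1) * catalan (k + 1) = 2 * (2 * k + 1) * catalan k := by
      have : (k : ℝ) + 1 ≠ 0 := by positivity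
      apply mul_left_cancel₀ this
      linear_combination h2
    rw [show 2 * (k + 1) = 2 * k + 1 + 1 by ring]
    have h4 : (k : ℝ) + 1 + 1 ≠ 0 := by positivity
    push_cast at h
    apply mul_left_cancel₀ h4
    linear_combination h / 2 - 2 * Real.pi * h3

/-- The moments of the semicircular law. -/
noncomputable def semicircleMoment (m : ℕ) : ℝ := if Even m then (catalan (m / 2) : ℝ) else 0

lemma semicircleIntegral_eq (m : ℕ) :
    semicircleIntegral m = 2 * Real.pi * semicircleMoment m := by
  rcases Nat.even_or_odd' m with ⟨k, rfl | rfl⟩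
  · rw [semicircleIntegral_even, semicircleMoment, if_pos (by simp)]
    simp
  · rw [semicircleIntegral_odd, semicircleMoment, if_neg (by simp), mul_zero]

lemma semicircleLaw_eq : semicircleLaw = (volume.restrict (Set.Ioc (-2 : ℝ) 2)).withDensity
    fun s => ENNReal.ofReal (√(4 - s ^ 2) / (2 * Real.pi)) := by
  rw [semicircleLaw, ← withDensity_indicator measurableSet_Ioc]
  congr 1
  funext s
  by_cases hs : s ∈ Set.Ioc (-2 : ℝ) 2
  · rw [Set.indicator_of_mem hs]
  · rw [Set.indicator_of_notMem hs]
    have : 4 - s ^ 2 ≤ 0 := by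
      simp only [Set.mem_Ioc, not_and_or, not_lt, not_le] at hs
      rcases hs with h | h <;> nlinarith
    rw [Real.sqrt_eq_zero_of_nonpos this]
    simp

lemma integral_semicircleLaw (f : ℝ → ℝ) :
    ∫ s, f s ∂semicircleLaw = ∫ s in (-2 : ℝ)..2, √(4 - s ^ 2) / (2 * Real.pi) * f s := by
  rw [semicircleLaw_eq, integral_withDensity_eq_integral_toReal_smul (by fun_prop)
    (Eventually.of_forall fun _ => ENNReal.ofReal_lt_top),
    intervalIntegral.integral_of_le (by norm_num)]
  refine integral_congr_ae (Eventually.of_forall fun s => ?_)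
  simp only [smul_eq_mul]
  rw [ENNReal.toReal_ofReal (by positivity)]

lemma integral_pow_semicircleLaw (m : ℕ) : ∫ s, s ^ m ∂semicircleLaw = semicircleMoment m := by
  rw [integral_semicircleLaw]
  have : ∀ s : ℝ, √(4 - s ^ 2) / (2 * Real.pi) * s ^ m =
      (2 * Real.pi)⁻¹ * (s ^ m * √(4 - s ^ 2)) := fun s => by ring
  simp_rw [this]
  rw [intervalIntegral.integral_const_mul, ← semicircleIntegral, semicircleIntegral_eq,
    inv_mul_cancel_left₀ (by positivity)]

instance : IsProbabilityMeasure semicircleLaw := by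
  have h1 : IsFiniteMeasure semicircleLaw := by
    rw [semicircleLaw_eq]
    refine isFiniteMeasure_withDensity_ofReal ?_
    exact (Continuous.integrableOn_Ioc (by fun_prop)).2
  refine ⟨?_⟩
  have h := integral_pow_semicircleLaw 0
  simp only [pow_zero, integral_const, smul_eq_mul, mul_one, semicircleMoment, Even.zero, if_true,
    Nat.zero_div, catalan_zero, Nat.cast_one] at h
  rw [Measure.real, ENNReal.toReal_eq_one_iff] at h
  exact h

instance : NullSingletonClass semicircleLaw := by
  rw [semicircleLaw]
  infer_instance

lemma ae_semicircleLaw : ∀ᵐ s ∂semicircleLaw, |s| ≤ 2 := by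
  rw [semicircleLaw_eq]
  refine (withDensity_absolutelyContinuous _ _).ae_le ?_
  filter_upwards [ae_restrict_mem measurableSet_Ioc] with s hs
  exact abs_le.2 ⟨hs.1.le, hs.2⟩

end SchurHadamard

namespace SchurHadamard

/-! ## The method of moments -/

lemma abs_eval_le_mul_pow (p : Polynomial ℝ) {x : ℝ} (hx : 1 ≤ |x|) :
    |p.eval x| ≤ (∑ i ∈ Finset.range (p.natDegree + 1), |p.coeff i|) * |x| ^ p.natDegree := by
  rw [Polynomial.eval_eq_sum_range, Finset.sum_mul]
  refine (Finset.abs_sum_le_sum_abs _ _).trans (Finset.sum_le_sum fun i hi => ?_)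
  rw [abs_mul, abs_pow]
  rw [Finset.mem_range] at hi
  gcongr
  omega

/-- Outside [-3, 3] the difference is of order |x|^(deg p), and the factor (|x|/3)^(2M - deg p),
which is at least 1 there, turns this into x^(2M)/9^M. The interval exceeds the support [-2, 2] of
the limit, so that 9^M will beat a moment of order 4^M. -/
lemma abs_sub_eval_le {T : ℝ → ℝ} {C ε : ℝ} (hε : 0 ≤ ε) (hb : ∀ s, |T s| ≤ C)
    {p : Polynomial ℝ}
    (hp : ∀ x ∈ Set.Icc (-3 : ℝ) 3, |p.eval x - T x| < ε) : ∃ K : ℝ, 0 ≤ K ∧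
    ∀ M : ℕ, p.natDegree ≤ 2 * M → ∀ x, |T x - p.eval x| ≤ ε + K / 9 ^ M * x ^ (2 * M) := by
  set S := ∑ i ∈ Finset.range (p.natDegree + 1), |p.coeff i| with hS
  have hS0 : 0 ≤ S := Finset.sum_nonneg fun i _ => abs_nonneg _
  have hC : 0 ≤ C := (abs_nonneg _).trans (hb 0)
  refine ⟨(C + S) * 3 ^ p.natDegree, by positivity, fun M hM x => ?_⟩
  have hx2 : 0 ≤ x ^ (2 * M) := by rw [pow_mul]; positivity
  by_cases hx : x ∈ Set.Icc (-3 : ℝ) 3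
  · have h1 := (hp x hx).le
    rw [abs_sub_comm] at h1
    have : 0 ≤ (C + S) * 3 ^ p.natDegree / 9 ^ M * x ^ (2 * M) := by positivity
    linarith
  · have h3 : 3 ≤ |x| := by
      by_contra h
      exact hx (abs_le.1 (not_le.1 h).le)
    have h1 : (1 : ℝ) ≤ |x| := by linarith
    have h2 := abs_eval_le_mul_pow p h1
    have h4 : |T x - p.eval x| ≤ (C + S) * |x| ^ p.natDegree := by
      calc _ ≤ |T x| + |p.eval x| := abs_sub _ _
        _ ≤ C * 1 + S * |x| ^ p.natDegree := by rw [mul_one]; exact add_le_add (hb x) h2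
        _ ≤ C * |x| ^ p.natDegree + S * |x| ^ p.natDegree := by
            gcongr
            exact one_le_pow₀ h1
        _ = _ := by ring
    obtain ⟨r, hr⟩ := Nat.exists_eq_add_of_le hM
    have h5 : 9 ^ M * |x| ^ p.natDegree ≤ 3 ^ p.natDegree * x ^ (2 * M) := by
      have e1 : (9 : ℝ) ^ M = 3 ^ p.natDegree * 3 ^ r := by
        rw [← pow_add, ← hr, pow_mul]; norm_num
      have e2 : x ^ (2 * M) = |x| ^ p.natDegree * |x| ^ r := by
        rw [← pow_add, ← hr, pow_mul, pow_mul, sq_abs]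
      rw [e1, e2]
      have : (3 : ℝ) ^ r ≤ |x| ^ r := by gcongr
      calc (3 : ℝ) ^ p.natDegree * 3 ^ r * |x| ^ p.natDegree =
          (3 ^ p.natDegree * |x| ^ p.natDegree) * 3 ^ r := by ring
        _ ≤ (3 ^ p.natDegree * |x| ^ p.natDegree) * |x| ^ r := by gcongr
        _ = _ := by ring
    have h6 : |x| ^ p.natDegree ≤ 3 ^ p.natDegree / 9 ^ M * x ^ (2 * M) := by
      rw [div_mul_eq_mul_div, le_div_iff₀ (by positivity)]
      linarith
    calc _ ≤ (C + S) * |x| ^ p.natDegree := h4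
      _ ≤ (C + S) * (3 ^ p.natDegree / 9 ^ M * x ^ (2 * M)) := by gcongr
      _ ≤ ε + (C + S) * (3 ^ p.natDegree / 9 ^ M * x ^ (2 * M)) := by linarith
      _ = _ := by ring

lemma integrable_eval {ν : Measure ℝ} (h : ∀ m : ℕ, Integrable (fun s : ℝ => s ^ m) ν)
    (p : Polynomial ℝ) : Integrable (fun s => p.eval s) ν := by
  simp_rw [Polynomial.eval_eq_sum_range]
  exact integrable_finsetSum _ fun i _ => (h i).const_mul _

/-- Compact support of the limit lets Weierstrass approximation do the work: a polynomial replaces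
`T` on [-3, 3], and one high moment controls both functions outside. -/
lemma tendsto_integral_of_tendsto_moments {ν : ℕ → Measure ℝ} [∀ n, IsProbabilityMeasure (ν n)]
    {F : Measure ℝ} [IsProbabilityMeasure F] (hF : ∀ᵐ s ∂F, |s| ≤ 2)
    (hint : ∀ n m, Integrable (fun s : ℝ => s ^ m) (ν n))
    (hlim : ∀ m : ℕ, Tendsto (fun n => ∫ s, s ^ m ∂ν n) atTop (𝓝 (∫ s, s ^ m ∂F)))
    {T : ℝ → ℝ} (hT : Continuous T) {C : ℝ} (hb : ∀ s, |T s| ≤ C) :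
    Tendsto (fun n => ∫ s, T s ∂ν n) atTop (𝓝 (∫ s, T s ∂F)) := by
  have hFm : ∀ m : ℕ, ∀ᵐ s ∂F, ‖s ^ m‖ ≤ 2 ^ m := fun m => by
    filter_upwards [hF] with s hs
    rw [norm_pow, Real.norm_eq_abs]
    gcongr
  have hFint : ∀ m : ℕ, Integrable (fun s : ℝ => s ^ m) F := fun m =>
    Integrable.of_bound (by fun_prop) _ (hFm m)
  have hTint : ∀ (μ : Measure ℝ) [IsProbabilityMeasure μ], Integrable T μ := fun μ _ =>
    Integrable.of_bound hT.aestronglyMeasurable C (Eventually.of_forall hb)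
  rw [Metric.tendsto_atTop']
  intro δ hδ
  obtain ⟨p, hp⟩ := exists_polynomial_near_of_continuousOn (-3) 3 T hT.continuousOn (δ / 8)
    (by positivity)
  obtain ⟨K, hK, hKM⟩ := abs_sub_eval_le (by positivity : (0 : ℝ) ≤ δ / 8) hb hp
  -- `M` is fixed before `n` grows. The limit has `2 * M`-th moment at most `4 ^ M`, so the moments
  -- of `ν n` eventually drop below `4 ^ M + 1`.
  obtain ⟨M, hM, hM'⟩ : ∃ M : ℕ, p.natDegree ≤ 2 * M ∧ K / 9 ^ M * (4 ^ M + 1) ≤ δ / 8 := by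
    have h1 : Tendsto (fun M : ℕ => 2 * K * (4 / 9 : ℝ) ^ M) atTop (𝓝 0) := by
      simpa using (tendsto_pow_atTop_nhds_zero_of_lt_one (r := (4 / 9 : ℝ)) (by norm_num)
        (by norm_num)).const_mul (2 * K)
    have h2 := (h1.eventually_lt_const (by positivity : 0 < δ / 8)).and
      (eventually_ge_atTop p.natDegree)
    obtain ⟨M, hM1, hM2⟩ := h2.exists
    refine ⟨M, by omega, le_trans ?_ hM1.le⟩
    have h4 : (1 : ℝ) ≤ 4 ^ M := one_le_pow₀ (by norm_num)
    calc K / 9 ^ M * (4 ^ M + 1) ≤ K / 9 ^ M * (4 ^ M + 4 ^ M) := by gcongr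
      _ = _ := by rw [div_pow]; ring
  have hM0 := hKM M hM
  have hclose : ∀ (μ : Measure ℝ) [IsProbabilityMeasure μ],
      (∀ m : ℕ, Integrable (fun s : ℝ => s ^ m) μ) → ∫ s, s ^ (2 * M) ∂μ ≤ 4 ^ M + 1 →
      |∫ s, T s ∂μ - ∫ s, p.eval s ∂μ| ≤ δ / 4 := by
    intro μ _ hμ hμM
    rw [← integral_sub (hTint μ) (integrable_eval hμ p)]
    calc _ ≤ ∫ s, |T s - p.eval s| ∂μ := abs_integral_le_integral_abs
      _ ≤ ∫ s, (δ / 8 + K / 9 ^ M * s ^ (2 * M)) ∂μ :=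
          integral_mono ((hTint μ).sub (integrable_eval hμ p)).abs
            ((integrable_const _).add ((hμ _).const_mul _)) hM0
      _ = δ / 8 + K / 9 ^ M * ∫ s, s ^ (2 * M) ∂μ := by
          rw [integral_add (integrable_const _) ((hμ _).const_mul _), integral_const_mul]
          simp
      _ ≤ δ / 8 + K / 9 ^ M * (4 ^ M + 1) := by gcongr
      _ ≤ δ / 4 := by linarith
  have hpoly : Tendsto (fun n => ∫ s, p.eval s ∂ν n) atTop (𝓝 (∫ s, p.eval s ∂F)) := by
    simp_rw [Polynomial.eval_eq_sum_range]
    rw [integral_finsetSum _ fun i _ => (hFint i).const_mul _]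
    simp_rw [integral_finsetSum _ fun i _ => (hint _ i).const_mul _, integral_const_mul]
    exact tendsto_finsetSum _ fun i _ => (hlim i).const_mul _
  have hF2 : ∫ s, s ^ (2 * M) ∂F ≤ 4 ^ M := by
    calc _ ≤ ∫ s, (2 : ℝ) ^ (2 * M) ∂F := by
          refine integral_mono_ae (hFint _) (integrable_const _) ?_
          filter_upwards [hFm (2 * M)] with s hs using (le_abs_self _).trans hs
      _ = 4 ^ M := by rw [pow_mul]; norm_num
  have h1 := (hlim (2 * M)).eventually_lt_const (hF2.trans_lt (lt_add_one _))
  have h2 := (Metric.tendsto_nhds.1 hpoly) (δ / 4) (by positivity)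
  obtain ⟨N, hN⟩ := eventually_atTop.1 (h1.and h2)
  refine ⟨N, fun n hn => ?_⟩
  obtain ⟨h3, h4⟩ := hN n hn.le
  rw [Real.dist_eq] at h4 ⊢
  have h5 := hclose (ν n) (hint n) h3.le
  have h6 := hclose F hFint (hF2.trans (by linarith))
  rw [abs_le] at h5 h6
  rw [abs_lt] at h4 ⊢
  constructor <;> linarith

lemma tendsto_cdf_of_tendsto_moments {ν : ℕ → Measure ℝ} [∀ n, IsProbabilityMeasure (ν n)]
    {F : Measure ℝ} [IsProbabilityMeasure F] [NullSingletonClass F] (hF : ∀ᵐ s ∂F, |s| ≤ 2)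
    (hint : ∀ n m, Integrable (fun s : ℝ => s ^ m) (ν n))
    (hlim : ∀ m : ℕ, Tendsto (fun n => ∫ s, s ^ m ∂ν n) atTop (𝓝 (∫ s, s ^ m ∂F))) (s : ℝ) :
    Tendsto (fun n => (ν n).real (Set.Iic s)) atTop (𝓝 (F.real (Set.Iic s))) := by
  let ν' : ℕ → ProbabilityMeasure ℝ := fun n => ⟨ν n, inferInstance⟩
  let F' : ProbabilityMeasure ℝ := ⟨F, inferInstance⟩
  have h : Tendsto ν' atTop (𝓝 F') := by
    rw [ProbabilityMeasure.tendsto_iff_forall_integral_tendsto]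
    intro f
    exact tendsto_integral_of_tendsto_moments hF hint hlim f.continuous (C := ‖f‖)
      fun s => f.norm_coe_le_norm s
  have := ProbabilityMeasure.tendsto_measure_of_null_frontier_of_tendsto' h (E := Set.Iic s)
    (by rw [frontier_Iic]; exact measure_singleton (μ := F) s)
  exact (ENNReal.tendsto_toReal (measure_ne_top F _)).comp this

end SchurHadamard

namespace SchurHadamard

/-! ## Spectra of symmetric matrices -/

lemma exists_diagonalization {n : ℕ} {A : Matrix (Fin n) (Fin n) ℝ} (hA : A.IsHermitian) :
    ∃ U : Matrix (Fin n) (Fin n) ℝ, U.transpose * U = 1 ∧ U * U.transpose = 1 ∧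
      A = U * Matrix.diagonal hA.eigenvalues * U.transpose := by
  refine ⟨hA.eigenvectorUnitary, ?_, ?_, ?_⟩
  · have := Unitary.coe_star_mul_self hA.eigenvectorUnitary
    rwa [Matrix.star_eq_conjTranspose, Matrix.conjTranspose_eq_transpose_of_trivial] at this
  · have := Unitary.coe_mul_star_self hA.eigenvectorUnitary
    rwa [Unitary.coe_star, Matrix.star_eq_conjTranspose,
      Matrix.conjTranspose_eq_transpose_of_trivial] at this
  · have := hA.spectral_theorem
    rw [Unitary.conjStarAlgAut_apply, Matrix.star_eq_conjTranspose,
      Matrix.conjTranspose_eq_transpose_of_trivial] at this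
    exact this

lemma sum_eigenvalues_pow {n : ℕ} {A : Matrix (Fin n) (Fin n) ℝ} (hA : A.IsHermitian) (m : ℕ) :
    ∑ i, hA.eigenvalues i ^ m = (A ^ m).trace := by
  obtain ⟨U, hU, hU', h⟩ := exists_diagonalization hA
  have hpow : ∀ m, A ^ m = U * Matrix.diagonal (fun i => hA.eigenvalues i ^ m) * U.transpose := by
    intro m
    induction m with
    | zero => simp [hU']
    | succ m ih =>
      calc A ^ (m + 1) = A ^ m * A := pow_succ A m
        _ = (U * Matrix.diagonal (fun i => hA.eigenvalues i ^ m) * U.transpose) *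
            (U * Matrix.diagonal hA.eigenvalues * U.transpose) := by rw [ih, ← h]
        _ = U * Matrix.diagonal (fun i => hA.eigenvalues i ^ m) * (U.transpose * U) *
            Matrix.diagonal hA.eigenvalues * U.transpose := by simp only [Matrix.mul_assoc]
        _ = _ := by
          rw [hU, Matrix.mul_one, Matrix.mul_assoc U, Matrix.diagonal_mul_diagonal]
          simp only [pow_succ]
  rw [hpow, Matrix.trace_mul_comm, ← Matrix.mul_assoc, hU, Matrix.one_mul, Matrix.trace_diagonal]

lemma sum_paths_eq {n : ℕ} (A : Matrix (Fin n) (Fin n) ℝ) (m : ℕ) (g : Fin n → ℝ) (v : Fin n) :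
    ∑ c : Fin m → Fin n, (∏ i : Fin m, A ((Fin.cons v c : Fin (m + 1) → Fin n) i.castSucc)
      ((Fin.cons v c : Fin (m + 1) → Fin n) i.succ)) *
        g ((Fin.cons v c : Fin (m + 1) → Fin n) (Fin.last m)) = ((A ^ m).mulVec g) v := by
  induction m generalizing v with
  | zero => simp
  | succ m ih =>
    rw [← (Fin.consEquiv fun _ => Fin n).sum_comp, Fintype.sum_prod_type, pow_succ',
      ← Matrix.mulVec_mulVec, Matrix.mulVec, dotProduct]
    refine Finset.sum_congr rfl fun u _ => ?_
    rw [← ih, Finset.mul_sum]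
    refine Finset.sum_congr rfl fun c _ => ?_
    rw [Fin.prod_univ_succ, mul_assoc]
    rfl

lemma trace_pow_eq_sum {n h : ℕ} [NeZero h] (A : Matrix (Fin n) (Fin n) ℝ) :
    (A ^ h).trace = ∑ c : Fin h → Fin n, ∏ i, A (c i) (c (i + 1)) := by
  obtain - | m := h
  · exact absurd rfl (NeZero.ne 0)
  rw [← (Fin.consEquiv fun _ => Fin n).sum_comp, Fintype.sum_prod_type, Matrix.trace]
  refine Finset.sum_congr rfl fun v _ => ?_
  rw [Matrix.diag_apply, pow_succ, Matrix.mul_apply]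
  have := sum_paths_eq A m (fun u => A u v) v
  rw [Matrix.mulVec, dotProduct] at this
  rw [← this]
  refine Finset.sum_congr rfl fun c _ => ?_
  rw [Fin.prod_univ_castSucc, Fin.last_add_one]
  simp only [Fin.coeSucc_eq_succ]
  rfl

lemma integral_esd {n : ℕ} {A : Matrix (Fin n) (Fin n) ℝ} (hA : A.IsHermitian) (f : ℝ → ℝ) :
    ∫ s, f s ∂esd hA = (n : ℝ)⁻¹ * ∑ i, f (hA.eigenvalues i) := by
  rw [esd, integral_smul_measure, integral_finsetSum_measure]
  · simp
  · intro i _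
    exact integrable_dirac enorm_lt_top

lemma integrable_esd {n : ℕ} (hn : 0 < n) {A : Matrix (Fin n) (Fin n) ℝ} (hA : A.IsHermitian)
    (f : ℝ → ℝ) : Integrable f (esd hA) := by
  refine Integrable.smul_measure ?_ (by simp; omega)
  rw [integrable_finsetSum_measure]
  intro i _
  exact integrable_dirac enorm_lt_top

lemma isProbabilityMeasure_esd {n : ℕ} (hn : 0 < n) {A : Matrix (Fin n) (Fin n) ℝ}
    (hA : A.IsHermitian) : IsProbabilityMeasure (esd hA) := by
  refine ⟨?_⟩
  simp only [esd, Measure.smul_apply, Measure.coe_finsetSum, Finset.sum_apply, measure_univ,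
    Finset.sum_const, Finset.card_univ, Fintype.card_fin, smul_eq_mul, nsmul_eq_mul, mul_one]
  exact ENNReal.inv_mul_cancel (by simpa using hn.ne') (by simp)

lemma esd_real_Iic {n : ℕ} {A : Matrix (Fin n) (Fin n) ℝ} (hA : A.IsHermitian) (s : ℝ) :
    (esd hA).real (Set.Iic s) =
      (n : ℝ)⁻¹ * ((Finset.univ.filter fun i => hA.eigenvalues i ≤ s).card : ℝ) := by
  have h1 := integral_esd hA ((Set.Iic s).indicator fun _ => 1)
  rw [integral_indicator measurableSet_Iic] at h1
  simp only [integral_const, smul_eq_mul, mul_one] at h1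
  rw [measureReal_restrict_apply_univ] at h1
  rw [h1, Finset.card_filter]
  push_cast
  simp [Set.indicator_apply]

lemma integral_pow_esd {n h : ℕ} [NeZero h] {A : Matrix (Fin n) (Fin n) ℝ} (hA : A.IsHermitian) :
    ∫ s, s ^ h ∂esd hA = (n : ℝ)⁻¹ * ∑ c : Fin h → Fin n, ∏ i, A (c i) (c (i + 1)) := by
  rw [integral_esd, sum_eigenvalues_pow, trace_pow_eq_sum]

lemma sum_sq_eq_trace {n : ℕ} (M : Matrix (Fin n) (Fin n) ℝ) :
    ∑ i, ∑ j, M i j ^ 2 = (M * M.transpose).trace := by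
  simp [Matrix.trace, Matrix.mul_apply, pow_two]

/-- With `W` the product of the two orthogonal eigenbases, the squares `W i j ^ 2` form a doubly
stochastic matrix and thus couple the two spectra. The cost of this coupling for the squared
distance is exactly the squared Frobenius norm of `A - B`, and Cauchy–Schwarz passes to the distance
itself. -/
lemma abs_integral_esd_sub_le {n : ℕ} {A B : Matrix (Fin n) (Fin n) ℝ}
    (hA : A.IsHermitian) (hB : B.IsHermitian) {f : ℝ → ℝ} {K : ℝ}
    (hK : 0 ≤ K) (hf : ∀ x y, |f x - f y| ≤ K * |x - y|) :
    |∫ s, f s ∂esd hA - ∫ s, f s ∂esd hB| ≤ K * √((∑ i, ∑ j, (A i j - B i j) ^ 2) / n) := by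
  rcases Nat.eq_zero_or_pos n with rfl | hn
  · simp [integral_esd]
  obtain ⟨U, hU, hU', hAU⟩ := exists_diagonalization hA
  obtain ⟨V, hV, hV', hBV⟩ := exists_diagonalization hB
  set a := hA.eigenvalues
  set b := hB.eigenvalues
  set W := U.transpose * V with hW
  have hWW : W * W.transpose = 1 := by
    rw [hW, Matrix.transpose_mul, Matrix.transpose_transpose]
    calc _ = U.transpose * (V * V.transpose) * U := by simp only [Matrix.mul_assoc]
      _ = 1 := by rw [hV', Matrix.mul_one, hU]
  have hWW' : W.transpose * W = 1 := by
    rw [hW, Matrix.transpose_mul, Matrix.transpose_transpose]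
    calc _ = V.transpose * (U * U.transpose) * V := by simp only [Matrix.mul_assoc]
      _ = 1 := by rw [hU', Matrix.mul_one, hV]
  have hrow : ∀ i, ∑ j, W i j ^ 2 = 1 := by
    intro i
    have := congrFun (congrFun hWW i) i
    simpa [Matrix.mul_apply, pow_two] using this
  have hcol : ∀ j, ∑ i, W i j ^ 2 = 1 := by
    intro j
    have := congrFun (congrFun hWW' j) j
    simpa [Matrix.mul_apply, pow_two] using this
  have hM : U.transpose * (A - B) * V = Matrix.diagonal a * W - W * Matrix.diagonal b := by
    rw [Matrix.mul_sub, Matrix.sub_mul, hAU, hBV]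
    congr 1
    · calc _ = (U.transpose * U) * Matrix.diagonal a * (U.transpose * V) := by
            simp only [Matrix.mul_assoc]
        _ = _ := by rw [hU, Matrix.one_mul]
    · calc _ = (U.transpose * V) * Matrix.diagonal b * (V.transpose * V) := by
            simp only [Matrix.mul_assoc]
        _ = _ := by rw [hV, Matrix.mul_one]
  have hfrob : ∑ i, ∑ j, (W i j * (a i - b j)) ^ 2 = ∑ i, ∑ j, (A i j - B i j) ^ 2 := by
    have e1 : ∑ i, ∑ j, (W i j * (a i - b j)) ^ 2 =
        ∑ i, ∑ j, (U.transpose * (A - B) * V) i j ^ 2 := by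
      rw [hM]
      refine Finset.sum_congr rfl fun i _ => Finset.sum_congr rfl fun j _ => ?_
      rw [Matrix.sub_apply, Matrix.diagonal_mul, Matrix.mul_diagonal]
      ring
    have e2 : ∑ i, ∑ j, (A i j - B i j) ^ 2 = ∑ i, ∑ j, (A - B) i j ^ 2 := rfl
    rw [e1, e2, sum_sq_eq_trace, sum_sq_eq_trace]
    simp only [Matrix.transpose_mul, Matrix.transpose_transpose]
    calc _ = (U.transpose * ((A - B) * (V * V.transpose) * (A - B).transpose * U)).trace := by
          simp only [Matrix.mul_assoc]
      _ = _ := by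
          rw [hV', Matrix.mul_one, Matrix.trace_mul_comm, Matrix.mul_assoc, hU', Matrix.mul_one]
  have hsum : ∑ i, f (a i) - ∑ j, f (b j) = ∑ i, ∑ j, W i j ^ 2 * (f (a i) - f (b j)) := by
    simp only [mul_sub, Finset.sum_sub_distrib]
    congr 1
    · simp_rw [← Finset.sum_mul, hrow, one_mul]
    · rw [Finset.sum_comm]
      simp_rw [← Finset.sum_mul, hcol, one_mul]
  have hCS : (∑ i, ∑ j, W i j ^ 2 * |a i - b j|) ^ 2 ≤
      n * ∑ i, ∑ j, (A i j - B i j) ^ 2 := by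
    have h1 := Finset.sum_mul_sq_le_sq_mul_sq (Finset.univ : Finset (Fin n × Fin n))
      (fun q => |W q.1 q.2|) (fun q => |W q.1 q.2 * (a q.1 - b q.2)|)
    simp only [Fintype.sum_prod_type, sq_abs] at h1
    rw [hfrob] at h1
    simp only [hrow, Finset.sum_const, Finset.card_univ, Fintype.card_fin, nsmul_eq_mul,
      mul_one] at h1
    refine le_of_eq_of_le ?_ h1
    congr 1
    refine Finset.sum_congr rfl fun i _ => Finset.sum_congr rfl fun j _ => ?_
    rw [abs_mul, ← mul_assoc, abs_mul_abs_self, pow_two]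
  rw [integral_esd, integral_esd, ← mul_sub, hsum, abs_mul, abs_of_nonneg (by positivity)]
  have hle : |∑ i, ∑ j, W i j ^ 2 * (f (a i) - f (b j))| ≤
      K * ∑ i, ∑ j, W i j ^ 2 * |a i - b j| := by
    rw [Finset.mul_sum]
    refine (Finset.abs_sum_le_sum_abs _ _).trans (Finset.sum_le_sum fun i _ => ?_)
    rw [Finset.mul_sum]
    refine (Finset.abs_sum_le_sum_abs _ _).trans (Finset.sum_le_sum fun j _ => ?_)
    rw [abs_mul, abs_of_nonneg (sq_nonneg _)]
    calc _ ≤ W i j ^ 2 * (K * |a i - b j|) := by gcongr; exact hf _ _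
      _ = _ := by ring
  have hn' : (0 : ℝ) < n := by exact_mod_cast hn
  calc _ ≤ (n : ℝ)⁻¹ * (K * ∑ i, ∑ j, W i j ^ 2 * |a i - b j|) := by gcongr
    _ = K * ((n : ℝ)⁻¹ * ∑ i, ∑ j, W i j ^ 2 * |a i - b j|) := by ring
    _ ≤ _ := by
      gcongr
      refine Real.le_sqrt_of_sq_le ?_
      rw [mul_pow]
      calc _ ≤ (n : ℝ)⁻¹ ^ 2 * (n * ∑ i, ∑ j, (A i j - B i j) ^ 2) := by gcongr
        _ = _ := by field_simp

/-! ### Comparison of distribution functions -/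

/-- The function that is `1` on `(-∞, s]`, `0` on `[s + δ, ∞)` and affine in between. -/
noncomputable def ramp (s δ x : ℝ) : ℝ := max 0 (min 1 ((s + δ - x) / δ))

lemma ramp_nonneg (s δ x : ℝ) : 0 ≤ ramp s δ x := le_max_left _ _

lemma ramp_le_one (s δ x : ℝ) : ramp s δ x ≤ 1 := max_le zero_le_one (min_le_left _ _)

lemma ramp_of_le {s δ x : ℝ} (hδ : 0 < δ) (hx : x ≤ s) : ramp s δ x = 1 := by
  rw [ramp, min_eq_left, max_eq_right zero_le_one]
  rw [le_div_iff₀ hδ]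
  linarith

lemma ramp_of_ge {s δ x : ℝ} (hδ : 0 < δ) (hx : s + δ ≤ x) : ramp s δ x = 0 := by
  rw [ramp, max_eq_left]
  exact (min_le_right _ _).trans (div_nonpos_of_nonpos_of_nonneg (by linarith) hδ.le)

lemma abs_ramp_sub_le {s δ : ℝ} (hδ : 0 < δ) (x y : ℝ) :
    |ramp s δ x - ramp s δ y| ≤ δ⁻¹ * |x - y| := by
  refine (abs_max_sub_max_le_max _ _ _ _).trans (max_le (by simp; positivity) ?_)
  refine (abs_min_sub_min_le_max _ _ _ _).trans (max_le (by simp; positivity) ?_)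
  rw [← sub_div, abs_div, abs_of_pos hδ, div_eq_inv_mul, abs_sub_comm x y]
  ring_nf
  rfl

lemma esd_Iic_le_integral_ramp {n : ℕ} {A : Matrix (Fin n) (Fin n) ℝ} (hA : A.IsHermitian)
    {s δ : ℝ} (hδ : 0 < δ) : (esd hA).real (Set.Iic s) ≤ ∫ x, ramp s δ x ∂esd hA := by
  rw [esd_real_Iic, integral_esd, Finset.card_filter]
  push_cast
  gcongr with i
  split_ifs with h
  · rw [ramp_of_le hδ h]
  · exact ramp_nonneg _ _ _

lemma integral_ramp_le_esd_Iic {n : ℕ} {A : Matrix (Fin n) (Fin n) ℝ} (hA : A.IsHermitian)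
    {s δ : ℝ} (hδ : 0 < δ) : ∫ x, ramp s δ x ∂esd hA ≤ (esd hA).real (Set.Iic (s + δ)) := by
  rw [esd_real_Iic, integral_esd, Finset.card_filter]
  push_cast
  gcongr with i
  split_ifs with h
  · exact ramp_le_one _ _ _
  · rw [ramp_of_ge hδ (not_le.1 h).le]

lemma esd_Iic_le_of_sum_sq {n : ℕ} {A B : Matrix (Fin n) (Fin n) ℝ} (hA : A.IsHermitian)
    (hB : B.IsHermitian) (s : ℝ) {δ : ℝ} (hδ : 0 < δ) :
    (esd hA).real (Set.Iic s) ≤ (esd hB).real (Set.Iic (s + δ)) +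
      δ⁻¹ * √((∑ i, ∑ j, (A i j - B i j) ^ 2) / n) := by
  have h1 := esd_Iic_le_integral_ramp hA (s := s) hδ
  have h2 := integral_ramp_le_esd_Iic hB (s := s) hδ
  have h3 := (abs_le.1 (abs_integral_esd_sub_le hA hB (inv_nonneg.2 hδ.le)
    (abs_ramp_sub_le (s := s) hδ))).2
  linarith

lemma quadForm_eq {n : ℕ} {A U : Matrix (Fin n) (Fin n) ℝ} {a : Fin n → ℝ}
    (hA : A = U * Matrix.diagonal a * U.transpose) (x : Fin n → ℝ) :
    x ⬝ᵥ A.mulVec x = ∑ i, a i * (U.transpose.mulVec x) i ^ 2 := by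
  rw [hA, ← Matrix.mulVec_mulVec, ← Matrix.mulVec_mulVec, Matrix.dotProduct_mulVec,
    ← Matrix.mulVec_transpose, dotProduct]
  refine Finset.sum_congr rfl fun i _ => ?_
  rw [Matrix.mulVec_diagonal]
  ring

lemma dotProduct_self_eq {n : ℕ} {U : Matrix (Fin n) (Fin n) ℝ} (hU : U * U.transpose = 1)
    (x : Fin n → ℝ) : x ⬝ᵥ x = ∑ i, (U.transpose.mulVec x) i ^ 2 := by
  have h : (1 : Matrix (Fin n) (Fin n) ℝ) = U * Matrix.diagonal (fun _ => 1) * U.transpose := by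
    rw [Matrix.diagonal_one, Matrix.mul_one, hU]
  have := quadForm_eq h x
  simpa using this

/-- If the bound failed, a dimension count would give a nonzero `x` that vanishes at the column
index of every changed entry, is orthogonal to the eigenvectors of `B` with eigenvalue at most `s`,
and to those of `A` with eigenvalue above `s`. Then `A` and `B` agree on `x`, although the quadratic
form of `A` is at most `s * (x ⬝ᵥ x)` and that of `B` is larger. -/
lemma card_eigenvalues_le_add {n : ℕ} {A B : Matrix (Fin n) (Fin n) ℝ} (hA : A.IsHermitian)
    (hB : B.IsHermitian) (s : ℝ) :
    (Finset.univ.filter fun i => hA.eigenvalues i ≤ s).card ≤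
      (Finset.univ.filter fun i => hB.eigenvalues i ≤ s).card +
      (Finset.univ.filter fun q : Fin n × Fin n => A q.1 q.2 ≠ B q.1 q.2).card := by
  obtain ⟨U, hU, hU', hAU⟩ := exists_diagonalization hA
  obtain ⟨V, hV, hV', hBV⟩ := exists_diagonalization hB
  set a := hA.eigenvalues
  set b := hB.eigenvalues
  by_contra! hcon
  let Φ : (Fin n → ℝ) →ₗ[ℝ] ({q : Fin n × Fin n // A q.1 q.2 ≠ B q.1 q.2} → ℝ) ×
      ({i // b i ≤ s} → ℝ) × ({i // ¬ a i ≤ s} → ℝ) :=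
    (LinearMap.funLeft ℝ ℝ fun q => q.1.2).prod
      (((LinearMap.funLeft ℝ ℝ fun i => i.1).comp V.transpose.mulVecLin).prod
        ((LinearMap.funLeft ℝ ℝ fun i => i.1).comp U.transpose.mulVecLin))
  have hker : LinearMap.ker Φ ≠ ⊥ := by
    refine LinearMap.ker_ne_bot_of_finrank_lt ?_
    simp only [Module.finrank_prod, Module.finrank_fintype_fun_eq_card, Fintype.card_subtype,
      Fintype.card_fin]
    have := Finset.card_filter_add_card_filter_not (s := (Finset.univ : Finset (Fin n)))
      (fun i => a i ≤ s)
    rw [Finset.card_univ, Fintype.card_fin] at this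
    omega
  obtain ⟨x, hx, hx0⟩ := (Submodule.ne_bot_iff _).1 hker
  rw [LinearMap.mem_ker] at hx
  have h1 : ∀ q : Fin n × Fin n, A q.1 q.2 ≠ B q.1 q.2 → x q.2 = 0 := fun q hq =>
    congrFun (congrArg Prod.fst hx) ⟨q, hq⟩
  have h2 : ∀ i, b i ≤ s → (V.transpose.mulVec x) i = 0 := fun i hi =>
    congrFun (congrArg (fun z => z.2.1) hx) ⟨i, hi⟩
  have h3 : ∀ i, ¬ a i ≤ s → (U.transpose.mulVec x) i = 0 := fun i hi =>
    congrFun (congrArg (fun z => z.2.2) hx) ⟨i, hi⟩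
  have hAB : A.mulVec x = B.mulVec x := by
    funext i
    simp only [Matrix.mulVec, dotProduct]
    refine Finset.sum_congr rfl fun j _ => ?_
    by_cases h : A i j = B i j
    · rw [h]
    · rw [h1 (i, j) h, mul_zero, mul_zero]
  have hxx : 0 < x ⬝ᵥ x := by
    rw [dotProduct]
    obtain ⟨i, hi⟩ := Function.ne_iff.1 hx0
    exact Finset.sum_pos' (fun j _ => mul_self_nonneg _)
      ⟨i, Finset.mem_univ _, mul_self_pos.2 hi⟩
  have h4 : x ⬝ᵥ A.mulVec x ≤ s * (x ⬝ᵥ x) := by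
    rw [quadForm_eq hAU, dotProduct_self_eq hU', Finset.mul_sum]
    refine Finset.sum_le_sum fun i _ => ?_
    by_cases hi : a i ≤ s
    · gcongr
    · rw [h3 i hi]; simp
  have h5 : s * (x ⬝ᵥ x) < x ⬝ᵥ B.mulVec x := by
    rw [dotProduct_self_eq hV'] at hxx
    rw [quadForm_eq hBV, dotProduct_self_eq hV', Finset.mul_sum]
    obtain ⟨i, -, hi⟩ := Finset.exists_ne_zero_of_sum_ne_zero hxx.ne'
    refine Finset.sum_lt_sum (fun j _ => ?_) ⟨i, Finset.mem_univ _, ?_⟩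
    · by_cases hj : b j ≤ s
      · rw [h2 j hj]; simp
      · have := (not_le.1 hj).le
        gcongr
    · have hbi : ¬ b i ≤ s := fun h => hi (by rw [h2 i h]; simp)
      have : 0 < (V.transpose.mulVec x) i ^ 2 := lt_of_le_of_ne (sq_nonneg _) (Ne.symm hi)
      exact mul_lt_mul_of_pos_right (not_le.1 hbi) this
  rw [hAB] at h4
  linarith

lemma esd_Iic_le_of_card_ne {n : ℕ} {A B : Matrix (Fin n) (Fin n) ℝ} (hA : A.IsHermitian)
    (hB : B.IsHermitian) (s : ℝ) :
    (esd hA).real (Set.Iic s) ≤ (esd hB).real (Set.Iic s) +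
      (Finset.univ.filter fun q : Fin n × Fin n => A q.1 q.2 ≠ B q.1 q.2).card / n := by
  rw [esd_real_Iic, esd_real_Iic, div_eq_inv_mul, ← mul_add]
  gcongr
  exact_mod_cast card_eigenvalues_le_add hA hB s

/-! ### Measurability of the empirical spectral distribution -/

lemma continuous_integral_esd {n : ℕ} {f : ℝ → ℝ} {K : ℝ} (hK : 0 ≤ K)
    (hf : ∀ x y, |f x - f y| ≤ K * |x - y|) :
    Continuous fun M : {M : Fin n → Fin n → ℝ // (Matrix.of M).IsHermitian} =>
      ∫ x, f x ∂esd M.2 := by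
  rw [continuous_iff_continuousAt]
  intro M
  rw [ContinuousAt, tendsto_iff_dist_tendsto_zero]
  refine squeeze_zero (fun _ => dist_nonneg) (fun M' => ?_)
    (g := fun M' : {M : Fin n → Fin n → ℝ // (Matrix.of M).IsHermitian} =>
      K * √((∑ i, ∑ j, (M'.1 i j - M.1 i j) ^ 2) / n)) ?_
  · rw [Real.dist_eq]
    exact abs_integral_esd_sub_le M'.2 M.2 hK hf
  · have : Continuous fun M' : {M : Fin n → Fin n → ℝ // (Matrix.of M).IsHermitian} =>
        K * √((∑ i, ∑ j, (M'.1 i j - M.1 i j) ^ 2) / n) := by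
      refine continuous_const.mul (Continuous.sqrt (Continuous.div_const ?_ _))
      exact continuous_finsetSum _ fun i _ => continuous_finsetSum _ fun j _ =>
        (((continuous_apply_apply i j).comp continuous_subtype_val).sub continuous_const).pow 2
    have h := this.tendsto M
    simpa using h

lemma measurable_integral_esd {Ω : Type*} [MeasurableSpace Ω] {n : ℕ}
    {A : Ω → Matrix (Fin n) (Fin n) ℝ} (hA : ∀ ω, (A ω).IsHermitian)
    (hm : ∀ i j, Measurable fun ω => A ω i j) {f : ℝ → ℝ} {K : ℝ} (hK : 0 ≤ K)
    (hf : ∀ x y, |f x - f y| ≤ K * |x - y|) :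
    Measurable fun ω => ∫ x, f x ∂esd (hA ω) := by
  have hA' : Measurable fun ω => (⟨fun i j => A ω i j, hA ω⟩ :
      {M : Fin n → Fin n → ℝ // (Matrix.of M).IsHermitian}) :=
    Measurable.subtype_mk (measurable_pi_lambda _ fun i => measurable_pi_lambda _ fun j => hm i j)
  have h := (continuous_integral_esd (n := n) hK hf).measurable.comp hA'
  exact h

/-- The indicator of (-∞, s] is a pointwise limit of ramps, whose integrals are continuous in the
matrix. This avoids discussing the measurability of individual eigenvalues. -/
lemma measurable_esd_Iic {Ω : Type*} [MeasurableSpace Ω] {n : ℕ}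
    {A : Ω → Matrix (Fin n) (Fin n) ℝ} (hA : ∀ ω, (A ω).IsHermitian)
    (hm : ∀ i j, Measurable fun ω => A ω i j) (s : ℝ) :
    Measurable fun ω => (esd (hA ω)).real (Set.Iic s) := by
  have h : ∀ m : ℕ, Measurable fun ω => ∫ x, ramp s (1 / ((m : ℝ) + 1)) x ∂esd (hA ω) := fun m =>
    measurable_integral_esd hA hm (inv_nonneg.2 (by positivity : 0 ≤ 1 / ((m : ℝ) + 1)))
      (abs_ramp_sub_le (by positivity))
  refine measurable_of_tendsto_metrizable h ?_
  rw [tendsto_pi_nhds]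
  intro ω
  simp_rw [integral_esd, esd_real_Iic, Finset.card_filter]
  push_cast
  refine (tendsto_finsetSum _ fun i _ => ?_).const_mul _
  split_ifs with h
  · refine tendsto_const_nhds.congr fun m => (ramp_of_le (by positivity) h).symm
  · have h0 : Tendsto (fun m : ℕ => s + 1 / ((m : ℝ) + 1)) atTop (𝓝 s) := by
      simpa using tendsto_one_div_add_atTop_nhds_zero_nat.const_add s
    refine tendsto_const_nhds.congr' ?_
    filter_upwards [h0.eventually_lt_const (not_le.1 h)] with m hm
    exact (ramp_of_ge (by positivity) hm.le).symm

end SchurHadamard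

namespace SchurHadamard

/-! ## Monomials in independent random variables -/

/-- Both inputs become one independent family, so that a circuit contributes a monomial in variables
indexed by `ι ⊕ κ`. -/
lemma iIndepFun_sumElim {ι κ Ω : Type*} [MeasurableSpace Ω] {μ : Measure Ω}
    {x : ι → Ω → ℝ} {y : κ → Ω → ℝ}
    (hx : iIndepFun x μ) (hy : iIndepFun y μ)
    (hxy : IndepFun (fun ω t => x t ω) (fun ω s => y s ω) μ) : iIndepFun (Sum.elim x y) μ := by
  rw [iIndepFun_iff_measure_inter_preimage_eq_mul]
  intro S sets hS
  have h1 : (⋂ i ∈ S, Sum.elim x y i ⁻¹' sets i) =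
      (fun ω t => x t ω) ⁻¹' (⋂ a ∈ S.toLeft, (fun f : ι → ℝ => f a) ⁻¹' sets (.inl a)) ∩
      (fun ω t => y t ω) ⁻¹' (⋂ a ∈ S.toRight, (fun f : κ → ℝ => f a) ⁻¹' sets (.inr a)) := by
    ext ω
    simp [Sum.forall]
  have hm1 : MeasurableSet (⋂ a ∈ S.toLeft, (fun f : ι → ℝ => f a) ⁻¹' sets (.inl a)) :=
    Finset.measurableSet_biInter _ fun a ha =>
      measurable_pi_apply a (hS _ (Finset.mem_toLeft.1 ha))
  have hm2 : MeasurableSet (⋂ a ∈ S.toRight, (fun f : κ → ℝ => f a) ⁻¹' sets (.inr a)) :=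
    Finset.measurableSet_biInter _ fun a ha =>
      measurable_pi_apply a (hS _ (Finset.mem_toRight.1 ha))
  rw [h1, hxy.measure_inter_preimage_eq_mul _ _ hm1 hm2]
  rw [iIndepFun_iff_measure_inter_preimage_eq_mul] at hx hy
  have h2 := hx S.toLeft (sets := fun a => sets (.inl a)) fun a ha => hS _ (Finset.mem_toLeft.1 ha)
  have h3 := hy S.toRight (sets := fun a => sets (.inr a))
    fun a ha => hS _ (Finset.mem_toRight.1 ha)
  conv_rhs => rw [← Finset.toLeft_disjSum_toRight (u := S)]
  rw [Finset.prod_disjSum]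
  simp only [Sum.elim_inl, Sum.elim_inr]
  rw [← h2, ← h3]
  simp only [Set.preimage_iInter]
  rfl

lemma inputA3_sumElim {ι κ Ω : Type*} [MeasurableSpace Ω] {μ : Measure Ω}
    {x : ι → Ω → ℝ} {y : κ → Ω → ℝ} (hx : InputA3 x μ) (hy : InputA3 y μ)
    (hxy : IndepFun (fun ω t => x t ω) (fun ω s => y s ω) μ) : InputA3 (Sum.elim x y) μ := by
  refine ⟨⟨?_, iIndepFun_sumElim hx.1.indep hy.1.indep hxy, ?_, ?_, ?_⟩, fun m => ?_⟩
  · rintro (t | t)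
    exacts [hx.1.measurable t, hy.1.measurable t]
  · rintro (t | t)
    exacts [hx.1.memLp t, hy.1.memLp t]
  · rintro (t | t)
    exacts [hx.1.mean t, hy.1.mean t]
  · rintro (t | t)
    exacts [hx.1.var t, hy.1.var t]
  · obtain ⟨C, hC⟩ := hx.2 m
    obtain ⟨C', hC'⟩ := hy.2 m
    refine ⟨max C C', ?_⟩
    rintro (t | t)
    · exact ⟨(hC t).1, (hC t).2.trans (le_max_left _ _)⟩
    · exact ⟨(hC' t).1, (hC' t).2.trans (le_max_right _ _)⟩

/-- The product of the variables with labels `f j`, with multiplicities. -/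
def monomial {α Ω J : Type*} [Fintype J] (u : α → Ω → ℝ) (f : J → α) (ω : Ω) : ℝ :=
  ∏ j, u (f j) ω

lemma abs_prod_le_sum_pow {J : Type*} [Fintype J] [Nonempty J] (x : J → ℝ) :
    |∏ j, x j| ≤ ∑ j, |x j| ^ Fintype.card J := by
  obtain ⟨j₀, -, hj₀⟩ := Finset.exists_max_image Finset.univ (fun j => |x j|)
    Finset.univ_nonempty
  calc |∏ j, x j| = ∏ j, |x j| := Finset.abs_prod _ _
    _ ≤ ∏ _j : J, |x j₀| := Finset.prod_le_prod (fun _ _ => abs_nonneg _) hj₀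
    _ = |x j₀| ^ Fintype.card J := by simp
    _ ≤ _ := Finset.single_le_sum (f := fun j => |x j| ^ Fintype.card J)
        (fun _ _ => by positivity) (Finset.mem_univ j₀)

lemma measurable_monomial {α Ω J : Type*} [MeasurableSpace Ω] [Fintype J] {u : α → Ω → ℝ}
    (hu : ∀ a, Measurable (u a)) (f : J → α) : Measurable (monomial u f) :=
  Finset.measurable_fun_prod _ fun j _ => hu (f j)

lemma exists_integral_monomial_pow_le {α Ω : Type*} [MeasurableSpace Ω] {μ : Measure Ω}
    {u : α → Ω → ℝ} (hu : InputA3 u μ) (J : Type*) [Fintype J] [Nonempty J] (r : ℕ) :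
    ∃ C : ℝ, 0 ≤ C ∧ ∀ f : J → α, Integrable (fun ω => |monomial u f ω| ^ r) μ ∧
      ∫ ω, |monomial u f ω| ^ r ∂μ ≤ C := by
  obtain ⟨C, hC⟩ := hu.2 (r * Fintype.card J)
  refine ⟨Fintype.card J * max C 0, by positivity, fun f => ?_⟩
  have hle : ∀ ω, |monomial u f ω| ^ r ≤ ∑ j, |u (f j) ω| ^ (r * Fintype.card J) := by
    intro ω
    have := abs_prod_le_sum_pow fun j => |u (f j) ω| ^ r
    simp only [abs_pow, abs_abs, ← pow_mul] at this
    rwa [Finset.prod_pow, ← Finset.abs_prod, abs_pow, abs_abs] at this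
  have hint : Integrable (fun ω => ∑ j, |u (f j) ω| ^ (r * Fintype.card J)) μ :=
    integrable_finsetSum _ fun j _ => (hC _).1
  have hint' : Integrable (fun ω => |monomial u f ω| ^ r) μ := by
    refine hint.mono' (((measurable_monomial hu.1.measurable f).abs.pow_const
      r).aestronglyMeasurable) (Eventually.of_forall fun ω => ?_)
    rw [Real.norm_eq_abs, abs_pow, abs_abs]
    exact hle ω
  refine ⟨hint', (integral_mono hint' hint hle).trans ?_⟩
  rw [integral_finsetSum _ fun j _ => (hC _).1]
  refine (Finset.sum_le_card_nsmul _ _ (max C 0) fun j _ =>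
    (hC _).2.trans (le_max_left _ _)).trans ?_
  simp

lemma integrable_monomial {α Ω : Type*} [MeasurableSpace Ω] {μ : Measure Ω}
    {u : α → Ω → ℝ} (hu : InputA3 u μ) {J : Type*} [Fintype J] [Nonempty J] (f : J → α) :
    Integrable (monomial u f) μ := by
  obtain ⟨C, -, hC⟩ := exists_integral_monomial_pow_le hu J 1
  refine (hC f).1.mono' (measurable_monomial hu.1.measurable f).aestronglyMeasurable ?_
  exact Eventually.of_forall fun ω => by simp

lemma IsStandardInput.integral_sq {α Ω : Type*} [MeasurableSpace Ω] {μ : Measure Ω}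
    [IsProbabilityMeasure μ] {u : α → Ω → ℝ} (hu : IsStandardInput u μ) (a : α) :
    ∫ ω, u a ω ^ 2 ∂μ = 1 := by
  have := variance_eq_sub (hu.memLp a)
  rw [hu.var a, hu.mean a] at this
  simpa using this.symm

open Classical in
lemma integral_monomial {α Ω : Type*} [MeasurableSpace Ω] {μ : Measure Ω}
    {u : α → Ω → ℝ} (hu : IsStandardInput u μ) {J : Type*} [Fintype J] (f : J → α) :
    ∫ ω, monomial u f ω ∂μ = ∏ a ∈ Finset.univ.image f,
      ∫ ω, u a ω ^ (Finset.univ.filter fun j => f j = a).card ∂μ := by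
  have h1 : ∀ ω, monomial u f ω = ∏ a : Finset.univ.image f,
      u a ω ^ (Finset.univ.filter fun j => f j = a).card := by
    intro ω
    rw [monomial, Finset.prod_coe_sort (Finset.univ.image f)
      (fun a => u a ω ^ (Finset.univ.filter fun j => f j = a).card),
      ← Finset.prod_fiberwise_of_maps_to (t := Finset.univ.image f) (g := f)
        fun j hj => Finset.mem_image_of_mem f hj]
    refine Finset.prod_congr rfl fun a _ => ?_
    rw [Finset.prod_congr rfl (g := fun _ => u a ω)]
    · simp
    · intro j hj
      rw [(Finset.mem_filter.1 hj).2]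
  simp_rw [h1]
  have hind : iIndepFun (fun (a : Finset.univ.image f) => u a) μ :=
    hu.indep.precomp Subtype.val_injective
  have hind' := hind.comp (fun a z => z ^ (Finset.univ.filter fun j => f j = a).card)
    fun a => measurable_id.pow_const _
  have h2 := hind'.integral_fun_prod_eq_prod_integral fun a =>
    ((hu.measurable a).pow_const _).aestronglyMeasurable
  simp only [Function.comp_apply] at h2
  rw [h2]
  exact Finset.prod_coe_sort (Finset.univ.image f) fun a =>
    ∫ ω, u a ω ^ (Finset.univ.filter fun j => f j = a).card ∂μ

lemma integral_monomial_eq_zero {α Ω : Type*} [MeasurableSpace Ω] {μ : Measure Ω}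
    {u : α → Ω → ℝ} (hu : IsStandardInput u μ) {J : Type*} [Fintype J] {f : J → α} {j₀ : J}
    (hj : ∀ j, f j = f j₀ → j = j₀) : ∫ ω, monomial u f ω ∂μ = 0 := by
  classical
  rw [integral_monomial hu]
  refine Finset.prod_eq_zero (Finset.mem_image_of_mem f (Finset.mem_univ j₀)) ?_
  have : (Finset.univ.filter fun j => f j = f j₀) = {j₀} := by
    ext j
    simp only [Finset.mem_filter, Finset.mem_univ, true_and, Finset.mem_singleton]
    exact ⟨hj j, fun h => by rw [h]⟩
  rw [this, Finset.card_singleton]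
  simpa using hu.mean (f j₀)

lemma integral_monomial_eq_one {α Ω : Type*} [MeasurableSpace Ω] {μ : Measure Ω}
    [IsProbabilityMeasure μ] {u : α → Ω → ℝ} (hu : IsStandardInput u μ) {J : Type*} [Fintype J]
    {f : J → α} (hf : ∀ j₀, {j | f j = f j₀}.ncard = 2) : ∫ ω, monomial u f ω ∂μ = 1 := by
  classical
  rw [integral_monomial hu]
  refine Finset.prod_eq_one fun a ha => ?_
  obtain ⟨j, -, rfl⟩ := Finset.mem_image.1 ha
  have : (Finset.univ.filter fun j' => f j' = f j).card = 2 := by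
    rw [← hf j, ← Set.ncard_coe_finset, Finset.coe_filter]
    simp
  rw [this, hu.integral_sq]

/-- The σ-algebra generated by the variables with labels in `S`. -/
abbrev generatedBy {α Ω : Type*} (u : α → Ω → ℝ) (S : Set α) : MeasurableSpace Ω :=
  ⨆ a ∈ S, (inferInstance : MeasurableSpace ℝ).comap (u a)

lemma measurable_generatedBy {α Ω : Type*} {u : α → Ω → ℝ} {S : Set α} {a : α} (ha : a ∈ S) :
    Measurable[generatedBy u S] (u a) := by
  refine Measurable.mono (comap_measurable (u a)) ?_ le_rfl
  exact le_iSup₂_of_le a ha le_rfl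

lemma generatedBy_le {α Ω : Type*} [mΩ : MeasurableSpace Ω] {u : α → Ω → ℝ}
    (hu : ∀ a, Measurable (u a)) (S : Set α) : generatedBy u S ≤ mΩ :=
  iSup₂_le fun a _ => (hu a).comap_le

lemma measurable_generatedBy_monomial {α Ω J : Type*} [Fintype J] {u : α → Ω → ℝ} {S : Set α}
    {f : J → α} (hf : ∀ j, f j ∈ S) : Measurable[generatedBy u S] (monomial u f) := by
  let _ := generatedBy u S
  exact Finset.measurable_fun_prod _ fun j _ => measurable_generatedBy (hf j)

lemma integral_mul_of_generatedBy {α Ω : Type*} [mΩ : MeasurableSpace Ω] {μ : Measure Ω}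
    {u : α → Ω → ℝ} (hu : IsStandardInput u μ) {S T : Set α} (hST : Disjoint S T)
    {F G : Ω → ℝ} (hF : Measurable[generatedBy u S] F) (hG : Measurable[generatedBy u T] G) :
    ∫ ω, F ω * G ω ∂μ = (∫ ω, F ω ∂μ) * ∫ ω, G ω ∂μ := by
  have h := indep_iSup_of_disjoint (fun a => (hu.measurable a).comap_le) hu.indep.iIndep hST
  have hind : IndepFun F G μ := by
    rw [IndepFun_iff_Indep]
    exact indep_of_indep_of_le_left (indep_of_indep_of_le_right h hG.comap_le) hF.comap_le
  exact hind.integral_fun_mul_eq_mul_integral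
    (hF.mono (generatedBy_le hu.measurable S) le_rfl).aestronglyMeasurable
    (hG.mono (generatedBy_le hu.measurable T) le_rfl).aestronglyMeasurable

/-- The monomial containing the solitary variable has mean zero, so centring does not alter it, and
the variable splits off as an independent factor of mean zero. -/
lemma integral_prod_centered_eq_zero_of_single {α Ω : Type*} [MeasurableSpace Ω] {μ : Measure Ω}
    {u : α → Ω → ℝ} (hu : IsStandardInput u μ) {r : ℕ} {J : Type*} [Fintype J]
    {f : Fin r → J → α} {c₀ : Fin r} {j₀ : J}
    (hj : ∀ c j, f c j = f c₀ j₀ → c = c₀ ∧ j = j₀) :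
    ∫ ω, ∏ c, (monomial u (f c) ω - ∫ ω, monomial u (f c) ω ∂μ) ∂μ = 0 := by
  classical
  have h0 : ∫ ω, monomial u (f c₀) ω ∂μ = 0 :=
    integral_monomial_eq_zero hu (j₀ := j₀) fun j h => (hj c₀ j h).2
  set S : Set α := {f c₀ j₀} with hS
  have h1 : ∀ ω, ∏ c, (monomial u (f c) ω - ∫ ω, monomial u (f c) ω ∂μ) =
      u (f c₀ j₀) ω * ((∏ j ∈ Finset.univ.erase j₀, u (f c₀ j) ω) *
        ∏ c ∈ Finset.univ.erase c₀, (monomial u (f c) ω - ∫ ω, monomial u (f c) ω ∂μ)) := by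
    intro ω
    rw [← Finset.mul_prod_erase _ _ (Finset.mem_univ c₀), h0, sub_zero, monomial,
      ← Finset.mul_prod_erase _ _ (Finset.mem_univ j₀), mul_assoc]
  simp_rw [h1]
  rw [integral_mul_of_generatedBy hu (S := S) (T := Sᶜ) disjoint_compl_right
    (measurable_generatedBy rfl), hu.mean, zero_mul]
  let _ := generatedBy u Sᶜ
  refine Measurable.mul (Finset.measurable_fun_prod _ fun j hj' => measurable_generatedBy ?_)
    (Finset.measurable_fun_prod _ fun c hc =>
      (measurable_generatedBy_monomial fun j => ?_).sub_const _)
  · intro h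
    exact (Finset.mem_erase.1 hj').1 (hj c₀ j h).2
  · intro h
    exact (Finset.mem_erase.1 hc).1 (hj c j h).1

/-- The centred monomial of `c₀` is independent of the product of all the others. -/
lemma integral_prod_centered_eq_zero_of_disjoint {α Ω : Type*} [MeasurableSpace Ω]
    {μ : Measure Ω} [IsProbabilityMeasure μ] {u : α → Ω → ℝ} (hu : InputA3 u μ) {r : ℕ}
    {J : Type*} [Fintype J] [Nonempty J]
    {f : Fin r → J → α} {c₀ : Fin r} (hj : ∀ c ≠ c₀, ∀ j j', f c j ≠ f c₀ j') :
    ∫ ω, ∏ c, (monomial u (f c) ω - ∫ ω, monomial u (f c) ω ∂μ) ∂μ = 0 := by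
  classical
  set S : Set α := Set.range (f c₀) with hS
  simp_rw [← Finset.mul_prod_erase _ _ (Finset.mem_univ c₀)]
  rw [integral_mul_of_generatedBy hu.1 (S := S) (T := Sᶜ) disjoint_compl_right,
    integral_sub (integrable_monomial hu _) (integrable_const _)]
  · simp
  · let _ := generatedBy u S
    exact (measurable_generatedBy_monomial (f := f c₀) fun j => Set.mem_range_self j).sub_const _
  · let _ := generatedBy u Sᶜ
    refine Finset.measurable_fun_prod _ fun c hc =>
      (measurable_generatedBy_monomial fun j => ?_).sub_const _
    rintro ⟨j', hj'⟩
    exact hj c (Finset.mem_erase.1 hc).1 j j' hj'.symm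

/-- A product of four factors is at most the sum of their fourth powers, whose means are bounded
uniformly over all choices of labels. -/
lemma exists_integral_prod_centered_le {α Ω : Type*} [MeasurableSpace Ω]
    {μ : Measure Ω} [IsProbabilityMeasure μ] {u : α → Ω → ℝ} (hu : InputA3 u μ)
    (J : Type*) [Fintype J] [Nonempty J] : ∃ C : ℝ, 0 ≤ C ∧ ∀ f : Fin 4 → J → α,
      Integrable (fun ω => ∏ c, (monomial u (f c) ω - ∫ ω, monomial u (f c) ω ∂μ)) μ ∧
      ∫ ω, ∏ c, (monomial u (f c) ω - ∫ ω, monomial u (f c) ω ∂μ) ∂μ ≤ C := by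
  obtain ⟨C₁, hC₁, h1⟩ := exists_integral_monomial_pow_le hu J 1
  obtain ⟨C₄, hC₄, h4⟩ := exists_integral_monomial_pow_le hu J 4
  have hmean : ∀ f : J → α, |∫ ω, monomial u f ω ∂μ| ≤ C₁ := fun f => by
    refine abs_integral_le_integral_abs.trans ?_
    simpa using (h1 f).2
  have hle : ∀ (f : Fin 4 → J → α) ω, |∏ c, (monomial u (f c) ω - ∫ ω, monomial u (f c) ω ∂μ)| ≤
      ∑ c, (8 * |monomial u (f c) ω| ^ 4 + 8 * C₁ ^ 4) := by
    intro f ω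
    refine (abs_prod_le_sum_pow _).trans (Finset.sum_le_sum fun c _ => ?_)
    rw [Fintype.card_fin]
    calc |monomial u (f c) ω - ∫ ω, monomial u (f c) ω ∂μ| ^ 4
        ≤ (|monomial u (f c) ω| + C₁) ^ 4 := by
          gcongr
          exact (abs_sub _ _).trans (by gcongr; exact hmean _)
      _ ≤ 2 ^ (4 - 1) * (|monomial u (f c) ω| ^ 4 + C₁ ^ 4) :=
          add_pow_le (abs_nonneg _) hC₁ 4
      _ = _ := by ring
  have hint : ∀ f : Fin 4 → J → α,
      Integrable (fun ω => ∑ c, (8 * |monomial u (f c) ω| ^ 4 + 8 * C₁ ^ 4)) μ := fun f =>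
    integrable_finsetSum _ fun c _ => ((h4 _).1.const_mul _).add (integrable_const _)
  refine ⟨4 * (8 * C₄ + 8 * C₁ ^ 4), by positivity, fun f => ?_⟩
  have hint' : Integrable
      (fun ω => ∏ c, (monomial u (f c) ω - ∫ ω, monomial u (f c) ω ∂μ)) μ :=
    (hint f).mono' (Finset.measurable_fun_prod _ fun c _ =>
      (measurable_monomial hu.1.measurable _).sub_const _).aestronglyMeasurable
      (Eventually.of_forall fun ω => hle f ω)
  refine ⟨hint', (integral_mono hint' (hint f) fun ω => (le_abs_self _).trans (hle f ω)).trans ?_⟩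
  have hi : ∀ c, Integrable (fun ω => 8 * |monomial u (f c) ω| ^ 4 + 8 * C₁ ^ 4) μ := fun c =>
    ((h4 _).1.const_mul _).add (integrable_const _)
  rw [integral_finsetSum _ fun c _ => hi c]
  refine (Finset.sum_le_card_nsmul _ _ (8 * C₄ + 8 * C₁ ^ 4) fun c _ => ?_).trans (by simp; linarith)
  rw [integral_add ((h4 _).1.const_mul _) (integrable_const _), integral_const_mul]
  have := (h4 (f c)).2
  simp
  linarith

end SchurHadamard

namespace SchurHadamard

/-! ## Words of sequences of labels -/

/-- Every value of `g` is taken exactly twice. -/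
def IsPairing {ι : Type*} {h : ℕ} (g : Fin h → ι) : Prop := ∀ i, {j | g j = g i}.ncard = 2

/-- Before a letter that is new, the letters used form an initial segment of the natural numbers, so
the new letter is the least unused one. Induction on the position then identifies both words. -/
lemma Word.ext_of_eq_iff {h : ℕ} {w w' : Word h}
    (hw : ∀ i j, w.letter i = w.letter j ↔ w'.letter i = w'.letter j) : w = w' := by
  refine Word.ext_letter (funext fun i => ?_)
  induction i using WellFoundedLT.induction with
  | _ i ih =>
  by_cases hex : ∃ j < i, w.letter j = w.letter i
  · obtain ⟨j, hj, hji⟩ := hex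
    rw [← hji, ih j hj, (hw j i).1 hji]
  · have key : ∀ v : Word h, (¬ ∃ j < i, v.letter j = v.letter i) →
        v.letter '' Set.Iio i = Set.Iio (v.letter i) := by
      intro v hv
      refine Set.Subset.antisymm ?_ fun a ha => v.ordered i a ha
      rintro _ ⟨j, hj, rfl⟩
      by_contra hlt
      rcases (not_lt.1 (Set.mem_Iio.not.1 hlt)).lt_or_eq with h | h
      · obtain ⟨j', hj', h'⟩ := v.ordered j _ h
        exact hv ⟨j', hj'.trans hj, h'⟩
      · exact hv ⟨j, hj, h.symm⟩
    have hex' : ¬ ∃ j < i, w'.letter j = w'.letter i := fun ⟨j, hj, h⟩ => hex ⟨j, hj, (hw j i).2 h⟩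
    have := key w hex
    have himg : w.letter '' Set.Iio i = w'.letter '' Set.Iio i :=
      Set.image_congr fun j hj => ih j hj
    rw [himg, key w' hex'] at this
    exact (Set.Iio_injective this).symm

instance finite_word (h : ℕ) : Finite (Word h) :=
  Finite.of_injective (fun (w : Word h) i j => w.letter i = w.letter j) fun _ _ hww' =>
    Word.ext_of_eq_iff fun i j => iff_of_eq (congrFun (congrFun hww' i) j)

/-- The letter at `i` is the number of distinct values of `g` before the first occurrence of `g i`.
-/
lemma exists_word {ι : Type*} {h : ℕ} (g : Fin h → ι) :
    ∃ w : Word h, ∀ i j, w.letter i = w.letter j ↔ g i = g j := by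
  classical
  have hfirst : ∀ i : Fin h, ∃ f : Fin h, g f = g i ∧ f ≤ i ∧ ∀ j < f, g j ≠ g i := by
    intro i
    have hne : (Finset.univ.filter fun j => g j = g i).Nonempty := ⟨i, by simp⟩
    refine ⟨_, (Finset.mem_filter.1 (Finset.min'_mem _ hne)).2,
      Finset.min'_le _ _ (by simp), fun j hj hji => ?_⟩
    exact (Finset.min'_le _ j (by simp [hji])).not_gt hj
  choose f hf hfi hfj using hfirst
  let W : ℕ → ℕ := fun m => ((Finset.univ.filter fun j : Fin h => (j : ℕ) < m).image g).card
  have hWlt : ∀ i m, (f i : ℕ) < m → W (f i) < W m := by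
    intro i m hm
    refine Finset.card_lt_card (Finset.ssubset_iff.2 ⟨g i, ?_, ?_⟩)
    · simp only [Finset.mem_image, Finset.mem_filter, Finset.mem_univ, true_and, not_exists,
        not_and]
      exact fun j hj => hfj i j hj
    · refine Finset.insert_subset ?_ (Finset.image_subset_image fun j hj => ?_)
      · exact Finset.mem_image.2 ⟨f i, by simpa using hm, hf i⟩
      · simp at hj ⊢
        omega
  have hff : ∀ i j, g i = g j → f i = f j := by
    intro i j hij
    refine le_antisymm (not_lt.1 fun h => ?_) (not_lt.1 fun h => ?_)
    · exact hfj i _ h ((hf j).trans hij.symm)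
    · exact hfj j _ h ((hf i).trans hij)
  refine ⟨⟨fun i => W (f i), fun i a ha => ?_⟩, fun i j => ⟨fun hij => ?_, fun hij => ?_⟩⟩
  -- The count `W` grows by at most one at each position, so the position that first lifts it above
  -- `a` carries a new value and has letter `a`.
  · have hex : ∃ m, a < W m := ⟨_, ha⟩
    obtain ⟨m, hspec, hmin⟩ : ∃ m, a < W m ∧ ∀ m' < m, ¬ a < W m' :=
      ⟨Nat.find hex, Nat.find_spec hex, fun _ h => Nat.find_min hex h⟩
    have hle : m ≤ f i := not_lt.1 fun h => hmin _ h ha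
    obtain - | m' := m
    · simp [W] at hspec
    have hnot : ¬ a < W m' := hmin m' (Nat.lt_succ_self m')
    have hm' : m' < h := by have := (f i).isLt; omega
    set j : Fin h := ⟨m', hm'⟩ with hj
    have himg : (Finset.univ.filter fun j : Fin h => (j : ℕ) < m' + 1) =
        insert j (Finset.univ.filter fun j : Fin h => (j : ℕ) < m') := by
      ext b
      simp [hj, Fin.ext_iff]
      omega
    have hstep : W (m' + 1) ≤ W m' + 1 := by
      simp only [W]
      rw [himg, Finset.image_insert]
      exact Finset.card_insert_le _ _
    have hfj' : f j = j := by
      refine le_antisymm (hfi j) (not_lt.1 fun h => ?_)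
      have : W (m' + 1) = W m' := by
        simp only [W]
        rw [himg, Finset.image_insert, Finset.insert_eq_of_mem]
        exact Finset.mem_image.2 ⟨f j, by simpa [Fin.lt_def, hj] using h, hf j⟩
      omega
    refine ⟨j, ?_, ?_⟩
    · have : j < f i := by rw [Fin.lt_def]; simp [hj]; omega
      exact this.trans_le (hfi i)
    · rw [hfj']
      change W m' = a
      omega
  · by_contra hne
    have hne' : f i ≠ f j := fun h => hne (by rw [← hf i, ← hf j, h])
    rcases lt_or_gt_of_ne hne' with h | h
    · exact (hWlt i _ h).ne hij
    · exact (hWlt j _ h).ne hij.symm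
  · simp only [hff i j hij]

/-- The word of a sequence of labels: equal labels correspond to equal letters. -/
noncomputable def wordOf {ι : Type*} {h : ℕ} (g : Fin h → ι) : Word h := (exists_word g).choose

lemma wordOf_letter_eq_iff {ι : Type*} {h : ℕ} (g : Fin h → ι) (i j : Fin h) :
    (wordOf g).letter i = (wordOf g).letter j ↔ g i = g j := (exists_word g).choose_spec i j

lemma wordOf_eq_iff {ι : Type*} {h : ℕ} {g : Fin h → ι} {w : Word h} :
    wordOf g = w ↔ ∀ i j, w.letter i = w.letter j ↔ g i = g j := by
  refine ⟨?_, fun hw => Word.ext_of_eq_iff fun i j => ?_⟩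
  · rintro rfl
    exact wordOf_letter_eq_iff g
  · rw [wordOf_letter_eq_iff, hw]

lemma pairMatched_wordOf_iff {ι : Type*} {h : ℕ} {g : Fin h → ι} :
    (wordOf g).PairMatched ↔ IsPairing g := by
  simp only [Word.PairMatched, IsPairing, wordOf_letter_eq_iff]

lemma ncard_circuitClass_inter {ι κ : Type*} {LX : SymLink ι} {LY : SymLink κ} {h : ℕ} [NeZero h]
    (n : ℕ) (w w' : Word h) : (circuitClass LX n w ∩ circuitClass LY n w').ncard =
      {c : Fin h → Fin n | wordOf (edgeLabel (LX.val n) c) = w ∧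
        wordOf (edgeLabel (LY.val n) c) = w'}.ncard := by
  rw [← Set.InjOn.ncard_image (s := circuitClass LX n w ∩ circuitClass LY n w')
    (f := fun p j => p (Fin.castSucc j)) fun p hp q hq hpq => closed_ext hp.1.1 hq.1.1 hpq]
  congr 1
  ext c
  simp only [wordOf_eq_iff, Set.mem_image, Set.mem_inter_iff, Set.mem_ofPred_eq]
  constructor
  · rintro ⟨p, ⟨⟨hp, h1⟩, -, h2⟩, rfl⟩
    simp only [edgeLabel_comp_castSucc _ hp]
    exact ⟨h1, h2⟩
  · rintro ⟨h1, h2⟩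
    set p : Fin (h + 1) → Fin n := Fin.snoc c (c 0) with hp
    have hpc : (fun j => p (Fin.castSucc j)) = c := by
      funext j
      simp [hp]
    have hp0 : p 0 = p (Fin.last h) := by
      rw [← Fin.castSucc_zero']
      simp [hp]
    refine ⟨p, ⟨⟨hp0, ?_⟩, hp0, ?_⟩, hpc⟩
    · intro i j
      rw [h1, ← hpc, edgeLabel_comp_castSucc _ hp0, edgeLabel_comp_castSucc _ hp0]
    · intro i j
      rw [h2, ← hpc, edgeLabel_comp_castSucc _ hp0, edgeLabel_comp_castSucc _ hp0]

/-- There are finitely many words of a given length, so the limits of the counts over pairs of words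
may be added: off the diagonal they vanish, on it they count Catalan words. -/
lemma tendsto_ncard_pairings {ι κ : Type*} {LX : SymLink ι} {LY : SymLink κ}
    (hc : Compatible LX LY) (hw : LeadsToWigner LX LY) {k : ℕ} (hk : 1 ≤ k) [NeZero (2 * k)] :
    Tendsto (fun n : ℕ => ({c : Fin (2 * k) → Fin n | IsPairing (edgeLabel (LX.val n) c) ∧
      IsPairing (edgeLabel (LY.val n) c)}.ncard : ℝ) / (n : ℝ) ^ (k + 1)) atTop
      (𝓝 (catalan k)) := by
  classical
  have := Fintype.ofFinite (Word (2 * k))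
  let P : Finset (Word (2 * k)) := Finset.univ.filter Word.PairMatched
  have hcount : ∀ n : ℕ, {c : Fin (2 * k) → Fin n | IsPairing (edgeLabel (LX.val n) c) ∧
      IsPairing (edgeLabel (LY.val n) c)}.ncard =
      ∑ w ∈ P, ∑ w' ∈ P, (circuitClass LX n w ∩ circuitClass LY n w').ncard := by
    intro n
    rw [← Finset.sum_product', Set.ncard_eq_toFinset_card',
      Finset.card_eq_sum_card_fiberwise (t := P ×ˢ P)
        (f := fun c => (wordOf (edgeLabel (LX.val n) c), wordOf (edgeLabel (LY.val n) c)))]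
    · refine Finset.sum_congr rfl fun q hq => ?_
      simp only [P, Finset.mem_product, Finset.mem_filter, Finset.mem_univ, true_and] at hq
      rw [ncard_circuitClass_inter, ← Set.ncard_coe_finset]
      congr 1
      ext c
      simp only [Finset.coe_filter, Set.mem_toFinset, Set.mem_ofPred_eq, Prod.ext_iff]
      refine ⟨fun h => h.2, fun h => ⟨?_, h⟩⟩
      rw [← pairMatched_wordOf_iff, ← pairMatched_wordOf_iff, h.1, h.2]
      exact hq
    · intro c hc
      simp only [Set.coe_toFinset, Set.mem_ofPred_eq] at hc
      simpa [P, pairMatched_wordOf_iff] using hc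
  have hlim : ∀ w ∈ P, ∀ w' ∈ P, HasWordLimit LX LY w w'
      (if w' = w then (if w.IsCatalan then 1 else 0) else 0) := by
    intro w hwP w' hwP'
    simp only [P, Finset.mem_filter, Finset.mem_univ, true_and] at hwP hwP'
    split_ifs with h1 h2
    · subst h1
      simpa [h2] using hw k w' hk hwP
    · subst h1
      simpa [h2] using hw k w' hk hwP
    · exact hc k w w' hk hwP hwP' (Ne.symm h1)
  have hsum := tendsto_finsetSum P fun w hwP => tendsto_finsetSum P fun w' hwP' => hlim w hwP w' hwP'
  have hcat : ∑ w ∈ P, ∑ w' ∈ P, (if w' = w then (if w.IsCatalan then (1 : ℝ) else 0) else 0) =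
      catalan k := by
    rw [Finset.sum_congr rfl (g := fun w : Word (2 * k) => if w.IsCatalan then (1 : ℝ) else 0),
      Finset.sum_boole, ← ncard_catalan_words k hk, ← Set.ncard_coe_finset]
    · congr 2
      ext w
      simp [P]
    · intro w hwP
      rw [Finset.sum_ite_eq' P w, if_pos hwP]
  rw [hcat] at hsum
  refine hsum.congr fun n => ?_
  rw [hcount]
  push_cast
  simp_rw [Finset.sum_div]

end SchurHadamard

namespace SchurHadamard

/-! ## Moments for inputs with uniformly bounded moments -/

/-- The labels, for a pair of arrays, of the edges of a circuit. -/
def jointLabel {ι κ : Type*} {n h : ℕ} [NeZero h] (l : Fin n → Fin n → ι) (l' : Fin n → Fin n → κ)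
    (c : Fin h → Fin n) : Fin h ⊕ Fin h → ι ⊕ κ :=
  Sum.map (edgeLabel l c) (edgeLabel l' c)

/-- The sum of the monomials of all circuits of length `h`. -/
noncomputable def circuitSum {ι κ Ω : Type*} (LX : SymLink ι) (LY : SymLink κ) (u : ι ⊕ κ → Ω → ℝ)
    (h : ℕ) [NeZero h] (n : ℕ) (ω : Ω) : ℝ :=
  ∑ c : Fin h → Fin n, monomial u (jointLabel (LX.val n) (LY.val n) c) ω

lemma integral_pow_productESD {ι κ Ω : Type*} (LX : SymLink ι) (LY : SymLink κ)
    (x : ι → Ω → ℝ) (y : κ → Ω → ℝ) (n h : ℕ) [NeZero h] (ω : Ω) :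
    ∫ s, s ^ h ∂productESD LX LY x y n ω =
      circuitSum LX LY (Sum.elim x y) h n ω / (n * √n ^ h) := by
  rw [productESD, integral_pow_esd, circuitSum, div_eq_inv_mul, mul_inv, mul_assoc]
  congr 1
  rw [Finset.mul_sum]
  refine Finset.sum_congr rfl fun c _ => ?_
  rw [monomial, Fintype.prod_sum_type]
  simp only [scaledProduct, patternedMatrix, Matrix.smul_apply, Matrix.hadamard_apply,
    Matrix.of_apply, smul_eq_mul, jointLabel, Sum.map_inl, Sum.map_inr, Sum.elim_inl,
    Sum.elim_inr, edgeLabel, Finset.prod_mul_distrib, Finset.prod_const, Finset.card_univ,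
    Fintype.card_fin, inv_pow]

lemma card_image_of_matched {ι : Type*} [DecidableEq ι] {h : ℕ} {g : Fin h → ι}
    (hg : ∀ i, ∃ j ≠ i, g j = g i) : 2 * (Finset.univ.image g).card ≤ h ∧
      (¬ IsPairing g → 2 * (Finset.univ.image g).card < h) := by
  have h1 := Finset.card_eq_sum_card_image g Finset.univ
  rw [Finset.card_univ, Fintype.card_fin] at h1
  have h2 : ∀ t ∈ Finset.univ.image g, 2 ≤ (Finset.univ.filter fun j => g j = t).card := by
    intro t ht
    obtain ⟨i, -, rfl⟩ := Finset.mem_image.1 ht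
    obtain ⟨j, hj, hji⟩ := hg i
    exact Finset.one_lt_card.2 ⟨j, by simp [hji], i, by simp, hj⟩
  have h3 : ∑ _t ∈ Finset.univ.image g, 2 = 2 * (Finset.univ.image g).card := by
    simp [mul_comm]
  constructor
  · rw [← h3]
    exact (Finset.sum_le_sum h2).trans h1.ge
  · intro hp
    simp only [IsPairing, not_forall] at hp
    obtain ⟨i, hi⟩ := hp
    rw [← h3]
    refine (Finset.sum_lt_sum h2 ⟨g i, Finset.mem_image_of_mem g (Finset.mem_univ i), ?_⟩).trans_le
      h1.ge
    refine lt_of_le_of_ne (h2 _ (Finset.mem_image_of_mem g (Finset.mem_univ i))) fun h => hi ?_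
    rw [h, ← Set.ncard_coe_finset]
    simp

lemma card_image_of_isPairing {ι : Type*} [DecidableEq ι] {h : ℕ} {g : Fin h → ι}
    (hg : IsPairing g) : 2 * (Finset.univ.image g).card = h := by
  have h1 := Finset.card_eq_sum_card_image g Finset.univ
  rw [Finset.card_univ, Fintype.card_fin, Finset.sum_congr rfl (g := fun _ => 2)] at h1
  · simp at h1
    omega
  · intro t ht
    obtain ⟨i, -, rfl⟩ := Finset.mem_image.1 ht
    rw [← hg i, ← Set.ncard_coe_finset]
    simp

lemma integral_monomial_jointLabel_eq_one {ι κ Ω : Type*} [MeasurableSpace Ω] {μ : Measure Ω}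
    [IsProbabilityMeasure μ] {u : ι ⊕ κ → Ω → ℝ} (hu : IsStandardInput u μ) {n h : ℕ} [NeZero h]
    {l : Fin n → Fin n → ι} {l' : Fin n → Fin n → κ} {c : Fin h → Fin n}
    (hc : IsPairing (edgeLabel l c)) (hc' : IsPairing (edgeLabel l' c)) :
    ∫ ω, monomial u (jointLabel l l' c) ω ∂μ = 1 := by
  classical
  refine integral_monomial_eq_one hu ?_
  rintro (i | i)
  · rw [← hc i,
      ← Set.ncard_image_of_injective {j | edgeLabel l c j = edgeLabel l c i}
        (Sum.inl_injective (β := Fin h))]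
    congr 1
    ext j
    cases j <;> simp [jointLabel, Set.mem_ofPred_eq]
  · rw [← hc' i,
      ← Set.ncard_image_of_injective {j | edgeLabel l' c j = edgeLabel l' c i}
        (Sum.inr_injective (α := Fin h))]
    congr 1
    ext j
    cases j <;> simp [jointLabel, Set.mem_ofPred_eq]

lemma matched_of_integral_ne_zero {ι κ Ω : Type*} [MeasurableSpace Ω] {μ : Measure Ω}
    {u : ι ⊕ κ → Ω → ℝ} (hu : IsStandardInput u μ) {n h : ℕ} [NeZero h]
    {l : Fin n → Fin n → ι} {l' : Fin n → Fin n → κ} {c : Fin h → Fin n}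
    (hc : ∫ ω, monomial u (jointLabel l l' c) ω ∂μ ≠ 0) :
    (∀ i, ∃ j ≠ i, edgeLabel l c j = edgeLabel l c i) ∧
      ∀ i, ∃ j ≠ i, edgeLabel l' c j = edgeLabel l' c i := by
  constructor
  · intro i
    by_contra! hi
    refine hc (integral_monomial_eq_zero hu (j₀ := .inl i) ?_)
    rintro (j | j) hj
    · by_contra hne
      exact hi j (fun h => hne (by rw [h])) (by simpa [jointLabel] using hj)
    · simp [jointLabel] at hj
  · intro i
    by_contra! hi
    refine hc (integral_monomial_eq_zero hu (j₀ := .inr i) ?_)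
    rintro (j | j) hj
    · simp [jointLabel] at hj
    · by_contra hne
      exact hi j (fun h => hne (by rw [h])) (by simpa [jointLabel] using hj)

lemma card_matched_not_pairing_le {ι : Type*} {D n h : ℕ} [NeZero h] {l : Fin n → Fin n → ι}
    (hl : RowBound D l) : {c : Fin h → Fin n | (∀ i, ∃ j ≠ i, edgeLabel l c j = edgeLabel l c i) ∧
      ¬ IsPairing (edgeLabel l c)}.ncard ≤ (D * h + 1) ^ h * n ^ ((h - 1) / 2 + 1) := by
  classical
  have h1 := card_circuits_le (h := h) hl ∅ ((h - 1) / 2)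
  rw [Finset.card_empty, zero_add] at h1
  refine le_trans ?_ h1
  rw [← Set.ncard_coe_finset]
  refine Set.ncard_le_ncard ?_ (Set.toFinite _)
  rintro c ⟨hc, hc'⟩
  have := (card_image_of_matched hc).2 hc'
  simp only [Finset.coe_filter, Finset.mem_univ, true_and, Set.mem_ofPred_eq, Finset.sdiff_empty,
    circuitLabels]
  omega

/-- Circuits that pair labels for both links have mean 1, and circuits with a label on a single edge
have mean 0. On any other circuit one link has all labels repeated and one of them at least three
times, hence at most `(h - 1) / 2` labels. -/
lemma exists_abs_sum_integral_sub_le {ι κ Ω : Type*} {LX : SymLink ι} {LY : SymLink κ}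
    (hX : LX.PropertyB) (hY : LY.PropertyB) [MeasurableSpace Ω] {μ : Measure Ω}
    [IsProbabilityMeasure μ] {u : ι ⊕ κ → Ω → ℝ} (hu : InputA3 u μ) (h : ℕ) [NeZero h] :
    ∃ C : ℝ, 0 ≤ C ∧ ∀ n : ℕ, |∫ ω, circuitSum LX LY u h n ω ∂μ -
      {c : Fin h → Fin n | IsPairing (edgeLabel (LX.val n) c) ∧
        IsPairing (edgeLabel (LY.val n) c)}.ncard| ≤ C * (n : ℝ) ^ ((h - 1) / 2 + 1) := by
  classical
  obtain ⟨D, hD⟩ := exists_rowBound hX hY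
  have : Nonempty (Fin h ⊕ Fin h) := ⟨.inl 0⟩
  obtain ⟨C, hC, hC'⟩ := exists_integral_monomial_pow_le hu (Fin h ⊕ Fin h) 1
  refine ⟨(2 * (D * h + 1) ^ h) * C, by positivity, fun n => ?_⟩
  set P := {c : Fin h → Fin n | IsPairing (edgeLabel (LX.val n) c) ∧
    IsPairing (edgeLabel (LY.val n) c)} with hP
  set E : (Fin h → Fin n) → ℝ :=
    fun c => ∫ ω, monomial u (jointLabel (LX.val n) (LY.val n) c) ω ∂μ with hE
  set QX := {c : Fin h → Fin n | (∀ i, ∃ j ≠ i, edgeLabel (LX.val n) c j =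
    edgeLabel (LX.val n) c i) ∧ ¬ IsPairing (edgeLabel (LX.val n) c)} with hQX
  set QY := {c : Fin h → Fin n | (∀ i, ∃ j ≠ i, edgeLabel (LY.val n) c j =
    edgeLabel (LY.val n) c i) ∧ ¬ IsPairing (edgeLabel (LY.val n) c)} with hQY
  have h1 : ∫ ω, circuitSum LX LY u h n ω ∂μ = ∑ c, E c :=
    integral_finsetSum _ fun c _ => integrable_monomial hu _
  have h2 : (P.ncard : ℝ) = ∑ c, if c ∈ P then 1 else 0 := by
    rw [Finset.sum_boole, Set.ncard_eq_toFinset_card']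
    congr 2
    ext c
    simp
  have h3 : ∀ c, |E c - if c ∈ P then 1 else 0| ≤ if c ∈ QX ∪ QY then C else 0 := by
    intro c
    by_cases hcP : c ∈ P
    · rw [if_pos hcP, show E c = 1 from integral_monomial_jointLabel_eq_one hu.1 hcP.1 hcP.2,
        sub_self, abs_zero]
      split_ifs
      exacts [hC, le_rfl]
    · rw [if_neg hcP, sub_zero]
      by_cases h0 : E c = 0
      · rw [h0, abs_zero]
        split_ifs
        exacts [hC, le_rfl]
      · have hm := matched_of_integral_ne_zero hu.1 h0
        rw [if_pos]
        · refine abs_integral_le_integral_abs.trans ?_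
          simpa using (hC' (jointLabel (LX.val n) (LY.val n) c)).2
        · by_cases hcX : IsPairing (edgeLabel (LX.val n) c)
          · exact Or.inr ⟨hm.2, fun hcY => hcP ⟨hcX, hcY⟩⟩
          · exact Or.inl ⟨hm.1, hcX⟩
  rw [h1, h2, ← Finset.sum_sub_distrib]
  calc _ ≤ ∑ c, |E c - if c ∈ P then 1 else 0| := Finset.abs_sum_le_sum_abs _ _
    _ ≤ ∑ c, if c ∈ QX ∪ QY then C else 0 := Finset.sum_le_sum fun c _ => h3 c
    _ = ((QX ∪ QY).ncard : ℝ) * C := by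
        rw [← Finset.sum_filter, Finset.sum_const, nsmul_eq_mul, Set.ncard_eq_toFinset_card']
        congr 3
        ext c
        simp
    _ ≤ ((2 * (D * h + 1) ^ h * n ^ ((h - 1) / 2 + 1) : ℕ) : ℝ) * C := by
        gcongr
        have h4 := card_matched_not_pairing_le (h := h) (hD n).1
        have h5 := card_matched_not_pairing_le (h := h) (hD n).2
        refine (Set.ncard_union_le _ _).trans ?_
        rw [mul_assoc, two_mul]
        exact add_le_add h4 h5
    _ = _ := by
        push_cast
        ring

lemma tendsto_integral_circuitSum {ι κ Ω : Type*} {LX : SymLink ι} {LY : SymLink κ}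
    (hX : LX.PropertyB) (hY : LY.PropertyB) (hc : Compatible LX LY) (hw : LeadsToWigner LX LY)
    [MeasurableSpace Ω] {μ : Measure Ω} [IsProbabilityMeasure μ] {u : ι ⊕ κ → Ω → ℝ}
    (hu : InputA3 u μ) (h : ℕ) [NeZero h] :
    Tendsto (fun n : ℕ => (∫ ω, circuitSum LX LY u h n ω ∂μ) / (n * √n ^ h)) atTop
      (𝓝 (semicircleMoment h)) := by
  obtain ⟨C, hC, hle⟩ := exists_abs_sum_integral_sub_le hX hY hu h
  set P := fun n : ℕ => {c : Fin h → Fin n | IsPairing (edgeLabel (LX.val n) c) ∧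
    IsPairing (edgeLabel (LY.val n) c)} with hP
  have h1 : Tendsto (fun n : ℕ => ((P n).ncard : ℝ) / (n * √n ^ h)) atTop
      (𝓝 (semicircleMoment h)) := by
    rcases Nat.even_or_odd' h with ⟨k, rfl | rfl⟩
    · have hk : 1 ≤ k := by have := NeZero.ne (2 * k); omega
      have := tendsto_ncard_pairings hc hw hk
      rw [semicircleMoment, if_pos (by simp), Nat.mul_div_cancel_left _ two_pos]
      refine this.congr fun n => ?_
      rw [pow_mul, Real.sq_sqrt (Nat.cast_nonneg n), pow_succ']
    · rw [semicircleMoment, if_neg (by simp)]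
      refine tendsto_const_nhds.congr fun n => ?_
      have : P n = ∅ := by
        refine Set.eq_empty_of_forall_notMem fun c hc => ?_
        classical
        have := card_image_of_isPairing hc.1
        omega
      simp [this]
  have h2 : Tendsto (fun n : ℕ => (∫ ω, circuitSum LX LY u h n ω ∂μ - (P n).ncard) /
      (n * √n ^ h)) atTop (𝓝 0) := by
    have hlim : Tendsto (fun n : ℕ => C / √n) atTop (𝓝 0) :=
      (Real.tendsto_sqrt_atTop.comp tendsto_natCast_atTop_atTop).const_div_atTop C
    refine squeeze_zero_norm' ?_ hlim
    filter_upwards [eventually_gt_atTop 0] with n hn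
    have hn1 : (1 : ℝ) ≤ √n := Real.one_le_sqrt.2 (by exact_mod_cast hn)
    have hn0 : 0 < √(n : ℝ) := by positivity
    rw [Real.norm_eq_abs, abs_div, abs_of_nonneg (a := (n : ℝ) * √n ^ h) (by positivity)]
    rw [div_le_div_iff₀ (by positivity) hn0]
    have hsq : (n : ℝ) = √n ^ 2 := (Real.sq_sqrt (Nat.cast_nonneg n)).symm
    calc _ ≤ C * (n : ℝ) ^ ((h - 1) / 2 + 1) * √n := by gcongr; exact hle n
      _ = C * √n ^ (2 * ((h - 1) / 2 + 1) + 1) := by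
          rw [pow_succ √(n : ℝ), pow_mul √(n : ℝ), ← hsq, mul_assoc]
      -- The exponents agree for odd `h`; for even `h` there is one power of √n to spare.
      _ ≤ C * √n ^ (2 + h) := by
          refine mul_le_mul_of_nonneg_left (pow_le_pow_right₀ hn1 ?_) hC
          have := NeZero.ne h
          omega
      _ = _ := by rw [pow_add, ← hsq]
  simpa [← add_div] using h2.add h1

/-- The fourth power expands into quadruples of circuits. A quadruple contributes nothing if a label
of the first link occurs once in it, or if one circuit shares no label of either link with another;
the rest are counted by `exists_card_linked_le`. -/
lemma integral_circuitSum_sub_pow_le {ι κ Ω : Type*} {LX : SymLink ι} {LY : SymLink κ}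
    (hX : LX.PropertyB) (hY : LY.PropertyB) [MeasurableSpace Ω] {μ : Measure Ω}
    [IsProbabilityMeasure μ] {u : ι ⊕ κ → Ω → ℝ} (hu : InputA3 u μ) (h : ℕ) [NeZero h] :
    ∃ C : ℝ, ∀ n : ℕ, 0 < n →
      Integrable (fun ω => (circuitSum LX LY u h n ω - ∫ ω, circuitSum LX LY u h n ω ∂μ) ^ 4) μ ∧
      ∫ ω, (circuitSum LX LY u h n ω - ∫ ω, circuitSum LX LY u h n ω ∂μ) ^ 4 ∂μ ≤
        C * (n : ℝ) ^ (2 * h + 2) := by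
  classical
  obtain ⟨D, hD⟩ := exists_rowBound hX hY
  have : Nonempty (Fin h ⊕ Fin h) := ⟨.inl 0⟩
  obtain ⟨C, hC, hC'⟩ := exists_integral_prod_centered_le hu (Fin h ⊕ Fin h)
  obtain ⟨K, hK⟩ := exists_card_linked_le ι κ D h
  refine ⟨K * C, fun n hn => ?_⟩
  set f : (Fin h → Fin n) → Fin h ⊕ Fin h → ι ⊕ κ := jointLabel (LX.val n) (LY.val n) with hf
  have h1 : ∫ ω, circuitSum LX LY u h n ω ∂μ = ∑ c, ∫ ω, monomial u (f c) ω ∂μ :=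
    integral_finsetSum _ fun c _ => integrable_monomial hu _
  have h2 : ∀ ω, (circuitSum LX LY u h n ω - ∫ ω, circuitSum LX LY u h n ω ∂μ) ^ 4 =
      ∑ p : Fin 4 → Fin h → Fin n, ∏ a,
        (monomial u (f (p a)) ω - ∫ ω, monomial u (f (p a)) ω ∂μ) := by
    intro ω
    rw [h1, circuitSum, ← Finset.sum_sub_distrib, Fintype.sum_pow]
  simp_rw [h2]
  refine ⟨integrable_finsetSum _ fun p _ => (hC' fun a => f (p a)).1, ?_⟩
  rw [integral_finsetSum _ fun p _ => (hC' fun a => f (p a)).1]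
  set S := {p : Fin 4 → Fin h → Fin n | JointlyMatched (LX.val n) p ∧
    ∀ c, ∃ d ≠ c, ShareLabel (LX.val n) (p c) (p d) ∨ ShareLabel (LY.val n) (p c) (p d)} with hS
  have h3 : ∀ p : Fin 4 → Fin h → Fin n, ∫ ω, ∏ a,
      (monomial u (f (p a)) ω - ∫ ω, monomial u (f (p a)) ω ∂μ) ∂μ ≤ if p ∈ S then C else 0 := by
    intro p
    split_ifs with hp
    · exact (hC' fun a => f (p a)).2
    · refine le_of_eq ?_
      rw [hS, Set.mem_ofPred_eq, not_and_or] at hp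
      rcases hp with hp | hp
      · simp only [JointlyMatched, not_forall, not_exists, not_and] at hp
        obtain ⟨c, i, hci⟩ := hp
        refine integral_prod_centered_eq_zero_of_single hu.1 (f := fun a => f (p a)) (c₀ := c)
          (j₀ := .inl i) ?_
        rintro d (j | j) hdj
        · by_contra hne
          refine hci d j (fun h => hne ?_) (by simpa [hf, jointLabel] using hdj)
          rw [Prod.mk.injEq] at h
          exact ⟨h.1, by rw [h.2]⟩
        · simp [hf, jointLabel] at hdj
      · simp only [not_forall, not_exists, not_and, not_or] at hp
        obtain ⟨c, hc⟩ := hp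
        refine integral_prod_centered_eq_zero_of_disjoint hu (f := fun a => f (p a)) (c₀ := c) ?_
        rintro d hd (j | j) (j' | j') heq
        · exact (hc d hd).1 ⟨j', j, by simpa [hf, jointLabel] using heq.symm⟩
        · simp [hf, jointLabel] at heq
        · simp [hf, jointLabel] at heq
        · exact (hc d hd).2 ⟨j', j, by simpa [hf, jointLabel] using heq.symm⟩
  calc _ ≤ ∑ p, if p ∈ S then C else 0 := Finset.sum_le_sum fun p _ => h3 p
    _ = (S.ncard : ℝ) * C := by
        rw [← Finset.sum_filter, Finset.sum_const, nsmul_eq_mul, Set.ncard_eq_toFinset_card']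
        congr 3
        ext c
        simp
    _ ≤ ((K * n ^ (2 * h + 2) : ℕ) : ℝ) * C := by
        gcongr
        exact hK n _ _ hn (hD n).1 (hD n).2
    _ = _ := by
        push_cast
        ring

lemma ae_summable_of_integral_le {Ω : Type*} [MeasurableSpace Ω] {μ : Measure Ω}
    {V : ℕ → Ω → ℝ} (hV : ∀ n ω, 0 ≤ V n ω) (hint : ∀ n, Integrable (V n) μ) {b : ℕ → ℝ}
    (hb : Summable b) (hle : ∀ n, ∫ ω, V n ω ∂μ ≤ b n) : ∀ᵐ ω ∂μ, Summable fun n => V n ω := by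
  have hb0 : ∀ n, 0 ≤ b n := fun n => (integral_nonneg (hV n)).trans (hle n)
  have h1 : ∫⁻ ω, ∑' n, ENNReal.ofReal (V n ω) ∂μ ≠ ⊤ := by
    rw [lintegral_tsum fun n => (hint n).1.aemeasurable.ennreal_ofReal]
    refine ne_top_of_le_ne_top (hb.tsum_ofReal_ne_top) (ENNReal.tsum_le_tsum fun n => ?_)
    rw [← ofReal_integral_eq_lintegral_ofReal (hint n) (Eventually.of_forall (hV n))]
    exact ENNReal.ofReal_le_ofReal (hle n)
  have h2 := ae_lt_top' (AEMeasurable.tsum fun n =>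
    (hint n).1.aemeasurable.ennreal_ofReal) h1
  filter_upwards [h2] with ω hω
  have := ENNReal.summable_toReal hω.ne
  simpa [ENNReal.toReal_ofReal (hV _ ω)] using this

lemma ae_tendsto_moments {ι κ Ω : Type*} {LX : SymLink ι} {LY : SymLink κ}
    (hX : LX.PropertyB) (hY : LY.PropertyB) (hc : Compatible LX LY) (hw : LeadsToWigner LX LY)
    [MeasurableSpace Ω] {μ : Measure Ω} [IsProbabilityMeasure μ] {u : ι ⊕ κ → Ω → ℝ}
    (hu : InputA3 u μ) (h : ℕ) [NeZero h] :
    ∀ᵐ ω ∂μ, Tendsto (fun n : ℕ => circuitSum LX LY u h n ω / (n * √n ^ h)) atTop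
      (𝓝 (semicircleMoment h)) := by
  obtain ⟨C, hC⟩ := integral_circuitSum_sub_pow_le hX hY hu h
  have hmean := tendsto_integral_circuitSum hX hY hc hw hu h
  set m : ℕ → ℝ := fun n => ∫ ω, circuitSum LX LY u h n ω ∂μ with hm
  set V : ℕ → Ω → ℝ := fun n ω => ((circuitSum LX LY u h n ω - m n) / (n * √n ^ h)) ^ 4 with hV
  -- The normalization to the fourth power is n^(2h+4), against a bound of order n^(2h+2).
  have hsum : Summable fun n : ℕ => C * ((n : ℝ) ^ 2)⁻¹ :=
    (Real.summable_nat_pow_inv.2 one_lt_two).mul_left C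
  have hV0 : ∀ ω, V 0 ω = 0 := by simp [hV]
  have hint : ∀ n, Integrable (V n) μ := by
    intro n
    rcases n.eq_zero_or_pos with rfl | hn
    · rw [funext hV0]
      exact integrable_zero _ _ _
    · simp only [hV, div_pow]
      exact (hC n hn).1.div_const _
  have h1 := ae_summable_of_integral_le (V := V) (fun n ω => by positivity) hint hsum fun n => by
    rcases n.eq_zero_or_pos with rfl | hn
    · simp [hV0]
    · simp only [hV, div_pow]
      rw [integral_div, div_le_iff₀ (by positivity)]
      refine (hC n hn).2.trans (le_of_eq ?_)
      have hsq : √(n : ℝ) ^ 2 = n := Real.sq_sqrt (Nat.cast_nonneg n)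
      have : (√(n : ℝ) ^ h) ^ 4 = (n : ℝ) ^ (2 * h) := by
        rw [← pow_mul, show h * 4 = 2 * (2 * h) by ring, pow_mul, hsq]
      rw [mul_pow, this]
      have hn' : (n : ℝ) ≠ 0 := by positivity
      field_simp
      ring
  filter_upwards [h1] with ω hω
  have h2 : Tendsto (fun n : ℕ => (circuitSum LX LY u h n ω - m n) / (n * √n ^ h)) atTop
      (𝓝 0) := by
    have h3 := hω.tendsto_atTop_zero
    simp only [hV] at h3
    have h4 := (Real.continuous_sqrt.comp Real.continuous_sqrt).tendsto 0 |>.comp h3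
    rw [tendsto_zero_iff_abs_tendsto_zero]
    simp only [Function.comp_apply, Real.sqrt_zero] at h4
    refine h4.congr fun n => ?_
    simp only [Function.comp_apply]
    rw [show ∀ z : ℝ, z ^ 4 = (z ^ 2) ^ 2 by intro z; ring, Real.sqrt_sq (by positivity),
      Real.sqrt_sq_eq_abs]
  refine (zero_add (semicircleMoment h) ▸ h2.add hmean).congr fun n => ?_
  rw [← add_div, sub_add_cancel]

theorem isLimitAlmostSurely_of_inputA3 {ι κ Ω : Type*} {LX : SymLink ι} {LY : SymLink κ}
    (hX : LX.PropertyB) (hY : LY.PropertyB) (hc : Compatible LX LY) (hw : LeadsToWigner LX LY)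
    [MeasurableSpace Ω] {μ : Measure Ω} [IsProbabilityMeasure μ] {x : ι → Ω → ℝ} {y : κ → Ω → ℝ}
    (hx : InputA3 x μ) (hy : InputA3 y μ)
    (hxy : IndepFun (fun ω t => x t ω) (fun ω s => y s ω) μ) :
    ∀ᵐ ω ∂μ, ∀ s : ℝ, Tendsto (fun n => (productESD LX LY x y n ω).real (Set.Iic s)) atTop
      (𝓝 (semicircleLaw.real (Set.Iic s))) := by
  have h1 : ∀ᵐ ω ∂μ, ∀ h : ℕ, Tendsto (fun n : ℕ => circuitSum LX LY (Sum.elim x y) (h + 1) n ω /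
      (n * √n ^ (h + 1))) atTop (𝓝 (semicircleMoment (h + 1))) :=
    ae_all_iff.2 fun h => ae_tendsto_moments hX hY hc hw (inputA3_sumElim hx hy hxy) (h + 1)
  filter_upwards [h1] with ω hω s
  -- The shift avoids `n = 0`, where the spectral distribution is not a probability measure.
  rw [← tendsto_add_atTop_iff_nat 1]
  have : ∀ n, IsProbabilityMeasure (productESD LX LY x y (n + 1) ω) := fun n =>
    isProbabilityMeasure_esd n.succ_pos _
  refine tendsto_cdf_of_tendsto_moments (ν := fun n => productESD LX LY x y (n + 1) ω)
    ae_semicircleLaw (fun n m => integrable_esd n.succ_pos _ _) (fun h => ?_) s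
  obtain - | h := h
  · simp
  · simp_rw [integral_pow_productESD, integral_pow_semicircleLaw]
    exact (tendsto_add_atTop_iff_nat 1).2 (hω h)

end SchurHadamard

namespace SchurHadamard

/-! ## Approximation by inputs with uniformly bounded moments -/

lemma InputA1.inputA3 {ι Ω : Type*} [MeasurableSpace Ω] {μ : Measure Ω} [IsProbabilityMeasure μ]
    {x : ι → Ω → ℝ} (hx : InputA1 x μ) : InputA3 x μ := by
  obtain ⟨hx, C, hC⟩ := hx
  refine ⟨hx, fun m => ⟨C ^ m, fun t => ?_⟩⟩
  have hle : ∀ᵐ ω ∂μ, |x t ω| ^ m ≤ C ^ m := by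
    filter_upwards [hC t] with ω hω
    gcongr
  have hint : Integrable (fun ω => |x t ω| ^ m) μ := by
    refine (integrable_const (C ^ m)).mono' ((hx.measurable t).abs.pow_const m).aestronglyMeasurable
      ?_
    filter_upwards [hle] with ω hω
    rwa [Real.norm_eq_abs, abs_of_nonneg (by positivity)]
  refine ⟨hint, (integral_mono_ae hint (integrable_const _) hle).trans (by simp)⟩

/-- Truncation at level `c`. -/
noncomputable def truncate (c s : ℝ) : ℝ := if |s| ≤ c then s else 0

lemma measurable_truncate (c : ℝ) : Measurable (truncate c) :=
  Measurable.ite (measurableSet_le measurable_norm measurable_const) measurable_id measurable_const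

lemma abs_truncate_le (c s : ℝ) : |truncate c s| ≤ |s| := by
  unfold truncate
  split_ifs
  exacts [le_rfl, by simp]

lemma abs_truncate_le_level {c : ℝ} (hc : 0 ≤ c) (s : ℝ) : |truncate c s| ≤ c := by
  unfold truncate
  split_ifs with h
  exacts [h, by simpa]

lemma tendsto_truncate (s : ℝ) : Tendsto (fun c : ℕ => truncate c s) atTop (𝓝 s) := by
  refine tendsto_const_nhds.congr' ?_
  filter_upwards [eventually_ge_atTop ⌈|s|⌉₊] with c hc
  rw [truncate, if_pos (Nat.ceil_le.1 hc)]

/-- Truncate, then restore mean 0 and variance 1; the corrections disappear as the level grows. The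
approximation is a function of the variable itself, which preserves independence and equality of
distributions. -/
lemma exists_bounded_approximation {Ω : Type*} [MeasurableSpace Ω] {μ : Measure Ω}
    [IsProbabilityMeasure μ] {X : Ω → ℝ} (hm : Measurable X) (h2 : MemLp X 2 μ)
    (hmean : ∫ ω, X ω ∂μ = 0) (hsq : ∫ ω, X ω ^ 2 ∂μ = 1) {ε : ℝ} (hε : 0 < ε) :
    ∃ (φ : ℝ → ℝ) (C : ℝ), Measurable φ ∧ (∀ s, |φ s| ≤ C) ∧ ∫ ω, φ (X ω) ∂μ = 0 ∧
      ∫ ω, φ (X ω) ^ 2 ∂μ = 1 ∧ ∫ ω, (X ω - φ (X ω)) ^ 2 ∂μ ≤ ε := by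
  have hX1 : Integrable X μ := h2.integrable one_le_two
  have hX2 : Integrable (fun ω => X ω ^ 2) μ := h2.integrable_sq
  have htm : ∀ c : ℝ, Measurable fun ω => truncate c (X ω) := fun c =>
    (measurable_truncate c).comp hm
  set a : ℕ → ℝ := fun c => ∫ ω, truncate c (X ω) ∂μ with ha
  set b : ℕ → ℝ := fun c => ∫ ω, truncate c (X ω) ^ 2 ∂μ with hb
  have hi1 : ∀ c : ℕ, Integrable (fun ω => truncate c (X ω)) μ := fun c =>
    hX1.mono (htm c).aestronglyMeasurable (Eventually.of_forall fun ω => abs_truncate_le _ _)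
  have hi2 : ∀ c : ℕ, Integrable (fun ω => truncate c (X ω) ^ 2) μ := fun c =>
    hX2.mono ((htm c).pow_const 2).aestronglyMeasurable (Eventually.of_forall fun ω => by
      simp only [norm_pow]
      exact pow_le_pow_left₀ (norm_nonneg _) (abs_truncate_le _ _) 2)
  have ha0 : Tendsto a atTop (𝓝 0) := by
    rw [← hmean]
    refine tendsto_integral_of_dominated_convergence (fun ω => |X ω|)
      (fun c => (htm c).aestronglyMeasurable) hX1.abs
      (fun c => Eventually.of_forall fun ω => abs_truncate_le _ _)
      (Eventually.of_forall fun ω => tendsto_truncate _)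
  have hb1 : Tendsto b atTop (𝓝 1) := by
    rw [← hsq]
    refine tendsto_integral_of_dominated_convergence (fun ω => X ω ^ 2)
      (fun c => ((htm c).pow_const 2).aestronglyMeasurable) hX2
      (fun c => Eventually.of_forall fun ω => ?_)
      (Eventually.of_forall fun ω => (tendsto_truncate _).pow 2)
    rw [Real.norm_eq_abs, abs_pow, ← sq_abs (X ω)]
    exact pow_le_pow_left₀ (abs_nonneg _) (abs_truncate_le _ _) 2
  set v : ℕ → ℝ := fun c => b c - a c ^ 2 with hv
  have hv1 : Tendsto (fun c => √(v c)) atTop (𝓝 1) := by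
    have : Tendsto v atTop (𝓝 1) := by simpa using hb1.sub (ha0.pow 2)
    simpa using this.sqrt
  set φ : ℕ → ℝ → ℝ := fun c s => (truncate c s - a c) / √(v c) with hφ
  have hφm : ∀ c, Measurable (φ c) := fun c => ((measurable_truncate c).sub_const _).div_const _
  have hlim : Tendsto (fun c => ∫ ω, (X ω - φ c (X ω)) ^ 2 ∂μ) atTop (𝓝 0) := by
    have hz : (0 : ℝ) = ∫ _, (0 : ℝ) ∂μ := by simp
    rw [hz]
    -- Once the truncated mean is below 1 and the standard deviation above 1/2, the difference is at
    -- most 3|X| + 2, whose square is at most the dominating function.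
    refine tendsto_integral_filter_of_dominated_convergence (fun ω => 18 * X ω ^ 2 + 8)
      (Eventually.of_forall fun c =>
        ((hm.sub ((hφm c).comp hm)).pow_const 2).aestronglyMeasurable) ?_
      ((hX2.const_mul 18).add (integrable_const 8)) (Eventually.of_forall fun ω => ?_)
    · filter_upwards [hv1.eventually_const_lt (show (1 / 2 : ℝ) < 1 by norm_num),
        ha0.abs.eventually_lt_const (show |(0 : ℝ)| < 1 by simp)] with c hc hc'
      refine Eventually.of_forall fun ω => ?_
      have h1 : |φ c (X ω)| ≤ 2 * (|X ω| + 1) := by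
        rw [hφ, abs_div, abs_of_nonneg (Real.sqrt_nonneg _), div_le_iff₀ (by linarith)]
        have : |truncate c (X ω) - a c| ≤ |X ω| + 1 :=
          (abs_sub _ _).trans (add_le_add (abs_truncate_le _ _) hc'.le)
        nlinarith [abs_nonneg (X ω)]
      have h3 : |X ω - φ c (X ω)| ≤ 3 * |X ω| + 2 := (abs_sub _ _).trans (by linarith)
      rw [Real.norm_eq_abs, abs_pow]
      calc |X ω - φ c (X ω)| ^ 2 ≤ (3 * |X ω| + 2) ^ 2 := by gcongr
        _ ≤ 18 * |X ω| ^ 2 + 8 := by nlinarith [sq_nonneg (3 * |X ω| - 2)]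
        _ = _ := by rw [sq_abs]
    · have h1 : Tendsto (fun c => φ c (X ω)) atTop (𝓝 ((X ω - 0) / 1)) :=
        ((tendsto_truncate (X ω)).sub ha0).div hv1 one_ne_zero
      simpa using ((tendsto_const_nhds (x := X ω)).sub h1).pow 2
  obtain ⟨c, hc, hc'⟩ := ((hv1.eventually_const_lt zero_lt_one).and
    (hlim.eventually_le_const hε)).exists
  have hvc : 0 < v c := Real.sqrt_pos.1 hc
  refine ⟨φ c, (c + |a c|) / √(v c), hφm c, fun s => ?_, ?_, ?_, hc'⟩
  · rw [hφ, abs_div, abs_of_nonneg (Real.sqrt_nonneg _)]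
    gcongr
    exact (abs_sub _ _).trans (by gcongr; exact abs_truncate_le_level (Nat.cast_nonneg c) s)
  · simp only [hφ]
    rw [integral_div, integral_sub (hi1 c) (integrable_const _)]
    simp [ha]
  · have h1 : ∀ ω, φ c (X ω) ^ 2 =
        (truncate c (X ω) ^ 2 - (2 * a c * truncate c (X ω) - a c ^ 2)) / v c := by
      intro ω
      rw [hφ, div_pow, Real.sq_sqrt hvc.le]
      ring
    simp_rw [h1]
    have hi3 : Integrable (fun ω => 2 * a c * truncate c (X ω) - a c ^ 2) μ :=
      ((hi1 c).const_mul _).sub (integrable_const _)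
    rw [integral_div, integral_sub (hi2 c) hi3, integral_sub ((hi1 c).const_mul _)
      (integrable_const _), integral_const_mul, div_eq_one_iff_eq hvc.ne']
    simp only [integral_const, probReal_univ, smul_eq_mul, one_mul, hv, ha, hb]
    ring

/-- The input can be approximated in `L²`, uniformly and label by label, by inputs with uniformly
bounded moments. -/
def IsApproximable {ι Ω : Type*} [MeasurableSpace Ω] (x : ι → Ω → ℝ) (μ : Measure Ω) : Prop :=
  ∀ ε > 0, ∃ φ : ι → ℝ → ℝ, (∀ t, Measurable (φ t)) ∧ InputA3 (fun t ω => φ t (x t ω)) μ ∧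
    ∀ t, ∫ ω, (x t ω - φ t (x t ω)) ^ 2 ∂μ ≤ ε

lemma InputA3.isApproximable {ι Ω : Type*} [MeasurableSpace Ω] {μ : Measure Ω} {x : ι → Ω → ℝ}
    (hx : InputA3 x μ) : IsApproximable x μ :=
  fun ε hε => ⟨fun _ s => s, fun _ => measurable_id, hx, fun t => by simpa using hε.le⟩

lemma InputA2.isApproximable {ι Ω : Type*} [MeasurableSpace Ω] {μ : Measure Ω}
    [IsProbabilityMeasure μ] {x : ι → Ω → ℝ} (hx : InputA2 x μ) : IsApproximable x μ := by
  intro ε hε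
  rcases isEmpty_or_nonempty ι with hι | ⟨⟨t₀⟩⟩
  · exact ⟨fun _ s => s, fun _ => measurable_id, ⟨hx.1, fun m => ⟨0, fun t => hι.elim t⟩⟩,
      fun t => hι.elim t⟩
  obtain ⟨hx, hid⟩ := hx
  obtain ⟨φ, C, hφ, hC, h0, h1, hle⟩ := exists_bounded_approximation (hx.measurable t₀)
    (hx.memLp t₀) (hx.mean t₀) (hx.integral_sq t₀) hε
  have hint : ∀ (F : ℝ → ℝ), Measurable F → ∀ t, ∫ ω, F (x t ω) ∂μ = ∫ ω, F (x t₀ ω) ∂μ :=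
    fun F hF t => ((hid t t₀).comp hF).integral_eq
  have hmeas : ∀ t, Measurable fun ω => φ (x t ω) := fun t => hφ.comp (hx.measurable t)
  have hmem : ∀ t, MemLp (fun ω => φ (x t ω)) 2 μ := fun t =>
    MemLp.of_bound (hmeas t).aestronglyMeasurable C (Eventually.of_forall fun ω => hC _)
  refine ⟨fun _ => φ, fun _ => hφ, InputA1.inputA3 ⟨⟨hmeas, ?_, hmem, fun t => ?_, fun t => ?_⟩,
    C, fun t => Eventually.of_forall fun ω => hC _⟩, fun t => ?_⟩
  · exact hx.indep.comp (fun _ => φ) fun _ => hφ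
  · rw [hint φ hφ, h0]
  · rw [variance_eq_sub (hmem t)]
    simp only [Pi.pow_apply]
    rw [hint (fun s => φ s ^ 2) (hφ.pow_const 2), hint φ hφ, h0, h1]
    norm_num
  · rw [hint (fun s => (s - φ s) ^ 2) ((measurable_id.sub hφ).pow_const 2)]
    exact hle

lemma IsStandardInput.integrable_sq {α Ω : Type*} [MeasurableSpace Ω] {μ : Measure Ω}
    {u : α → Ω → ℝ} (hu : IsStandardInput u μ) (a : α) : Integrable (fun ω => u a ω ^ 2) μ :=
  (hu.memLp a).integrable_sq

lemma indepFun_apply {ι κ Ω : Type*} [MeasurableSpace Ω] {μ : Measure Ω} {x : ι → Ω → ℝ}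
    {y : κ → Ω → ℝ} (hxy : IndepFun (fun ω t => x t ω) (fun ω s => y s ω) μ) (t : ι) (s : κ)
    {F G : ℝ → ℝ} (hF : Measurable F) (hG : Measurable G) :
    IndepFun (fun ω => F (x t ω)) (fun ω => G (y s ω)) μ :=
  hxy.comp (φ := fun f : ι → ℝ => F (f t)) (ψ := fun f : κ → ℝ => G (f s))
    (hF.comp (measurable_pi_apply t)) (hG.comp (measurable_pi_apply s))

lemma indepFun_pi_comp {ι κ Ω : Type*} [MeasurableSpace Ω] {μ : Measure Ω} {x : ι → Ω → ℝ}
    {y : κ → Ω → ℝ} (hxy : IndepFun (fun ω t => x t ω) (fun ω s => y s ω) μ) {φ : ι → ℝ → ℝ}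
    (hφ : ∀ t, Measurable (φ t)) {ψ : κ → ℝ → ℝ} (hψ : ∀ s, Measurable (ψ s)) :
    IndepFun (fun ω t => φ t (x t ω)) (fun ω s => ψ s (y s ω)) μ := by
  have h1 : Measurable fun (f : ι → ℝ) t => φ t (f t) :=
    measurable_pi_lambda _ fun t => (hφ t).comp (measurable_pi_apply t)
  have h2 : Measurable fun (f : κ → ℝ) t => ψ t (f t) :=
    measurable_pi_lambda _ fun t => (hψ t).comp (measurable_pi_apply t)
  exact hxy.comp h1 h2

/-- Write xy - x'y' = (x - x')y + x'(y - y'). The factors in each term are independent, and `y` and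
`x'` have second moment 1. -/
lemma integral_mul_sub_mul_sq_le {ι κ Ω : Type*} [MeasurableSpace Ω] {μ : Measure Ω}
    [IsProbabilityMeasure μ] {x : ι → Ω → ℝ} {y : κ → Ω → ℝ} (hx : IsStandardInput x μ)
    (hy : IsStandardInput y μ) (hxy : IndepFun (fun ω t => x t ω) (fun ω s => y s ω) μ)
    {φ : ι → ℝ → ℝ} (hφ : ∀ t, Measurable (φ t)) (hx' : IsStandardInput (fun t ω => φ t (x t ω)) μ)
    {ψ : κ → ℝ → ℝ} (hψ : ∀ s, Measurable (ψ s)) (hy' : IsStandardInput (fun s ω => ψ s (y s ω)) μ)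
    {ε : ℝ} (hφε : ∀ t, ∫ ω, (x t ω - φ t (x t ω)) ^ 2 ∂μ ≤ ε)
    (hψε : ∀ s, ∫ ω, (y s ω - ψ s (y s ω)) ^ 2 ∂μ ≤ ε) (t : ι) (s : κ) :
    Integrable (fun ω => (x t ω * y s ω - φ t (x t ω) * ψ s (y s ω)) ^ 2) μ ∧
      ∫ ω, (x t ω * y s ω - φ t (x t ω) * ψ s (y s ω)) ^ 2 ∂μ ≤ 4 * ε := by
  have h1 := indepFun_apply hxy t s (F := fun r => (r - φ t r) ^ 2) (G := fun r => r ^ 2)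
    ((measurable_id.sub (hφ t)).pow_const 2) (measurable_id.pow_const 2)
  have h2 := indepFun_apply hxy t s (F := fun r => φ t r ^ 2) (G := fun r => (r - ψ s r) ^ 2)
    ((hφ t).pow_const 2) ((measurable_id.sub (hψ s)).pow_const 2)
  have i1 : Integrable (fun ω => (x t ω - φ t (x t ω)) ^ 2) μ :=
    ((hx.memLp t).sub (hx'.memLp t)).integrable_sq
  have i2 : Integrable (fun ω => (y s ω - ψ s (y s ω)) ^ 2) μ :=
    ((hy.memLp s).sub (hy'.memLp s)).integrable_sq
  have j1 : Integrable (fun ω => (x t ω - φ t (x t ω)) ^ 2 * y s ω ^ 2) μ :=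
    h1.integrable_mul i1 (hy.integrable_sq s)
  have j2 : Integrable (fun ω => φ t (x t ω) ^ 2 * (y s ω - ψ s (y s ω)) ^ 2) μ :=
    h2.integrable_mul (hx'.integrable_sq t) i2
  have e1 := h1.integral_fun_mul_eq_mul_integral i1.1 (hy.integrable_sq s).1
  have e2 := h2.integral_fun_mul_eq_mul_integral (hx'.integrable_sq t).1 i2.1
  rw [hy.integral_sq, mul_one] at e1
  rw [hx'.integral_sq, one_mul] at e2
  have hle : ∀ ω, (x t ω * y s ω - φ t (x t ω) * ψ s (y s ω)) ^ 2 ≤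
      2 * ((x t ω - φ t (x t ω)) ^ 2 * y s ω ^ 2) +
        2 * (φ t (x t ω) ^ 2 * (y s ω - ψ s (y s ω)) ^ 2) := by
    intro ω
    nlinarith [sq_nonneg ((x t ω - φ t (x t ω)) * y s ω - φ t (x t ω) * (y s ω - ψ s (y s ω)))]
  have hj : Integrable (fun ω => 2 * ((x t ω - φ t (x t ω)) ^ 2 * y s ω ^ 2) +
      2 * (φ t (x t ω) ^ 2 * (y s ω - ψ s (y s ω)) ^ 2)) μ :=
    (j1.const_mul 2).add (j2.const_mul 2)
  have hint : Integrable (fun ω => (x t ω * y s ω - φ t (x t ω) * ψ s (y s ω)) ^ 2) μ := by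
    refine hj.mono' ((((hx.measurable t).mul (hy.measurable s)).sub
      ((hx'.measurable t).mul (hy'.measurable s))).pow_const 2).aestronglyMeasurable
      (Eventually.of_forall fun ω => ?_)
    rw [Real.norm_eq_abs, abs_of_nonneg (sq_nonneg _)]
    exact hle ω
  refine ⟨hint, (integral_mono hint hj hle).trans ?_⟩
  rw [integral_add (j1.const_mul 2) (j2.const_mul 2), integral_const_mul, integral_const_mul]
  rw [e1, e2]
  linarith [hφε t, hψε s]

/-! ## Convergence in probability -/

/-- The sum of `f` over the labels of all entries of the `n × n` matrices. -/
def cellSum {ι κ : Type*} (LX : SymLink ι) (LY : SymLink κ) (f : ι → κ → ℝ) (n : ℕ) : ℝ :=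
  ∑ i, ∑ j, f (LX.val n i j) (LY.val n i j)

lemma sum_sq_scaledProduct_sub {ι κ : Type*} (LX : SymLink ι) (LY : SymLink κ) (x x' : ι → ℝ)
    (y y' : κ → ℝ) (n : ℕ) : (∑ i, ∑ j, (scaledProduct LX LY x y n i j -
      scaledProduct LX LY x' y' n i j) ^ 2) / n =
      cellSum LX LY (fun t s => (x t * y s - x' t * y' s) ^ 2) n / (n : ℝ) ^ 2 := by
  simp only [scaledProduct, patternedMatrix, Matrix.smul_apply, Matrix.hadamard_apply,
    Matrix.of_apply, smul_eq_mul, ← mul_sub, mul_pow, inv_pow, Real.sq_sqrt (Nat.cast_nonneg n),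
    ← Finset.mul_sum, cellSum]
  rw [div_eq_mul_inv, div_eq_mul_inv, pow_two, mul_inv]
  ring

lemma measurable_productESD_Iic {ι κ Ω : Type*} [MeasurableSpace Ω] (LX : SymLink ι)
    (LY : SymLink κ) {x : ι → Ω → ℝ} {y : κ → Ω → ℝ} (hx : ∀ t, Measurable (x t))
    (hy : ∀ s, Measurable (y s)) (n : ℕ) (s : ℝ) :
    Measurable fun ω => (productESD LX LY x y n ω).real (Set.Iic s) := by
  refine measurable_esd_Iic (fun ω => scaledProduct_isHermitian LX LY _ _ n) (fun i j => ?_) s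
  simp only [scaledProduct, patternedMatrix, Matrix.smul_apply, Matrix.hadamard_apply,
    Matrix.of_apply, smul_eq_mul]
  exact ((hx _).mul (hy _)).const_mul _

lemma integral_cellSum_le {ι κ Ω : Type*} [MeasurableSpace Ω] {μ : Measure Ω} (LX : SymLink ι)
    (LY : SymLink κ) {f : ι → κ → Ω → ℝ} (hint : ∀ t s, Integrable (f t s) μ) {C : ℝ}
    (hC : ∀ t s, ∫ ω, f t s ω ∂μ ≤ C) (n : ℕ) :
    Integrable (fun ω => cellSum LX LY (fun t s => f t s ω) n) μ ∧
      ∫ ω, cellSum LX LY (fun t s => f t s ω) n ∂μ ≤ C * (n : ℝ) ^ 2 := by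
  simp only [cellSum]
  refine ⟨integrable_finsetSum _ fun i _ => integrable_finsetSum _ fun j _ => hint _ _, ?_⟩
  rw [integral_finsetSum _ fun i _ => integrable_finsetSum _ fun j _ => hint _ _]
  simp_rw [integral_finsetSum _ fun j _ => hint _ _]
  calc _ ≤ ∑ _i : Fin n, ∑ _j : Fin n, C := by
        gcongr
        exact hC _ _
    _ = _ := by
        simp only [Finset.sum_const, Finset.card_univ, Fintype.card_fin, nsmul_eq_mul]
        ring

lemma abs_sub_lt_of_sandwich {F : ℝ → ℝ} {s δ η p q r e : ℝ} (h1 : |F (s - δ) - F s| < η)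
    (h2 : |F (s + δ) - F s| < η) (h3 : |q - F (s - δ)| < η) (h4 : |r - F (s + δ)| < η) (he : e < η)
    (h5 : q ≤ p + e) (h6 : p ≤ r + e) : |p - F s| < 3 * η := by
  rw [abs_lt] at *
  constructor <;> linarith [h1.1, h1.2, h2.1, h2.2, h3.1, h3.2, h4.1, h4.2]

lemma exists_pos_abs_sub_lt {F : ℝ → ℝ} {s η : ℝ} (hF : ContinuousAt F s) (hη : 0 < η) :
    ∃ δ > 0, |F (s - δ) - F s| < η ∧ |F (s + δ) - F s| < η := by
  obtain ⟨δ, hδ, h⟩ := Metric.continuousAt_iff.1 hF η hη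
  refine ⟨δ / 2, half_pos hδ, h ?_, h ?_⟩
  · rw [Real.dist_eq, sub_sub_cancel_left, abs_neg, abs_of_pos (half_pos hδ)]
    linarith
  · rw [Real.dist_eq, add_sub_cancel_left, abs_of_pos (half_pos hδ)]
    linarith

/-- The normalized Frobenius error has mean at most 4ε whatever the dependence between entries, so
Markov's inequality bounds it in probability. The distribution function at `s` is then caught
between those of the approximating matrix at `s - δ` and `s + δ`. -/
theorem isLimitInProbability_of_isApproximable {ι κ Ω : Type*} {LX : SymLink ι} {LY : SymLink κ}
    (hX : LX.PropertyB) (hY : LY.PropertyB) (hc : Compatible LX LY) (hw : LeadsToWigner LX LY)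
    [MeasurableSpace Ω] {μ : Measure Ω} [IsProbabilityMeasure μ] {x : ι → Ω → ℝ} {y : κ → Ω → ℝ}
    (hx : IsStandardInput x μ) (hy : IsStandardInput y μ) (hxa : IsApproximable x μ)
    (hya : IsApproximable y μ) (hxy : IndepFun (fun ω t => x t ω) (fun ω s => y s ω) μ) :
    IsLimitInProbability μ (productESD LX LY x y) semicircleLaw := by
  intro s hs
  set F : ℝ → ℝ := fun r => semicircleLaw.real (Set.Iic r) with hF
  rw [tendstoInMeasure_iff_measureReal_dist]
  intro η' hη'
  obtain ⟨η, hη, rfl⟩ : ∃ η > 0, η' = 3 * η := ⟨η' / 3, by positivity, by ring⟩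
  obtain ⟨δ, hδ, hδ1, hδ2⟩ := exists_pos_abs_sub_lt hs hη
  rw [Metric.tendsto_atTop]
  intro θ hθ
  -- Chosen so that Markov's bound `4 * ε / (η * δ) ^ 2` equals `θ / 3`.
  set ε : ℝ := θ / 3 * (η * δ) ^ 2 / 4 with hε
  have hε0 : 0 < ε := by positivity
  obtain ⟨φ, hφ, hφ3, hφε⟩ := hxa ε hε0
  obtain ⟨ψ, hψ, hψ3, hψε⟩ := hya ε hε0
  set x' : ι → Ω → ℝ := fun t ω => φ t (x t ω) with hx'
  set y' : κ → Ω → ℝ := fun t ω => ψ t (y t ω) with hy'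
  have hxy' : IndepFun (fun ω t => x' t ω) (fun ω s => y' s ω) μ := indepFun_pi_comp hxy hφ hψ
  have hae := isLimitAlmostSurely_of_inputA3 hX hY hc hw hφ3 hψ3 hxy'
  have hprob : ∀ r, ∀ᶠ n in atTop,
      μ.real {ω | η ≤ dist ((productESD LX LY x' y' n ω).real (Set.Iic r)) (F r)} < θ / 3 := by
    intro r
    have := tendstoInMeasure_of_tendsto_ae (μ := μ) (fun n =>
      (measurable_productESD_Iic LX LY hφ3.1.measurable hψ3.1.measurable n r).aestronglyMeasurable)
      (hae.mono fun ω hω => hω r)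
    rw [tendstoInMeasure_iff_measureReal_dist] at this
    exact (this η hη).eventually_lt_const (by positivity)
  set T : ℕ → Ω → ℝ := fun n ω => cellSum LX LY
    (fun t s => (x t ω * y s ω - x' t ω * y' s ω) ^ 2) n / (n : ℝ) ^ 2 with hT
  have herr : ∀ t s, Integrable (fun ω => (x t ω * y s ω - x' t ω * y' s ω) ^ 2) μ ∧
      ∫ ω, (x t ω * y s ω - x' t ω * y' s ω) ^ 2 ∂μ ≤ 4 * ε := fun t s =>
    integral_mul_sub_mul_sq_le hx hy hxy hφ hφ3.1 hψ hψ3.1 hφε hψε t s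
  have hTprob : ∀ n > 0, μ.real {ω | (η * δ) ^ 2 ≤ T n ω} ≤ θ / 3 := by
    intro n hn
    have h1 := integral_cellSum_le LX LY (fun t s => (herr t s).1) (fun t s => (herr t s).2) n
    have hT0 : ∀ ω, 0 ≤ T n ω := fun ω => div_nonneg
      (Finset.sum_nonneg fun i _ => Finset.sum_nonneg fun j _ => sq_nonneg _) (by positivity)
    have h2 := mul_meas_ge_le_integral_of_nonneg (μ := μ) (f := T n) (Eventually.of_forall hT0)
      (h1.1.div_const _) ((η * δ) ^ 2)
    have h3 : ∫ ω, T n ω ∂μ ≤ 4 * ε := by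
      simp only [hT]
      rw [integral_div, div_le_iff₀ (by positivity)]
      exact h1.2
    have h4 : (η * δ) ^ 2 * μ.real {ω | (η * δ) ^ 2 ≤ T n ω} ≤ (η * δ) ^ 2 * (θ / 3) := by
      refine h2.trans (h3.trans (le_of_eq ?_))
      rw [hε]
      ring
    exact le_of_mul_le_mul_left h4 (by positivity)
  have hev := ((hprob (s - δ)).and (hprob (s + δ))).and (eventually_gt_atTop 0)
  obtain ⟨N, hN⟩ := eventually_atTop.1 hev
  refine ⟨N, fun n hn => ?_⟩
  obtain ⟨⟨h1, h2⟩, hn0⟩ := hN n hn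
  rw [Real.dist_eq, sub_zero, abs_of_nonneg measureReal_nonneg]
  refine lt_of_le_of_lt (measureReal_mono (s₂ := ({ω | η ≤ dist
    ((productESD LX LY x' y' n ω).real (Set.Iic (s - δ))) (F (s - δ))} ∪ {ω | η ≤ dist
    ((productESD LX LY x' y' n ω).real (Set.Iic (s + δ))) (F (s + δ))}) ∪
    {ω | (η * δ) ^ 2 ≤ T n ω}) ?_) ?_
  · intro ω hω
    by_contra hnot
    simp only [Set.mem_union, Set.mem_ofPred_eq, not_or, not_le, Real.dist_eq] at hnot hω
    obtain ⟨⟨g1, g2⟩, g3⟩ := hnot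
    have he : δ⁻¹ * √(T n ω) < η := by
      rw [inv_mul_lt_iff₀ hδ, mul_comm δ, Real.sqrt_lt' (by positivity)]
      exact g3
    have k1 := esd_Iic_le_of_sum_sq
      (scaledProduct_isHermitian LX LY (fun t => x' t ω) (fun s => y' s ω) n)
      (scaledProduct_isHermitian LX LY (fun t => x t ω) (fun s => y s ω) n) (s - δ) hδ
    have k2 := esd_Iic_le_of_sum_sq
      (scaledProduct_isHermitian LX LY (fun t => x t ω) (fun s => y s ω) n)
      (scaledProduct_isHermitian LX LY (fun t => x' t ω) (fun s => y' s ω) n) s hδ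
    simp_rw [sub_sq_comm (scaledProduct LX LY (fun t => x' t ω) (fun s => y' s ω) n _ _)] at k1
    rw [sum_sq_scaledProduct_sub] at k1 k2
    rw [sub_add_cancel] at k1
    exact hω.not_gt (abs_sub_lt_of_sandwich hδ1 hδ2 g1 g2 he k1 k2)
  · refine (measureReal_union_le _ _).trans_lt ?_
    have := measureReal_union_le (μ := μ) {ω | η ≤ dist
      ((productESD LX LY x' y' n ω).real (Set.Iic (s - δ))) (F (s - δ))} {ω | η ≤ dist
      ((productESD LX LY x' y' n ω).real (Set.Iic (s + δ))) (F (s + δ))}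
    linarith [hTprob n hn0]

end SchurHadamard

namespace SchurHadamard

/-! ## Dyadic tail bounds -/

lemma integrable_ite_one {Ω : Type*} [MeasurableSpace Ω] {μ : Measure Ω} [IsProbabilityMeasure μ]
    {f : Ω → ℝ} (hf : Measurable f) (a : ℝ) :
    Integrable (fun ω => if a < f ω then (1 : ℝ) else 0) μ ∧
      ∫ ω, (if a < f ω then (1 : ℝ) else 0) ∂μ = μ.real {ω | a < f ω} := by
  have hs : MeasurableSet {ω | a < f ω} := measurableSet_lt measurable_const hf
  have h : (fun ω => if a < f ω then (1 : ℝ) else 0) = {ω | a < f ω}.indicator fun _ => 1 := by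
    ext ω
    simp [Set.indicator_apply]
  rw [h]
  exact ⟨(integrable_const 1).indicator hs, by simp [integral_indicator_const _ hs]⟩

/-- A uniform bound for the tails of the squares at powers of `2`, summable against `2 ^ j`. -/
def HasSummableTail {ι Ω : Type*} [MeasurableSpace Ω] (x : ι → Ω → ℝ) (μ : Measure Ω) : Prop :=
  ∃ g : ℕ → ℝ, (∀ j, 0 ≤ g j) ∧ (Summable fun j => 2 ^ j * g j) ∧
    ∀ t j, μ.real {ω | 2 ^ j < x t ω ^ 2} ≤ g j

lemma sum_two_pow_ite_le {a : ℝ} (ha : 0 ≤ a) (J : ℕ) :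
    ∑ j ∈ Finset.range J, (2 : ℝ) ^ j * (if 2 ^ j < a then 1 else 0) ≤ 2 * a := by
  induction J with
  | zero => simpa using ha
  | succ J ih =>
    rw [Finset.sum_range_succ]
    split_ifs with h
    · have h1 : ∑ j ∈ Finset.range J, (2 : ℝ) ^ j * (if 2 ^ j < a then 1 else 0) ≤
          ∑ j ∈ Finset.range J, (2 : ℝ) ^ j := by
        gcongr with j
        split_ifs <;> simp
      rw [geom_sum_eq (by norm_num)] at h1
      linarith
    · simpa using ih

lemma InputA2.hasSummableTail {ι Ω : Type*} [MeasurableSpace Ω] {μ : Measure Ω}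
    [IsProbabilityMeasure μ] {x : ι → Ω → ℝ} (hx : InputA2 x μ) : HasSummableTail x μ := by
  rcases isEmpty_or_nonempty ι with hι | ⟨⟨t₀⟩⟩
  · exact ⟨0, fun _ => le_rfl, by simp, fun t => hι.elim t⟩
  obtain ⟨hx, hid⟩ := hx
  have hsq : Measurable fun ω => x t₀ ω ^ 2 := (hx.measurable t₀).pow_const 2
  refine ⟨fun j => μ.real {ω | 2 ^ j < x t₀ ω ^ 2}, fun _ => measureReal_nonneg, ?_,
    fun t j => le_of_eq ?_⟩
  · refine summable_of_sum_range_le (c := 2) (fun j => by positivity) fun J => ?_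
    have h1 : ∀ j, Integrable (fun ω => (2 : ℝ) ^ j * (if 2 ^ j < x t₀ ω ^ 2 then 1 else 0)) μ :=
      fun j => (integrable_ite_one hsq _).1.const_mul _
    calc _ = ∫ ω, ∑ j ∈ Finset.range J, (2 : ℝ) ^ j * (if 2 ^ j < x t₀ ω ^ 2 then 1 else 0) ∂μ := by
          rw [integral_finsetSum _ fun j _ => h1 j]
          simp_rw [integral_const_mul, (integrable_ite_one hsq _).2]
      _ ≤ ∫ ω, 2 * x t₀ ω ^ 2 ∂μ :=
          integral_mono (integrable_finsetSum _ fun j _ => h1 j)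
            ((hx.integrable_sq t₀).const_mul 2) fun ω => sum_two_pow_ite_le (sq_nonneg _) J
      _ = 2 := by rw [integral_const_mul, hx.integral_sq, mul_one]
  · have h := ((hid t t₀).comp (measurable_id.pow_const 2)).measure_mem_eq
      (measurableSet_Ioi (a := (2 : ℝ) ^ j))
    exact congrArg ENNReal.toReal h

lemma InputA3.hasSummableTail {ι Ω : Type*} [MeasurableSpace Ω] {μ : Measure Ω}
    [IsProbabilityMeasure μ] {x : ι → Ω → ℝ} (hx : InputA3 x μ) : HasSummableTail x μ := by
  obtain ⟨C, hC⟩ := hx.2 4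
  refine ⟨fun j => max C 0 / 4 ^ j, fun j => by positivity, ?_, fun t j => ?_⟩
  · refine (summable_geometric_two.mul_left (max C 0)).congr fun j => ?_
    change _ = 2 ^ j * (max C 0 / 4 ^ j)
    rw [show (4 : ℝ) = 2 * 2 by norm_num, mul_pow, one_div, inv_pow]
    field_simp
  · rw [le_div_iff₀ (by positivity), mul_comm]
    have h1 := mul_meas_ge_le_integral_of_nonneg (μ := μ) (f := fun ω => |x t ω| ^ 4)
      (Eventually.of_forall fun ω => by positivity) (hC t).1 (4 ^ j)
    refine le_trans ?_ (h1.trans ((hC t).2.trans (le_max_left _ _)))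
    gcongr
    · exact measure_ne_top _ _
    · intro h
      rw [show (4 : ℝ) = 2 ^ 2 by norm_num, ← pow_mul, mul_comm 2 j, pow_mul,
        show ∀ z : ℝ, |z| ^ 4 = (z ^ 2) ^ 2 by intro z; rw [← sq_abs z]; ring]
      gcongr

lemma summable_convolution {f g : ℕ → ℝ} (hf0 : ∀ j, 0 ≤ f j) (hg0 : ∀ j, 0 ≤ g j)
    (hf : Summable f) (hg : Summable g) :
    Summable fun n => ∑ l ∈ Finset.range (n + 1), f l * g (n - l) := by
  refine summable_sum_mul_range_of_summable_norm' ?_ hf ?_ hg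
  · simpa [abs_of_nonneg (hf0 _)] using hf
  · simpa [abs_of_nonneg (hg0 _)] using hg

/-- Take `l + 1` as the least exponent with `b ≤ 2 ^ (l + 1)`; the lower bound on the product then
forces `a` above `2 ^ (j - 1 - l)`. -/
lemma exists_dyadic_of_lt_mul {a b : ℝ} (ha : 0 ≤ a) {j : ℕ} (hab : 2 ^ j < a * b)
    (haj : a ≤ 2 ^ j) (hbj : b ≤ 2 ^ j) : ∃ l < j, 2 ^ l < b ∧ 2 ^ (j - 1 - l) < a := by
  have hex : ∃ m : ℕ, b ≤ 2 ^ m := ⟨j, hbj⟩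
  obtain ⟨m, hm, hmin⟩ : ∃ m : ℕ, b ≤ 2 ^ m ∧ ∀ m' < m, ¬ b ≤ 2 ^ m' :=
    ⟨Nat.find hex, Nat.find_spec hex, fun _ h => Nat.find_min hex h⟩
  have hmj : m ≤ j := not_lt.1 fun h => hmin j h hbj
  obtain - | l := m
  · rw [pow_zero] at hm
    nlinarith
  · refine ⟨l, hmj, not_le.1 (hmin l (Nat.lt_succ_self l)), ?_⟩
    by_contra hle
    rw [not_lt] at hle
    have : a * b ≤ 2 ^ (j - 1 - l) * 2 ^ (l + 1) :=
      (mul_le_mul_of_nonneg_left hm ha).trans (mul_le_mul_of_nonneg_right hle (by positivity))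
    rw [← pow_add, show j - 1 - l + (l + 1) = j by omega] at this
    linarith

/-- By independence the tail of a product is bounded by the two tails and their convolution. The
weights `2 ^ j` are multiplicative, so summability is that of a Cauchy product. -/
lemma HasSummableTail.mul {ι κ Ω : Type*} [MeasurableSpace Ω] {μ : Measure Ω}
    [IsProbabilityMeasure μ] {x : ι → Ω → ℝ} {y : κ → Ω → ℝ} (hx : HasSummableTail x μ)
    (hy : HasSummableTail y μ) (hxy : IndepFun (fun ω t => x t ω) (fun ω s => y s ω) μ) :
    HasSummableTail (fun (q : ι × κ) ω => x q.1 ω * y q.2 ω) μ := by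
  obtain ⟨g, hg0, hg, hgx⟩ := hx
  obtain ⟨k, hk0, hk, hky⟩ := hy
  refine ⟨fun j => g j + k j + ∑ l ∈ Finset.range j, k l * g (j - 1 - l), fun j => ?_, ?_, ?_⟩
  · have := Finset.sum_nonneg fun l (_ : l ∈ Finset.range j) => mul_nonneg (hk0 l) (hg0 (j - 1 - l))
    linarith [hg0 j, hk0 j]
  · have h1 : Summable fun j => 2 ^ j * ∑ l ∈ Finset.range j, k l * g (j - 1 - l) := by
      rw [← summable_nat_add_iff 1]
      refine ((summable_convolution (fun j => mul_nonneg (by positivity) (hk0 j))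
        (fun j => mul_nonneg (by positivity) (hg0 j)) hk hg).mul_left 2).congr fun j => ?_
      rw [Finset.mul_sum, Finset.mul_sum]
      refine Finset.sum_congr rfl fun l hl => ?_
      have hlj : l ≤ j := Nat.lt_succ_iff.1 (Finset.mem_range.1 hl)
      rw [Nat.add_sub_cancel, pow_succ]
      nth_rewrite 3 [← Nat.add_sub_cancel' hlj]
      rw [pow_add]
      ring
    refine ((hg.add hk).add h1).congr fun j => ?_
    ring
  · rintro ⟨t, s⟩ j
    have hsub : {ω | 2 ^ j < (x t ω * y s ω) ^ 2} ⊆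
        ({ω | 2 ^ j < x t ω ^ 2} ∪ {ω | 2 ^ j < y s ω ^ 2}) ∪
        ⋃ l ∈ Finset.range j, ({ω | 2 ^ l < y s ω ^ 2} ∩ {ω | 2 ^ (j - 1 - l) < x t ω ^ 2}) := by
      intro ω hω
      simp only [Set.mem_union, Set.mem_iUnion, Finset.mem_range, Set.mem_inter_iff,
        Set.mem_ofPred_eq, exists_prop] at hω ⊢
      by_contra! hnot
      rw [mul_pow] at hω
      obtain ⟨l, hl, h1, h2⟩ := exists_dyadic_of_lt_mul (sq_nonneg _) hω hnot.1.1 hnot.1.2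
      exact (hnot.2 l hl h1).not_gt h2
    refine (measureReal_mono hsub).trans ((measureReal_union_le _ _).trans (add_le_add
      ((measureReal_union_le _ _).trans (add_le_add (hgx t j) (hky s j)))
      ((measureReal_biUnion_finset_le _ _).trans (Finset.sum_le_sum fun l _ => ?_))))
    have hind := indepFun_apply hxy t s (F := fun r => r ^ 2) (G := fun r => r ^ 2)
      (measurable_id.pow_const 2) (measurable_id.pow_const 2)
    have h1 := hind.symm.measure_inter_preimage_eq_mul (Set.Ioi (2 ^ l)) (Set.Ioi (2 ^ (j - 1 - l)))
      measurableSet_Ioi measurableSet_Ioi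
    calc _ = μ.real {ω | 2 ^ l < y s ω ^ 2} * μ.real {ω | 2 ^ (j - 1 - l) < x t ω ^ 2} := by
          rw [measureReal_def, measureReal_def, measureReal_def, ← ENNReal.toReal_mul]
          exact congrArg ENNReal.toReal h1
      _ ≤ _ := mul_le_mul (hky s l) (hgx t _) measureReal_nonneg (hk0 l)

/-- On the layer between `2 ^ l` and `2 ^ (l + 1)` the square is at most `4 ^ (l + 1)`; the summand
1 covers values up to 1. -/
lemma ite_sq_le_sum {a : ℝ} (ha : 0 ≤ a) (J : ℕ) : (if a ≤ 2 ^ J then a ^ 2 else 0) ≤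
    1 + ∑ l ∈ Finset.range J, (4 : ℝ) ^ (l + 1) * (if 2 ^ l < a then 1 else 0) := by
  induction J with
  | zero =>
    split_ifs with h
    · simp only [pow_zero, Finset.range_zero, Finset.sum_empty, add_zero] at h ⊢
      nlinarith
    · simp
  | succ J ih =>
    have hnn : 0 ≤ ∑ l ∈ Finset.range J, (4 : ℝ) ^ (l + 1) * (if 2 ^ l < a then 1 else 0) :=
      Finset.sum_nonneg fun l _ => by positivity
    rw [Finset.sum_range_succ]
    by_cases h1 : a ≤ 2 ^ J
    · rw [if_pos h1] at ih
      rw [if_pos (h1.trans (by gcongr <;> norm_num)), if_neg h1.not_gt]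
      linarith
    · rw [if_pos (not_le.1 h1)]
      split_ifs with h2
      · have : a ^ 2 ≤ 4 ^ (J + 1) := by
          rw [show (4 : ℝ) = 2 ^ 2 by norm_num, ← pow_mul, mul_comm, pow_mul]
          gcongr
        linarith
      · positivity

lemma integral_ite_sq_le {Ω : Type*} [MeasurableSpace Ω] {μ : Measure Ω} [IsProbabilityMeasure μ]
    {Z : Ω → ℝ} (hZ : Measurable Z) {G : ℕ → ℝ} (hG : ∀ j, μ.real {ω | 2 ^ j < Z ω ^ 2} ≤ G j)
    (J : ℕ) : Integrable (fun ω => if Z ω ^ 2 ≤ 2 ^ J then (Z ω ^ 2) ^ 2 else 0) μ ∧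
      ∫ ω, (if Z ω ^ 2 ≤ 2 ^ J then (Z ω ^ 2) ^ 2 else 0) ∂μ ≤
        1 + ∑ l ∈ Finset.range J, 4 ^ (l + 1) * G l := by
  have hsq : Measurable fun ω => Z ω ^ 2 := hZ.pow_const 2
  have h1 : ∀ l, Integrable (fun ω => (4 : ℝ) ^ (l + 1) * (if 2 ^ l < Z ω ^ 2 then 1 else 0)) μ :=
    fun l => (integrable_ite_one hsq _).1.const_mul _
  have h2 : Integrable (fun ω => 1 + ∑ l ∈ Finset.range J,
      (4 : ℝ) ^ (l + 1) * (if 2 ^ l < Z ω ^ 2 then 1 else 0)) μ :=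
    (integrable_const 1).add (integrable_finsetSum _ fun l _ => h1 l)
  have h3 : Integrable (fun ω => if Z ω ^ 2 ≤ 2 ^ J then (Z ω ^ 2) ^ 2 else 0) μ := by
    refine h2.mono' (Measurable.ite (measurableSet_le hsq measurable_const) (hsq.pow_const 2)
      measurable_const).aestronglyMeasurable (Eventually.of_forall fun ω => ?_)
    rw [Real.norm_eq_abs, abs_of_nonneg (by positivity)]
    exact ite_sq_le_sum (sq_nonneg _) J
  refine ⟨h3, (integral_mono h3 h2 fun ω => ite_sq_le_sum (sq_nonneg _) J).trans ?_⟩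
  rw [integral_add (integrable_const 1) (integrable_finsetSum _ fun l _ => h1 l),
    integral_finsetSum _ fun l _ => h1 l]
  simp_rw [integral_const_mul, (integrable_ite_one hsq _).2]
  simp only [integral_const, probReal_univ, smul_eq_mul, mul_one]
  gcongr with l
  exact hG l

/-! ## The variance of sums over all entries -/

lemma covariance_le_of_integral_sq_le {Ω : Type*} [MeasurableSpace Ω] {μ : Measure Ω}
    [IsProbabilityMeasure μ] {X Y : Ω → ℝ} (hX : MemLp X 2 μ) (hY : MemLp Y 2 μ) {C : ℝ}
    (hXC : ∫ ω, X ω ^ 2 ∂μ ≤ C) (hYC : ∫ ω, Y ω ^ 2 ∂μ ≤ C) : cov[X, Y; μ] ≤ C := by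
  have h1 := variance_sub hX hY
  have h2 := variance_nonneg (X - Y) μ
  have h3 := variance_le_expectation_sq (μ := μ) hX.1
  have h4 := variance_le_expectation_sq (μ := μ) hY.1
  simp only [Pi.pow_apply] at h3 h4
  linarith

/-- An entry can be correlated only with entries that share one of its two labels. Property B allows
at most `2 * D` of these in a row, so each of the n² entries meets at most `2 * D * n` others. -/
lemma variance_cellSum_le {ι κ Ω : Type*} [MeasurableSpace Ω] {μ : Measure Ω}
    [IsProbabilityMeasure μ] {LX : SymLink ι} {LY : SymLink κ} {D n : ℕ}
    (hX : RowBound D (LX.val n)) (hY : RowBound D (LY.val n)) {f : ι → κ → Ω → ℝ}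
    (hf : ∀ t s, MemLp (f t s) 2 μ) {C : ℝ} (hC0 : 0 ≤ C) (hC : ∀ t s, ∫ ω, f t s ω ^ 2 ∂μ ≤ C)
    (hind : ∀ t t' s s', t ≠ t' → s ≠ s' → IndepFun (f t s) (f t' s') μ) :
    variance (fun ω => cellSum LX LY (fun t s => f t s ω) n) μ ≤ 2 * D * (n : ℝ) ^ 3 * C := by
  classical
  set F : Fin n × Fin n → Ω → ℝ := fun q => f (LX.val n q.1 q.2) (LY.val n q.1 q.2) with hF
  have h1 : (fun ω => cellSum LX LY (fun t s => f t s ω) n) = fun ω => ∑ q, F q ω := by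
    ext ω
    rw [cellSum, Fintype.sum_prod_type]
  set dep : Fin n × Fin n → Fin n × Fin n → Prop := fun q q' =>
    LX.val n q'.1 q'.2 = LX.val n q.1 q.2 ∨ LY.val n q'.1 q'.2 = LY.val n q.1 q.2 with hdep
  have h2 : ∀ q q', cov[F q, F q'; μ] ≤ if dep q q' then C else 0 := by
    intro q q'
    split_ifs with h
    · exact covariance_le_of_integral_sq_le (hf _ _) (hf _ _) (hC _ _) (hC _ _)
    · simp only [hdep, not_or] at h
      exact ((hind _ _ _ _ (Ne.symm h.1) (Ne.symm h.2)).covariance_eq_zero (hf _ _) (hf _ _)).le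
  have h3 : ∀ q, ((Finset.univ.filter (dep q)).card : ℝ) ≤ 2 * D * n := by
    intro q
    have : (Finset.univ.filter (dep q)).card ≤ (2 * D) * (Finset.univ : Finset (Fin n)).card := by
      refine Finset.card_le_mul_card_image_of_maps_to (f := Prod.fst) (fun _ _ => Finset.mem_univ _)
        (2 * D) fun i _ => ?_
      have hsub : ((Finset.univ.filter (dep q)).filter fun q' => q'.1 = i) ⊆
          ((Finset.univ.filter fun j => LX.val n i j = LX.val n q.1 q.2) ∪
            Finset.univ.filter fun j => LY.val n i j = LY.val n q.1 q.2).image (Prod.mk i) := by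
        rintro ⟨i', j'⟩ h
        simp only [Finset.mem_filter, Finset.mem_univ, true_and, hdep] at h
        obtain ⟨h, rfl⟩ := h
        simpa using h
      refine (Finset.card_le_card hsub).trans (Finset.card_image_le.trans
        ((Finset.card_union_le _ _).trans ?_))
      have e1 := hX.ncard_le (LX.val n q.1 q.2) i
      have e2 := hY.ncard_le (LY.val n q.1 q.2) i
      rw [Set.ncard_eq_toFinset_card', Set.toFinset_ofPred] at e1 e2
      omega
    rw [Finset.card_univ, Fintype.card_fin] at this
    exact_mod_cast this
  rw [h1, variance_fun_sum fun q => hf _ _]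
  calc _ ≤ ∑ q : Fin n × Fin n, ∑ q', if dep q q' then C else 0 :=
        Finset.sum_le_sum fun q _ => Finset.sum_le_sum fun q' _ => h2 q q'
    _ ≤ ∑ _q : Fin n × Fin n, 2 * D * n * C := by
        refine Finset.sum_le_sum fun q _ => ?_
        rw [← Finset.sum_filter, Finset.sum_const, nsmul_eq_mul]
        exact mul_le_mul_of_nonneg_right (h3 q) hC0
    _ = _ := by
        simp only [Finset.sum_const, Finset.card_univ, Fintype.card_prod, Fintype.card_fin,
          nsmul_eq_mul, Nat.cast_mul]
        ring

end SchurHadamard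

namespace SchurHadamard

/-! ## Almost sure convergence for consistent link functions -/

lemma sum_castLE_le {n N : ℕ} (h : n ≤ N) {g : Fin N → ℝ} (hg : ∀ j, 0 ≤ g j) :
    ∑ j : Fin n, g (Fin.castLE h j) ≤ ∑ j, g j := by
  rw [← Finset.sum_image (f := g) (g := Fin.castLE h) fun a _ b _ hab => Fin.castLE_injective h hab]
  exact Finset.sum_le_univ_sum_of_nonneg hg

/-- The smaller matrix is a corner of the larger one. This reduces almost sure statements about all
sizes to dyadic sizes. -/
lemma cellSum_mono_of_consistent {ι κ : Type*} {LX : SymLink ι} {LY : SymLink κ}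
    (hX : LX.Consistent) (hY : LY.Consistent) {f : ι → κ → ℝ} (hf : ∀ t s, 0 ≤ f t s) {n N : ℕ}
    (h : n ≤ N) : cellSum LX LY f n ≤ cellSum LX LY f N := by
  simp only [cellSum, ← hX n N h, ← hY n N h]
  refine le_trans ?_ (sum_castLE_le h fun i => Finset.sum_nonneg fun j _ => hf _ _)
  exact Finset.sum_le_sum fun i _ =>
    sum_castLE_le h (g := fun j => f (LX.val N (Fin.castLE h i) j) (LY.val N (Fin.castLE h i) j))
      fun j => hf _ _

lemma cellSum_le_cellSum {ι κ : Type*} (LX : SymLink ι) (LY : SymLink κ) {f g : ι → κ → ℝ}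
    (hfg : ∀ t s, f t s ≤ g t s) (n : ℕ) : cellSum LX LY f n ≤ cellSum LX LY g n :=
  Finset.sum_le_sum fun _ _ => Finset.sum_le_sum fun _ _ => hfg _ _

lemma cellSum_nonneg {ι κ : Type*} (LX : SymLink ι) (LY : SymLink κ) {f : ι → κ → ℝ}
    (hf : ∀ t s, 0 ≤ f t s) (n : ℕ) : 0 ≤ cellSum LX LY f n :=
  Finset.sum_nonneg fun _ _ => Finset.sum_nonneg fun _ _ => hf _ _

lemma tendsto_log_two_atTop : Tendsto (Nat.log 2) atTop atTop :=
  tendsto_atTop_atTop.2 fun b => ⟨2 ^ b, fun _ hn => Nat.le_log_of_pow_le one_lt_two hn⟩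

lemma two_pow_log_le {n : ℕ} (hn : 0 < n) : (2 : ℝ) ^ Nat.log 2 n ≤ n := by
  exact_mod_cast Nat.pow_log_le_self 2 hn.ne'

lemma le_two_pow_log_succ (n : ℕ) : n ≤ 2 ^ (Nat.log 2 n + 1) :=
  (Nat.lt_pow_succ_log_self one_lt_two n).le

/-- For `n` between 2^j and 2^(j+1) the count is at most the number of entries in the matrix of size
2^(j+1) whose square exceeds 2^j. Its mean is at most 4^(j+1) G_j, and after division by 2^j this is
summable. -/
lemma ae_tendsto_card_large {ι κ Ω : Type*} [MeasurableSpace Ω] {μ : Measure Ω}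
    [IsProbabilityMeasure μ] {LX : SymLink ι} {LY : SymLink κ} (hX : LX.Consistent)
    (hY : LY.Consistent) {z : ι × κ → Ω → ℝ} (hz : ∀ q, Measurable (z q))
    (htail : HasSummableTail z μ) :
    ∀ᵐ ω ∂μ, Tendsto (fun n : ℕ =>
      cellSum LX LY (fun t s => if (n : ℝ) < z (t, s) ω ^ 2 then 1 else 0) n / n) atTop (𝓝 0) := by
  obtain ⟨G, hG0, hG, hGz⟩ := htail
  set V : ℕ → Ω → ℝ := fun j ω =>
    cellSum LX LY (fun t s => if (2 : ℝ) ^ j < z (t, s) ω ^ 2 then 1 else 0) (2 ^ (j + 1)) / 2 ^ j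
    with hV
  have h1 : ∀ j t s, Integrable (fun ω => if (2 : ℝ) ^ j < z (t, s) ω ^ 2 then (1 : ℝ) else 0) μ ∧
      ∫ ω, (if (2 : ℝ) ^ j < z (t, s) ω ^ 2 then (1 : ℝ) else 0) ∂μ ≤ G j := by
    intro j t s
    have := integrable_ite_one (μ := μ) ((hz (t, s)).pow_const 2) ((2 : ℝ) ^ j)
    exact ⟨this.1, this.2.trans_le (hGz (t, s) j)⟩
  have h2 := fun j => integral_cellSum_le LX LY (fun t s => (h1 j t s).1)
    (fun t s => (h1 j t s).2) (2 ^ (j + 1))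
  have h3 := ae_summable_of_integral_le (V := V)
    (fun j ω => div_nonneg (cellSum_nonneg _ _ (fun t s => by positivity) _) (by positivity))
    (fun j => (h2 j).1.div_const _) (hG.mul_left 4) fun j => by
      simp only [hV]
      rw [integral_div, div_le_iff₀ (by positivity)]
      refine (h2 j).2.trans (le_of_eq ?_)
      push_cast
      ring
  filter_upwards [h3] with ω hω
  refine squeeze_zero' (Eventually.of_forall fun n => div_nonneg
    (cellSum_nonneg _ _ (fun t s => by positivity) _) (Nat.cast_nonneg n)) ?_
    (hω.tendsto_atTop_zero.comp tendsto_log_two_atTop)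
  filter_upwards [eventually_gt_atTop 0] with n hn
  have hle := two_pow_log_le hn
  refine div_le_div₀ (cellSum_nonneg _ _ (fun t s => by positivity) _) ?_ (by positivity) hle
  refine le_trans (cellSum_le_cellSum _ _ (fun t s => ?_) n)
    (cellSum_mono_of_consistent hX hY (fun t s => by positivity) (le_two_pow_log_succ n))
  split_ifs with g1 g2
  · exact le_rfl
  · exact absurd (hle.trans_lt g1) g2
  · exact zero_le_one
  · exact le_rfl

/-- The inner sum divided by `2 ^ j` is, up to a constant, the convolution of `2 ^ l * G l` with a
geometric sequence. -/
lemma summable_truncated_moments {G : ℕ → ℝ} (hG0 : ∀ j, 0 ≤ G j)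
    (hG : Summable fun j => 2 ^ j * G j) (A C : ℝ) :
    Summable fun j : ℕ =>
      A * (8 * ((1 + ∑ l ∈ Finset.range (j + 1), 4 ^ (l + 1) * G l) + C)) / 2 ^ j := by
  have h1 := summable_convolution (fun j => mul_nonneg (by positivity) (hG0 j))
    (fun j => by positivity) hG summable_geometric_two
  have h2 := ((summable_geometric_two.mul_left (1 + C)).add (h1.mul_left 4)).mul_left (8 * A)
  refine h2.congr fun j => ?_
  have h3 : ∑ l ∈ Finset.range (j + 1), 2 ^ l * G l * (1 / 2 : ℝ) ^ (j - l) =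
      (∑ l ∈ Finset.range (j + 1), 4 ^ l * G l) / 2 ^ j := by
    rw [Finset.sum_div]
    refine Finset.sum_congr rfl fun l hl => ?_
    have hlj : l ≤ j := Nat.lt_succ_iff.1 (Finset.mem_range.1 hl)
    rw [show (2 : ℝ) ^ j = 2 ^ l * 2 ^ (j - l) by rw [← pow_add, Nat.add_sub_cancel' hlj], show (4 : ℝ) = 2 * 2 by norm_num, mul_pow, one_div, inv_pow]
    field_simp
  have h4 : ∑ l ∈ Finset.range (j + 1), 4 ^ (l + 1) * G l =
      4 * ∑ l ∈ Finset.range (j + 1), 4 ^ l * G l := by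
    rw [Finset.mul_sum]
    exact Finset.sum_congr rfl fun l _ => by ring
  rw [h3, h4, one_div, inv_pow]
  field_simp
  ring

/-- Both the size and the truncation level are raised from `n` to 2^(j+1), with 2^j ≤ n. Relative to
4^j the mean becomes at most 4e, which explains the condition on `b`. The variance, relative to
16^j, is of order 2^(-j) times a truncated fourth moment and hence summable. -/
lemma ae_eventually_truncated_le {ι κ Ω : Type*} [MeasurableSpace Ω] {μ : Measure Ω}
    [IsProbabilityMeasure μ] {LX : SymLink ι} {LY : SymLink κ} (hX : LX.Consistent)
    (hY : LY.Consistent) {D : ℕ} (hD : ∀ n, RowBound D (LX.val n) ∧ RowBound D (LY.val n))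
    {z z' : ι × κ → Ω → ℝ} (hz : ∀ q, Measurable (z q)) (hz' : ∀ q, Measurable (z' q))
    (htail : HasSummableTail z μ) {e C : ℝ}
    (he : ∀ q, Integrable (fun ω => (z q ω - z' q ω) ^ 2) μ ∧ ∫ ω, (z q ω - z' q ω) ^ 2 ∂μ ≤ e)
    (hC0 : 0 ≤ C) (hC : ∀ q, Integrable (fun ω => z' q ω ^ 4) μ ∧ ∫ ω, z' q ω ^ 4 ∂μ ≤ C)
    (hind : ∀ t t' s s', t ≠ t' → s ≠ s' → IndepFun (fun ω => (z (t, s) ω, z' (t, s) ω))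
      (fun ω => (z (t', s') ω, z' (t', s') ω)) μ) {b : ℝ} (hb : 4 * e < b) :
    ∀ᵐ ω ∂μ, ∀ᶠ n : ℕ in atTop, cellSum LX LY (fun t s => if z (t, s) ω ^ 2 ≤ n then
      (z (t, s) ω - z' (t, s) ω) ^ 2 else 0) n / (n : ℝ) ^ 2 ≤ b := by
  obtain ⟨G, hG0, hG, hGz⟩ := htail
  set f : ℕ → ι → κ → Ω → ℝ := fun j t s ω =>
    if z (t, s) ω ^ 2 ≤ 2 ^ (j + 1) then (z (t, s) ω - z' (t, s) ω) ^ 2 else 0 with hf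
  have hf0 : ∀ j t s ω, 0 ≤ f j t s ω := fun j t s ω => by
    simp only [hf]
    positivity
  have hφm : ∀ j : ℕ, Measurable fun p : ℝ × ℝ =>
      if p.1 ^ 2 ≤ 2 ^ (j + 1) then (p.1 - p.2) ^ 2 else 0 := fun j =>
    Measurable.ite (measurableSet_le (measurable_fst.pow_const 2) measurable_const)
      ((measurable_fst.sub measurable_snd).pow_const 2) measurable_const
  have hfm : ∀ j t s, Measurable (f j t s) := fun j t s =>
    (hφm j).comp ((hz (t, s)).prodMk (hz' (t, s)))
  have hfint : ∀ j t s, Integrable (f j t s) μ ∧ ∫ ω, f j t s ω ∂μ ≤ e := by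
    intro j t s
    have hle : ∀ ω, f j t s ω ≤ (z (t, s) ω - z' (t, s) ω) ^ 2 := by
      intro ω
      simp only [hf]
      split_ifs
      exacts [le_rfl, sq_nonneg _]
    have hi : Integrable (f j t s) μ := (he (t, s)).1.mono' (hfm j t s).aestronglyMeasurable
      (Eventually.of_forall fun ω => by
        rw [Real.norm_eq_abs, abs_of_nonneg (hf0 j t s ω)]
        exact hle ω)
    exact ⟨hi, (integral_mono hi (he (t, s)).1 hle).trans (he (t, s)).2⟩
  set M : ℕ → ℝ := fun j =>
    8 * ((1 + ∑ l ∈ Finset.range (j + 1), 4 ^ (l + 1) * G l) + C) with hM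
  have hM0 : ∀ j, 0 ≤ M j := fun j => by
    have := Finset.sum_nonneg fun l (_ : l ∈ Finset.range (j + 1)) =>
      mul_nonneg (by positivity : (0 : ℝ) ≤ 4 ^ (l + 1)) (hG0 l)
    simp only [hM]
    positivity
  have hfsq : ∀ j t s, Integrable (fun ω => f j t s ω ^ 2) μ ∧ ∫ ω, f j t s ω ^ 2 ∂μ ≤ M j := by
    intro j t s
    have h1 := integral_ite_sq_le (hz (t, s)) (hGz (t, s)) (j + 1)
    have h2 : Integrable (fun ω => 8 * ((if z (t, s) ω ^ 2 ≤ 2 ^ (j + 1) then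
        (z (t, s) ω ^ 2) ^ 2 else 0) + z' (t, s) ω ^ 4)) μ :=
      (h1.1.add (hC (t, s)).1).const_mul 8
    have hle : ∀ ω, f j t s ω ^ 2 ≤ 8 * ((if z (t, s) ω ^ 2 ≤ 2 ^ (j + 1) then
        (z (t, s) ω ^ 2) ^ 2 else 0) + z' (t, s) ω ^ 4) := by
      intro ω
      simp only [hf]
      split_ifs
      · have h3 : (z (t, s) ω - z' (t, s) ω) ^ 2 ≤ 2 * (z (t, s) ω ^ 2 + z' (t, s) ω ^ 2) := by
          nlinarith [sq_nonneg (z (t, s) ω + z' (t, s) ω)]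
        calc _ ≤ (2 * (z (t, s) ω ^ 2 + z' (t, s) ω ^ 2)) ^ 2 := by gcongr
          _ ≤ _ := by nlinarith [sq_nonneg (z (t, s) ω ^ 2 - z' (t, s) ω ^ 2)]
      · rw [zero_pow two_ne_zero]
        positivity
    have h3 : Integrable (fun ω => f j t s ω ^ 2) μ :=
      h2.mono' ((hfm j t s).pow_const 2).aestronglyMeasurable (Eventually.of_forall fun ω => by
        rw [Real.norm_eq_abs, abs_of_nonneg (sq_nonneg _)]
        exact hle ω)
    refine ⟨h3, (integral_mono h3 h2 hle).trans ?_⟩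
    rw [integral_const_mul, integral_add h1.1 (hC (t, s)).1]
    simp only [hM]
    gcongr
    exacts [h1.2, (hC (t, s)).2]
  have hfmem : ∀ j t s, MemLp (f j t s) 2 μ := fun j t s =>
    (memLp_two_iff_integrable_sq (hfm j t s).aestronglyMeasurable).2 (hfsq j t s).1
  set S : ℕ → Ω → ℝ := fun j ω => cellSum LX LY (fun t s => f j t s ω) (2 ^ (j + 1)) with hS
  have hSmean := fun j => integral_cellSum_le LX LY (fun t s => (hfint j t s).1)
    (fun t s => (hfint j t s).2) (2 ^ (j + 1))
  have hSvar : ∀ j, variance (S j) μ ≤ 2 * D * ((2 ^ (j + 1) : ℕ) : ℝ) ^ 3 * M j := fun j =>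
    variance_cellSum_le (hD _).1 (hD _).2 (hfmem j) (hM0 j) (fun t s => (hfsq j t s).2)
      fun t t' s s' ht hs => (hind t t' s s' ht hs).comp (hφm j) (hφm j)
  have hSmem : ∀ j, MemLp (S j) 2 μ := fun j =>
    memLp_finsetSum _ fun i _ => memLp_finsetSum _ fun i' _ => hfmem j _ _
  set V : ℕ → Ω → ℝ := fun j ω => ((S j ω - ∫ ω, S j ω ∂μ) / 4 ^ j) ^ 2 with hV
  have hVsum := ae_summable_of_integral_le (V := V) (fun j ω => sq_nonneg _)
    (fun j => by
      simp only [hV, div_pow]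
      exact ((hSmem j).sub (memLp_const _)).integrable_sq.div_const _)
    (summable_truncated_moments hG0 hG (16 * D) C) (fun j => by
      simp only [hV, div_pow]
      rw [integral_div, ← variance_eq_integral (hSmem j).1.aemeasurable, div_le_iff₀ (by positivity)]
      refine (hSvar j).trans (le_of_eq ?_)
      rw [hM]
      push_cast
      have : ((4 : ℝ) ^ j) ^ 2 = 2 ^ j * (2 ^ j) ^ 3 := by
        rw [show (4 : ℝ) = 2 * 2 by norm_num, mul_pow]
        ring
      rw [this, pow_succ]
      field_simp
      ring)
  filter_upwards [hVsum] with ω hω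
  have h1 : ∀ᶠ j in atTop, V j ω < (b - 4 * e) ^ 2 :=
    hω.tendsto_atTop_zero.eventually_lt_const (by have := sub_pos.2 hb; positivity)
  filter_upwards [tendsto_log_two_atTop.eventually h1, eventually_gt_atTop 0] with n hn hn0
  set j := Nat.log 2 n with hj
  have h2 : (S j ω - ∫ ω, S j ω ∂μ) / 4 ^ j < b - 4 * e :=
    lt_of_pow_lt_pow_left₀ 2 (sub_pos.2 hb).le hn
  have h3 : (∫ ω, S j ω ∂μ) / 4 ^ j ≤ 4 * e := by
    rw [div_le_iff₀ (by positivity)]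
    refine (hSmean j).2.trans (le_of_eq ?_)
    push_cast
    rw [show (4 : ℝ) ^ j = 2 ^ j * 2 ^ j by rw [← mul_pow]; norm_num]
    ring
  have h4 : S j ω / 4 ^ j ≤ b := by
    rw [sub_div] at h2
    linarith
  have hle := two_pow_log_le hn0
  refine le_trans (div_le_div₀ (hS ▸ cellSum_nonneg _ _ (fun t s => hf0 j t s ω) _) ?_
    (by positivity) ?_) h4
  · refine le_trans (cellSum_le_cellSum _ _ (fun t s => ?_) n)
      (cellSum_mono_of_consistent hX hY (fun t s => hf0 j t s ω) (le_two_pow_log_succ n))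
    simp only [hf]
    split_ifs with g1 g2
    · exact le_rfl
    · refine absurd (g1.trans ?_) g2
      exact_mod_cast le_two_pow_log_succ n
    · positivity
    · exact le_rfl
  · calc (4 : ℝ) ^ j = (2 ^ j) ^ 2 := by rw [← pow_mul, mul_comm, pow_mul]; norm_num
      _ ≤ (n : ℝ) ^ 2 := by gcongr

/-- The matrix `n^{-1/2} X_n ⊙ Y_n` with entries replaced by those of another such matrix where the
unscaled entry is larger than `√n` in absolute value. -/
noncomputable def truncatedProduct {ι κ : Type*} (LX : SymLink ι) (LY : SymLink κ)
    (z z' : ι × κ → ℝ) (n : ℕ) : Matrix (Fin n) (Fin n) ℝ :=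
  (√(n : ℝ))⁻¹ • Matrix.of fun i j => if z (LX.val n i j, LY.val n i j) ^ 2 ≤ n then
    z (LX.val n i j, LY.val n i j) else z' (LX.val n i j, LY.val n i j)

lemma truncatedProduct_isHermitian {ι κ : Type*} (LX : SymLink ι) (LY : SymLink κ)
    (z z' : ι × κ → ℝ) (n : ℕ) : (truncatedProduct LX LY z z' n).IsHermitian := by
  ext i j
  simp [truncatedProduct, LX.symm n j i, LY.symm n j i]

lemma sum_sq_truncatedProduct_sub {ι κ : Type*} (LX : SymLink ι) (LY : SymLink κ) (x x' : ι → ℝ)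
    (y y' : κ → ℝ) (n : ℕ) : (∑ i, ∑ j, (truncatedProduct LX LY (fun q => x q.1 * y q.2)
      (fun q => x' q.1 * y' q.2) n i j - scaledProduct LX LY x' y' n i j) ^ 2) / n =
      cellSum LX LY (fun t s => if (x t * y s) ^ 2 ≤ n then (x t * y s - x' t * y' s) ^ 2 else 0) n /
        (n : ℝ) ^ 2 := by
  have h : ∀ i j, (truncatedProduct LX LY (fun q => x q.1 * y q.2)
      (fun q => x' q.1 * y' q.2) n i j - scaledProduct LX LY x' y' n i j) ^ 2 =
      (n : ℝ)⁻¹ * if (x (LX.val n i j) * y (LY.val n i j)) ^ 2 ≤ n then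
        (x (LX.val n i j) * y (LY.val n i j) - x' (LX.val n i j) * y' (LY.val n i j)) ^ 2 else 0 := by
    intro i j
    simp only [truncatedProduct, scaledProduct, patternedMatrix, Matrix.smul_apply,
      Matrix.hadamard_apply, Matrix.of_apply, smul_eq_mul, ← mul_sub]
    rw [mul_pow, inv_pow, Real.sq_sqrt (Nat.cast_nonneg n)]
    split_ifs <;> simp
  simp_rw [h, ← Finset.mul_sum, cellSum]
  rw [div_eq_mul_inv, div_eq_mul_inv, pow_two, mul_inv]
  ring

lemma card_ne_truncatedProduct_le {ι κ : Type*} (LX : SymLink ι) (LY : SymLink κ) (x x' : ι → ℝ)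
    (y y' : κ → ℝ) (n : ℕ) : ((Finset.univ.filter fun q : Fin n × Fin n =>
      scaledProduct LX LY x y n q.1 q.2 ≠ truncatedProduct LX LY (fun q => x q.1 * y q.2)
      (fun q => x' q.1 * y' q.2) n q.1 q.2).card : ℝ) ≤
      cellSum LX LY (fun t s => if (n : ℝ) < (x t * y s) ^ 2 then 1 else 0) n := by
  rw [cellSum, ← Fintype.sum_prod_type' (f := fun i j => if (n : ℝ) <
    (x (LX.val n i j) * y (LY.val n i j)) ^ 2 then (1 : ℝ) else 0), Finset.sum_boole]
  gcongr with q
  intro hq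
  by_contra hle
  refine hq ?_
  simp [truncatedProduct, scaledProduct, patternedMatrix, not_lt.1 hle]

/-- The truncated matrix lies between the given one and its approximation. It differs from the first
in o(n) entries, where the entry count bound applies, and from the second by a small Frobenius norm.
Countably many approximations suffice, so the exceptional null sets can be united. -/
theorem isLimitAlmostSurely_of_consistent {ι κ Ω : Type*} {LX : SymLink ι} {LY : SymLink κ}
    (hX : LX.PropertyB) (hY : LY.PropertyB) (hc : Compatible LX LY) (hw : LeadsToWigner LX LY)
    (hXc : LX.Consistent) (hYc : LY.Consistent)
    [MeasurableSpace Ω] {μ : Measure Ω} [IsProbabilityMeasure μ] {x : ι → Ω → ℝ} {y : κ → Ω → ℝ}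
    (hx : IsStandardInput x μ) (hy : IsStandardInput y μ) (hxa : IsApproximable x μ)
    (hya : IsApproximable y μ) (hxt : HasSummableTail x μ) (hyt : HasSummableTail y μ)
    (hxy : IndepFun (fun ω t => x t ω) (fun ω s => y s ω) μ) :
    IsLimitAlmostSurely μ (productESD LX LY x y) semicircleLaw := by
  obtain ⟨D, hD⟩ := exists_rowBound hX hY
  have hε : ∀ k : ℕ, (0 : ℝ) < 1 / (k + 1) := fun k => by positivity
  choose φ hφ hφ3 hφε using fun k : ℕ => hxa _ (hε k)
  choose ψ hψ hψ3 hψε using fun k : ℕ => hya _ (hε k)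
  have hae1 : ∀ᵐ ω ∂μ, ∀ k s, Tendsto (fun n => (productESD LX LY (fun t ω => φ k t (x t ω))
      (fun t ω => ψ k t (y t ω)) n ω).real (Set.Iic s)) atTop
      (𝓝 (semicircleLaw.real (Set.Iic s))) :=
    ae_all_iff.2 fun k => isLimitAlmostSurely_of_inputA3 hX hY hc hw (hφ3 k) (hψ3 k)
      (indepFun_pi_comp hxy (hφ k) (hψ k))
  have hzm : ∀ q : ι × κ, Measurable fun ω => x q.1 ω * y q.2 ω := fun q =>
    (hx.measurable q.1).mul (hy.measurable q.2)
  have htail := hxt.mul hyt hxy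
  have hae2 := ae_tendsto_card_large hXc hYc hzm htail
  have hu := iIndepFun_sumElim hx.indep hy.indep hxy
  have hum : ∀ a, Measurable (Sum.elim x y a) := by
    rintro (t | s)
    exacts [hx.measurable t, hy.measurable s]
  -- An entry has mean error at most 4/(k + 1) and the dyadic comparison costs another factor 4; any
  -- constant above 16 will do.
  have hae3 : ∀ᵐ ω ∂μ, ∀ k : ℕ, ∀ᶠ n : ℕ in atTop, cellSum LX LY (fun t s =>
      if (x t ω * y s ω) ^ 2 ≤ n then
        (x t ω * y s ω - φ k t (x t ω) * ψ k s (y s ω)) ^ 2 else 0) n / (n : ℝ) ^ 2 ≤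
        17 * (1 / (k + 1)) := by
    refine ae_all_iff.2 fun k => ?_
    obtain ⟨C, hC⟩ := (hφ3 k).2 4
    obtain ⟨C', hC'⟩ := (hψ3 k).2 4
    refine ae_eventually_truncated_le hXc hYc hD (z := fun q ω => x q.1 ω * y q.2 ω)
      (z' := fun q ω => φ k q.1 (x q.1 ω) * ψ k q.2 (y q.2 ω)) hzm
      (fun q => ((hφ3 k).1.measurable q.1).mul ((hψ3 k).1.measurable q.2)) htail
      (e := 4 * (1 / (k + 1))) (C := max C 0 * max C' 0) (fun q =>
        integral_mul_sub_mul_sq_le hx hy hxy (hφ k) (hφ3 k).1 (hψ k) (hψ3 k).1 (hφε k) (hψε k)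
          q.1 q.2) (by positivity) (fun q => ?_) (fun t t' s s' ht hs => ?_) (by linarith [hε k])
    · have h4 : ∀ r : ℝ, |r| ^ 4 = r ^ 4 := fun r => Even.pow_abs (by decide) r
      have h1 := hC q.1
      have h2 := hC' q.2
      simp only [h4] at h1 h2
      have hind := indepFun_apply hxy q.1 q.2 (F := fun r => φ k q.1 r ^ 4)
        (G := fun r => ψ k q.2 r ^ 4) ((hφ k q.1).pow_const 4) ((hψ k q.2).pow_const 4)
      have e1 := hind.integral_fun_mul_eq_mul_integral h1.1.1 h2.1.1
      simp only [mul_pow]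
      refine ⟨hind.integrable_mul h1.1 h2.1, e1.trans_le ?_⟩
      exact mul_le_mul (h1.2.trans (le_max_left _ _)) (h2.2.trans (le_max_left _ _))
        (integral_nonneg fun ω => by positivity) (le_max_right _ _)
    · have h1 := hu.indepFun_prodMk_prodMk hum (.inl t) (.inr s) (.inl t') (.inr s') (by simpa)
        (by simp) (by simp) (by simpa)
      have h2 : ∀ t s, Measurable fun p : ℝ × ℝ => (p.1 * p.2, φ k t p.1 * ψ k s p.2) :=
        fun t s => (measurable_fst.mul measurable_snd).prodMk
          (((hφ k t).comp measurable_fst).mul ((hψ k s).comp measurable_snd))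
      exact h1.comp (h2 t s) (h2 t' s')
  filter_upwards [hae1, hae2, hae3] with ω h1 h2 h3 s hs
  set F : ℝ → ℝ := fun r => semicircleLaw.real (Set.Iic r) with hF
  rw [Metric.tendsto_atTop]
  intro η' hη'
  obtain ⟨η, hη, rfl⟩ : ∃ η > 0, η' = 3 * η := ⟨η' / 3, by positivity, by ring⟩
  obtain ⟨δ, hδ, hδ1, hδ2⟩ := exists_pos_abs_sub_lt hs hη
  obtain ⟨k, hk⟩ : ∃ k : ℕ, 17 * (1 / ((k : ℝ) + 1)) < (δ * (η / 2)) ^ 2 := by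
    obtain ⟨k, hk⟩ := exists_nat_one_div_lt (show 0 < (δ * (η / 2)) ^ 2 / 17 by positivity)
    exact ⟨k, by linarith⟩
  have hev : ∀ r, ∀ᶠ n in atTop, |(productESD LX LY (fun t ω => φ k t (x t ω))
      (fun t ω => ψ k t (y t ω)) n ω).real (Set.Iic r) - F r| < η := fun r =>
    (Metric.tendsto_nhds.1 (h1 k r)) η hη
  have hfin := (((hev (s - δ)).and (hev (s + δ))).and (h3 k)).and
    (h2.eventually_lt_const (half_pos hη))
  obtain ⟨N, hN⟩ := eventually_atTop.1 hfin
  refine ⟨N, fun n hn => ?_⟩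
  obtain ⟨⟨⟨g1, g2⟩, g3⟩, g4⟩ := hN n hn
  set B := truncatedProduct_isHermitian LX LY (fun q => x q.1 ω * y q.2 ω)
    (fun q => φ k q.1 (x q.1 ω) * ψ k q.2 (y q.2 ω)) n with hB
  set A := scaledProduct_isHermitian LX LY (fun t => x t ω) (fun s => y s ω) n with hA
  set A' := scaledProduct_isHermitian LX LY (fun t => φ k t (x t ω)) (fun s => ψ k s (y s ω)) n
    with hA'
  have hT : (∑ i, ∑ j, (truncatedProduct LX LY (fun q => x q.1 ω * y q.2 ω)
      (fun q => φ k q.1 (x q.1 ω) * ψ k q.2 (y q.2 ω)) n i j - scaledProduct LX LY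
      (fun t => φ k t (x t ω)) (fun s => ψ k s (y s ω)) n i j) ^ 2) / n < (δ * (η / 2)) ^ 2 :=
    (sum_sq_truncatedProduct_sub LX LY (fun t => x t ω) (fun t => φ k t (x t ω))
      (fun s => y s ω) (fun s => ψ k s (y s ω)) n).trans_lt (g3.trans_lt hk)
  have he : ∀ T : ℝ, T < (δ * (η / 2)) ^ 2 → δ⁻¹ * √T < η / 2 := fun T hT => by
    rw [inv_mul_lt_iff₀ hδ, Real.sqrt_lt' (by positivity)]
    exact hT
  have k1 := esd_Iic_le_of_sum_sq A' B (s - δ) hδ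
  have k2 := esd_Iic_le_of_sum_sq B A' s hδ
  simp_rw [sub_sq_comm (scaledProduct LX LY (fun t => φ k t (x t ω)) (fun s => ψ k s (y s ω)) n _ _)]
    at k1
  rw [sub_add_cancel] at k1
  have k3 := esd_Iic_le_of_card_ne A B s
  have k4 := esd_Iic_le_of_card_ne B A s
  simp_rw [ne_comm (a := truncatedProduct LX LY _ _ n _ _)] at k4
  have hcard : ((Finset.univ.filter fun q : Fin n × Fin n => scaledProduct LX LY (fun t => x t ω)
      (fun s => y s ω) n q.1 q.2 ≠ truncatedProduct LX LY (fun q => x q.1 ω * y q.2 ω)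
      (fun q => φ k q.1 (x q.1 ω) * ψ k q.2 (y q.2 ω)) n q.1 q.2).card : ℝ) / n < η / 2 := by
    refine lt_of_le_of_lt ?_ g4
    gcongr
    exact card_ne_truncatedProduct_le LX LY (fun t => x t ω) (fun t => φ k t (x t ω))
      (fun s => y s ω) (fun s => ψ k s (y s ω)) n
  have he' := he _ hT
  exact abs_sub_lt_of_sandwich hδ1 hδ2 g1 g2 (add_lt_add he' hcard |>.trans_eq (add_halves η))
    (by rw [← add_assoc, add_right_comm]; exact (k1.trans (add_le_add k4 le_rfl)))
    (by rw [← add_assoc]; exact (k3.trans (add_le_add k2 le_rfl)))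

end SchurHadamard

/-! ### The main theorem -/

theorem mainTheorem4 {ι κ : Type*} (LX : SchurHadamard.SymLink ι) (LY : SchurHadamard.SymLink κ)
    (hBX : LX.PropertyB) (hBY : LY.PropertyB) :
    (SchurHadamard.Compatible LX LY → SchurHadamard.LeadsToWigner LX LY →
      ∀ {Ω : Type*} [MeasurableSpace Ω] (μ : Measure Ω) [IsProbabilityMeasure μ]
        (x : ι → Ω → ℝ) (y : κ → Ω → ℝ),
        (SchurHadamard.InputA1 x μ ∨ SchurHadamard.InputA2 x μ ∨ SchurHadamard.InputA3 x μ) →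
        (SchurHadamard.InputA1 y μ ∨ SchurHadamard.InputA2 y μ ∨ SchurHadamard.InputA3 y μ) →
        IndepFun (fun ω t => x t ω) (fun ω s => y s ω) μ →
        ((SchurHadamard.InputA1 x μ ∧ SchurHadamard.InputA1 y μ) ∨
          (LX.GrowthConditions ∧ LY.GrowthConditions)) →
        SchurHadamard.IsLimitInProbability μ (SchurHadamard.productESD LX LY x y)
            SchurHadamard.semicircleLaw ∧
          ((((SchurHadamard.InputA1 x μ ∨ SchurHadamard.InputA3 x μ) ∧
              (SchurHadamard.InputA1 y μ ∨ SchurHadamard.InputA3 y μ)) ∨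
              (LX.Consistent ∧ LY.Consistent)) →
            SchurHadamard.IsLimitAlmostSurely μ (SchurHadamard.productESD LX LY x y)
              SchurHadamard.semicircleLaw)) ∧
    (SchurHadamard.DetermineWigner LX LY → SchurHadamard.LeadsToWigner LX LY) := by
  refine ⟨fun hc hw Ω _ μ _ x y hx hy hxy _ => ?_,
    SchurHadamard.leadsToWigner_of_determineWigner hBX hBY⟩
  have hx' : SchurHadamard.InputA2 x μ ∨ SchurHadamard.InputA3 x μ := by
    rcases hx with h | h | h
    exacts [.inr h.inputA3, .inl h, .inr h]
  have hy' : SchurHadamard.InputA2 y μ ∨ SchurHadamard.InputA3 y μ := by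
    rcases hy with h | h | h
    exacts [.inr h.inputA3, .inl h, .inr h]
  have hxs : SchurHadamard.IsStandardInput x μ := hx'.elim And.left And.left
  have hys : SchurHadamard.IsStandardInput y μ := hy'.elim And.left And.left
  have hxa : SchurHadamard.IsApproximable x μ :=
    hx'.elim (fun h => h.isApproximable) fun h => h.isApproximable
  have hya : SchurHadamard.IsApproximable y μ :=
    hy'.elim (fun h => h.isApproximable) fun h => h.isApproximable
  refine ⟨SchurHadamard.isLimitInProbability_of_isApproximable hBX hBY hc hw hxs hys hxa hya hxy, ?_⟩
  rintro (⟨hx, hy⟩ | ⟨hXc, hYc⟩)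
  · have h := SchurHadamard.isLimitAlmostSurely_of_inputA3 hBX hBY hc hw
      (hx.elim (fun h => h.inputA3) id) (hy.elim (fun h => h.inputA3) id) hxy
    filter_upwards [h] with ω hω s _ using hω s
  · exact SchurHadamard.isLimitAlmostSurely_of_consistent hBX hBY hc hw hXc hYc hxs hys hxa hya
      (hx'.elim (fun h => h.hasSummableTail) fun h => h.hasSummableTail)
      (hy'.elim (fun h => h.hasSummableTail) fun h => h.hasSummableTail) hxy
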